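/- Let $n\ge 2$, and let $m>0$ be an integer or a half-integer (an odd integer divided by $2$). Let $$\mathcal A=\mathcal A^{\tilde B_n}_m=\{(x_1,\dots,x_n)\in\mathbb R^n:\ x_1>x_2>\dots>x_n>0\ \text{and}\ x_1+x_2<2m\},$$ and let $\eta=(\eta_1,\dots,\eta_n)\in\mathcal A$ be a vector all of whose components are integers or all of whose components are half-integers. Let $N_k$ be the number of walks $\eta=w_0,w_1,\dots,w_k$ (with arbitrary end point) such that every step $w_i-w_{i-1}$ is of the form $\pm\frac12e_1\pm\frac12e_2\pm\dots\pm\frac12e_n$ (any choice of signs) and all of $w_0,\dots,w_k$ lie in $\mathcal A$. Put $$R=2^n\prod_{j=1}^n\cos\frac{(2j-1)\pi}{4m},$$ $$E(\eta)=\prod_{1\le h<t\le n}\Big(\sin\tfrac{\pi(\eta_h-\eta_t)}{2m}\,\sin\tfrac{\pi(t-h)}{2m}\,\sin\tfrac{\pi(\eta_h+\eta_t)}{2m}\,\sin\tfrac{\pi(t+h)}{2m}\Big)\prod_{h=1}^n\Big(\sin\tfrac{\pi\eta_h}{2m}\,\sin\tfrac{\pi h}{2m}\Big),$$ $$O(\eta)=\prod_{1\le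 h<t\le n}\Big(\sin\tfrac{\pi(\eta_h-\eta_t)}{2m}\,\sin\tfrac{\pi(t-h)}{2m}\,\sin\tfrac{\pi(\eta_h+\eta_t)}{2m}\,\sin\tfrac{\pi(t+h-1)}{2m}\Big)\prod_{h=1}^n\Big(\sin\tfrac{\pi\eta_h}{2m}\,\sin\tfrac{\pi(2h-1)}{4m}\Big),$$ $$P(c)=\prod_{h=1}^{2n}\frac{\sin\frac{\pi(c-n+h)}{4m}}{\sin\frac{\pi h}{4m}}\ \prod_{h=1}^{n-1}\prod_{t=1}^{n}\frac{\sin\frac{\pi(c+t-h)}{2m}}{\sin\frac{\pi(n+t-h)}{2m}},$$ $$Q(c)=\prod_{h=1}^{2n}\frac{\sin\frac{\pi(c-n+h)}{4m}}{\sin\frac{\pi h}{4m}}\ \prod_{h=1}^{n}\prod_{t=1}^{n}\frac{\sin\frac{\pi(c+t-h)}{2m}}{\sin\frac{\pi(n+t-h)}{2m}}\ \prod_{h=1}^{n}\frac{\sin\frac{\pi h}{2m}}{\sin\frac{\pi(c-n+2h)}{4m}}\cdot\frac{\cos\frac{\pi(2h-1)}{4m}}{\cos\frac{\pi(c-n+2h-1)}{4m}}.$$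 Then the following holds, where the parity of $k+2\eta_j$ does not depend on $j$, and where $a_k\sim b_k$ means that $a_k=(1+\varepsilon_k)b_k$ for all large $k$ of the parity considered, with $\varepsilon_k\to0$. 1. If $m$ is an integer, then, as $k\to\infty$ with $k+2\eta_j$ even, $$N_k\sim\frac{4^{n^2}}{2(2m)^n}\,R^k\,E(\eta)\,\big(P(m)+P(m-1)\big).$$ 2. If $m$ is a half-integer, then, as $k\to\infty$ with $k+2\eta_j$ even, $$N_k\sim\frac{4^{n^2}}{(2m)^n}\,R^k\,E(\eta)\,P(\lfloor m\rfloor).$$ 3. If $m$ is an integer, then, as $k\to\infty$ with $k+2\eta_j$ odd, $$N_k\sim\frac{4^{n^2}}{(2m)^n}\,R^k\,O(\eta)\,Q(m).$$ 4. If $m$ is a half-integer, then, as $k\to\infty$ with $k+2\eta_j$ odd, $$N_k\sim\frac{4^{n^2}}{2(2m)^n}\,R^k\,O(\eta)\,\big(Q(\lceil m\rceil)+Q(\lfloor m\rfloor)\big).$$ (In the degenerate case $m=n-\frac12$ one has $R=0$ and some factors of $P$ and $Q$ have denominator $0$; with any values assigned to these factors, items 2 and 4 then say that $N_k=0$ for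 all large $k$ of the parity in question. In all other cases every denominator is nonzero.) -/

import Mathlib

open scoped BigOperators

namespace AlcoveWalk

/-- A real number that is an integer. -/
def IsInteger (x : ℝ) : Prop := ∃ z : ℤ, x = z

/-- A real number that is an odd integer divided by `2`. -/
def IsHalfInteger (x : ℝ) : Prop := ∃ z : ℤ, x = (2 * (z : ℝ) + 1) / 2

/-- The scaled alcove of type `B̃ₙ`, for `n ≥ 2`: the points of `ℝⁿ` with
`x₁ > x₂ > ⋯ > xₙ > 0` and `x₁ + x₂ < 2m` (coordinates are indexed from `0`). -/
def alcoveB {n : ℕ} (hn : 2 ≤ n) (m : ℝ) : Set (Fin n → ℝ) :=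
  {x | (∀ i j : Fin n, i < j → x j < x i) ∧ (∀ i : Fin n, 0 < x i) ∧
    x ⟨0, by omega⟩ + x ⟨1, by omega⟩ < 2 * m}

/-- The step vectors `±e₁/2 ± e₂/2 ± ⋯ ± eₙ/2`. -/
def IsDiagonalStep {n : ℕ} (s : Fin n → ℝ) : Prop := ∀ j, s j = 1 / 2 ∨ s j = -(1 / 2)

/-- The walks with exactly `k` diagonal steps that start at `η`, all of whose `k + 1` positions
lie in the region `A`. A walk is recorded as the sequence of its positions. -/
def diagonalWalks {n : ℕ} (A : Set (Fin n → ℝ)) (η : Fin n → ℝ) (k : ℕ) :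
    Set (Fin (k + 1) → Fin n → ℝ) :=
  {w | w 0 = η ∧ (∀ i : Fin k, IsDiagonalStep (w i.succ - w i.castSucc)) ∧ ∀ i, w i ∈ A}

/-- The number of such walks (with free end point). -/
noncomputable def numDiagonalWalks {n : ℕ} (A : Set (Fin n → ℝ)) (η : Fin n → ℝ) (k : ℕ) : ℕ :=
  (diagonalWalks A η k).ncard

/-- The one-based value of an index. -/
def idx {n : ℕ} (h : Fin n) : ℝ := ((h : ℕ) : ℝ) + 1

/-- The growth rate `2ⁿ ∏_{j=1}^n cos((2j-1)π/(4m))`. -/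
noncomputable def growthRate (n : ℕ) (m : ℝ) : ℝ :=
  2 ^ n * ∏ j ∈ Finset.Icc 1 n, Real.cos ((2 * (j : ℝ) - 1) * Real.pi / (4 * m))

/-- The `η`-dependent product accompanying even `k + 2ηⱼ`:
`∏_{h<t} (sin(π(η_h-η_t)/2m) sin(π(t-h)/2m) sin(π(η_h+η_t)/2m) sin(π(t+h)/2m))`
`· ∏_h (sin(πη_h/2m) sin(πh/2m))`. -/
noncomputable def startFactorEven {n : ℕ} (m : ℝ) (η : Fin n → ℝ) : ℝ :=
  (∏ h : Fin n, ∏ t ∈ Finset.Ioi h,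
    (Real.sin (Real.pi * (η h - η t) / (2 * m)) *
      Real.sin (Real.pi * (idx t - idx h) / (2 * m)) *
      Real.sin (Real.pi * (η h + η t) / (2 * m)) *
      Real.sin (Real.pi * (idx t + idx h) / (2 * m)))) *
  ∏ h : Fin n,
    (Real.sin (Real.pi * η h / (2 * m)) * Real.sin (Real.pi * idx h / (2 * m)))

/-- The `η`-dependent product accompanying odd `k + 2ηⱼ`:
`∏_{h<t} (sin(π(η_h-η_t)/2m) sin(π(t-h)/2m) sin(π(η_h+η_t)/2m) sin(π(t+h-1)/2m))`
`· ∏_h (sin(πη_h/2m) sin(π(2h-1)/4m))`. -/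
noncomputable def startFactorOdd {n : ℕ} (m : ℝ) (η : Fin n → ℝ) : ℝ :=
  (∏ h : Fin n, ∏ t ∈ Finset.Ioi h,
    (Real.sin (Real.pi * (η h - η t) / (2 * m)) *
      Real.sin (Real.pi * (idx t - idx h) / (2 * m)) *
      Real.sin (Real.pi * (η h + η t) / (2 * m)) *
      Real.sin (Real.pi * (idx t + idx h - 1) / (2 * m)))) *
  ∏ h : Fin n,
    (Real.sin (Real.pi * η h / (2 * m)) * Real.sin (Real.pi * (2 * idx h - 1) / (4 * m)))

/-- `P(c) = ∏_{h=1}^{2n} sin(π(c-n+h)/4m) / sin(πh/4m)`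
`· ∏_{h=1}^{n-1} ∏_{t=1}^{n} sin(π(c+t-h)/2m) / sin(π(n+t-h)/2m)`. -/
noncomputable def endFactorEven (n : ℕ) (m c : ℝ) : ℝ :=
  (∏ h ∈ Finset.Icc 1 (2 * n),
    Real.sin (Real.pi * (c - n + h) / (4 * m)) / Real.sin (Real.pi * h / (4 * m))) *
  ∏ h ∈ Finset.Icc 1 (n - 1), ∏ t ∈ Finset.Icc 1 n,
    Real.sin (Real.pi * (c + t - h) / (2 * m)) / Real.sin (Real.pi * (n + t - h) / (2 * m))

/-- `Q(c) = ∏_{h=1}^{2n} sin(π(c-n+h)/4m) / sin(πh/4m)`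
`· ∏_{h=1}^{n} ∏_{t=1}^{n} sin(π(c+t-h)/2m) / sin(π(n+t-h)/2m)`
`· ∏_{h=1}^{n} (sin(πh/2m) / sin(π(c-n+2h)/4m)) (cos(π(2h-1)/4m) / cos(π(c-n+2h-1)/4m))`. -/
noncomputable def endFactorOdd (n : ℕ) (m c : ℝ) : ℝ :=
  (∏ h ∈ Finset.Icc 1 (2 * n),
    Real.sin (Real.pi * (c - n + h) / (4 * m)) / Real.sin (Real.pi * h / (4 * m))) *
  (∏ h ∈ Finset.Icc 1 n, ∏ t ∈ Finset.Icc 1 n,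
    Real.sin (Real.pi * (c + t - h) / (2 * m)) / Real.sin (Real.pi * (n + t - h) / (2 * m))) *
  ∏ h ∈ Finset.Icc 1 n,
    (Real.sin (Real.pi * h / (2 * m)) / Real.sin (Real.pi * (c - n + 2 * h) / (4 * m)) *
      (Real.cos (Real.pi * (2 * h - 1) / (4 * m)) /
        Real.cos (Real.pi * (c - n + 2 * h - 1) / (4 * m))))

/-- `k → ∞` through those `k` for which `k + 2ηⱼ` is an even integer for every `j`. -/
def evenSteps {n : ℕ} (η : Fin n → ℝ) : Filter ℕ :=
  Filter.atTop ⊓ Filter.principal {k | ∀ j, ∃ l : ℤ, Even l ∧ (k : ℝ) + 2 * η j = l}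

/-- `k → ∞` through those `k` for which `k + 2ηⱼ` is an odd integer for every `j`. -/
def oddSteps {n : ℕ} (η : Fin n → ℝ) : Filter ℕ :=
  Filter.atTop ⊓ Filter.principal {k | ∀ j, ∃ l : ℤ, Odd l ∧ (k : ℝ) + 2 * η j = l}

end AlcoveWalk

/-! Double all coordinates and put `M = 2m`, `α = π/(2M)`. The walk then lives on the finite set of
strictly decreasing positive integer vectors of constant parity with `z₁ + z₂ < 2M`, each step
changes every coordinate by `±1`, and `N_k` is a row sum of the `k`-th power of a symmetric,
connected 0-1 matrix `T` that is bipartite by parity.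

The vector `v(z) = det sin((2i+1) α z_j)` is an eigenvector of `T` for the eigenvalue `R`: summing
over all sign choices multiplies row `i` by `2 cos((2i+1)α)`, and `v` vanishes at every point that a
step out of the alcove can reach. It factors as `2^(n(n-1))` times a product of sines (`sinDet_eq`),
hence is positive inside. Perron-Frobenius together with the spectral theorem
(`tendsto_pow_mulVec_one_div`) gives `N_k / R^k → v(x) ∑ v / ∑ v²`, both sums running over the
parity class of the end points.

Both sums are evaluated in closed form. The reflection `z₁ ↦ 2M - z₁` preserves the alcove and `v`,
so each class is covered by two families of decreasing sequences `2s + b`, with `b = 2` for even and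
`b = 1` for odd coordinates (`sum_latticeAlcove_eq`); this is the origin of the two summands in the
answers. The sum of squares becomes, by Cauchy-Binet, a sum of two Gram determinants, which is
`2(M/4)^n` by discrete orthogonality of sines. The linear sum rests on a bounded Schur function
identity (`powSum_mul_denomProd`): the sum of `det(zᵢ^(sⱼ))` over decreasing `s` bounded by `c` is a
quotient of an odd orthogonal type determinant by its denominator. Symmetrizing it under `ζᵢ ↦ ζᵢ⁻¹`
and specializing to roots of unity makes all factors sine products at arithmetic progressions
(`sum_sinProd_mul`), which regroup into `P` and `Q`.

A nonempty alcove forces `2n ≤ M + 1`. In the extreme case `M = 2n - 1` one has `R = 0`, and then `T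
v = 0` with `v > 0` forces `T = 0`. -/

namespace AlcoveWalk

open Matrix Finset Filter Topology

/-! ### A recursion for determinants of the type of odd orthogonal characters of rectangular shape.
-/

section RectangularDeterminant

variable {K : Type*} [Field K]

/-- The determinant with entries `uᵢ zᵢ^(n-1-j) - wᵢ zᵢ^j`. -/
def recipDet {n : ℕ} (u w z : Fin n → K) : K :=
  det (of fun i j : Fin n => u i * z i ^ (j.rev : ℕ) - w i * z i ^ (j : ℕ))

/-- The border column `uᵢ (zᵢ - 1) ∏_{j ≠ i} (zᵢ zⱼ - 1)`. -/
def borderCol {n : ℕ} (u z : Fin n → K) (i : Fin n) : K :=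
  u i * ((z i - 1) * ∏ j ∈ univ.erase i, (z i * z j - 1))

/-- The matrix of `recipDet` in one dimension less, bordered by `borderCol`. -/
def borderMat {n : ℕ} (u w z : Fin (n + 1) → K) : Matrix (Fin (n + 1)) (Fin (n + 1)) K :=
  of fun i => Fin.cons (borderCol u z i)
    fun j : Fin n => u i * z i ^ (j.rev : ℕ) - w i * z i ^ (j : ℕ)

/-- Subtracting `z 0` times each column from the next one clears row `0` apart from its first entry.
The remaining minor has the same shape with modified weights, which is why arbitrary `u` and `w` are
carried along. -/
theorem recipDet_zero_left {n : ℕ} (u w z : Fin (n + 1) → K) (h : u 0 = 0) :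
    recipDet u w z = -w 0 * recipDet (fun k : Fin n => u k.succ * (1 - z 0 * z k.succ))
      (fun k => w k.succ * (z k.succ - z 0)) (fun k => z k.succ) := by
  unfold recipDet
  rw [det_eq_of_forall_col_eq_smul_add_pred (B := of fun i => Fin.cons (u i * z i ^ n - w i)
    fun j : Fin n => u i * (1 - z 0 * z i) * z i ^ (j.rev : ℕ) - w i * (z i - z 0) * z i ^ (j : ℕ))
    (fun _ => z 0)]
  · rw [det_succ_row_zero, Fin.sum_univ_succ]
    simp only [of_apply, Fin.cons_zero, Fin.cons_succ, h, zero_mul, sub_self, mul_zero,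
      sum_const_zero, add_zero, Fin.val_zero, pow_zero, one_mul, zero_sub]
    congr 1
  · intro i
    simp
  · intro i j
    have h1 : (j.succ.rev : ℕ) = j.rev := by simp [Fin.val_rev]
    have h2 : (j.castSucc.rev : ℕ) = j.rev + 1 := by simp only [Fin.val_rev, Fin.val_castSucc]; omega
    simp only [of_apply, Fin.cons_succ, h1, h2, Fin.val_succ, Fin.val_castSucc, pow_succ]
    ring

theorem det_borderMat_zero_left {n : ℕ} (u w z : Fin (n + 2) → K) (h : u 0 = 0) :
    (borderMat u w z).det = -w 0 * (borderMat (fun k : Fin (n + 1) =>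
      u k.succ * (1 - z 0 * z k.succ))
      (fun k => w k.succ * (z k.succ - z 0)) (fun k => z k.succ)).det := by
  rw [det_eq_of_forall_col_eq_smul_add_pred (B := of fun i => Fin.cons (borderCol u z i)
    (Fin.cons (u i * z i ^ n - w i)
    fun j : Fin n => u i * (1 - z 0 * z i) * z i ^ (j.rev : ℕ) - w i * (z i - z 0) * z i ^ (j : ℕ)))
    -- The coefficient `0` protects the first power column: it must not be reduced by the border
    -- column to its left.
    (Fin.cons 0 fun _ => z 0)]
  · have h0 : borderCol u z 0 = 0 := by simp [borderCol, h]
    rw [det_succ_row_zero, Fin.sum_univ_succ, Fin.sum_univ_succ]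
    simp only [of_apply, Fin.cons_zero, Fin.cons_succ, h, zero_mul, sub_self, mul_zero,
      sum_const_zero, add_zero, Fin.val_zero, pow_zero, one_mul, zero_sub, h0, zero_add,
      Fin.val_succ, pow_one, neg_mul, mul_neg, neg_neg]
    have : (borderMat (fun k : Fin (n + 1) => u k.succ * (1 - z 0 * z k.succ))
      (fun k => w k.succ * (z k.succ - z 0)) (fun k => z k.succ)).det =
      - det ((of fun i => Fin.cons (borderCol u z i) (Fin.cons (u i * z i ^ n - w i)
        fun j : Fin n => u i * (1 - z 0 * z i) * z i ^ (j.rev : ℕ)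
          - w i * (z i - z 0) * z i ^ (j : ℕ)) : Matrix (Fin (n + 2)) (Fin (n + 2)) K).submatrix
            Fin.succ (Fin.succAbove (Fin.succ 0))) := by
      -- The factor `1 - z₀ z_k` absorbed into the new `u` is minus the factor `z_k z₀ - 1` missing
      -- from the new border column. This sign cancels the one from expanding row `0` at column `1`.
      have e : (of fun (i : Fin (n + 1)) (j : Fin (n + 1)) =>
          (Fin.cons (-1) (fun _ => 1) : Fin (n + 1) → K) j *
          (borderMat (fun k : Fin (n + 1) => u k.succ * (1 - z 0 * z k.succ))
            (fun k => w k.succ * (z k.succ - z 0)) (fun k => z k.succ)) i j) =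
          ((of fun i => Fin.cons (borderCol u z i) (Fin.cons (u i * z i ^ n - w i)
        fun j : Fin n => u i * (1 - z 0 * z i) * z i ^ (j.rev : ℕ)
          - w i * (z i - z 0) * z i ^ (j : ℕ)) : Matrix (Fin (n + 2)) (Fin (n + 2)) K).submatrix
            Fin.succ (Fin.succAbove (Fin.succ 0))) := by
        ext i j
        refine Fin.cases ?_ (fun j => ?_) j
        · simp only [of_apply, submatrix_apply, Fin.cons_zero, borderMat, borderCol]
          have hs : (Fin.succ 0 : Fin (n + 2)).succAbove 0 = 0 := by
            simp
          rw [hs, Fin.cons_zero]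
          have hp : (univ.erase i.succ : Finset (Fin (n + 2))) =
              insert 0 ((univ.erase i).map (Fin.succEmb _)) := by
            ext k
            refine Fin.cases ?_ (fun k => ?_) k
            · simpa using (Fin.succ_ne_zero i).symm
            · simp
          rw [hp, prod_insert (by simp), prod_map]
          simp only [Fin.coe_succEmb]
          ring
        · simp only [of_apply, submatrix_apply, Fin.cons_succ, borderMat]
          have hs : (Fin.succ 0 : Fin (n + 2)).succAbove j.succ = j.succ.succ := by
            rw [Fin.succ_succAbove_succ]; simp
          rw [hs, Fin.cons_succ, Fin.cons_succ, one_mul]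
      rw [← e, det_mul_row, Fin.prod_univ_succ]
      simp
    rw [this]
    ring
  · intro i
    simp [borderMat]
  · intro i j
    refine Fin.cases ?_ (fun j => ?_) j
    · simp [borderMat]
    have h1 : (j.succ.rev : ℕ) = j.rev := by simp [Fin.val_rev]
    have h2 : (j.castSucc.rev : ℕ) = j.rev + 1 := by simp only [Fin.val_rev, Fin.val_castSucc]; omega
    simp only [borderMat, of_apply, Fin.cons_succ, h1, Fin.val_succ, ← Fin.succ_castSucc, h2,
      Fin.val_castSucc, pow_succ]
    ring

theorem recipDet_comp_perm {n : ℕ} (σ : Equiv.Perm (Fin n)) (u w z : Fin n → K) :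
    recipDet (u ∘ σ) (w ∘ σ) (z ∘ σ) = (Equiv.Perm.sign σ : K) * recipDet u w z := by
  unfold recipDet
  rw [← det_permute σ]
  rfl

theorem borderCol_comp_perm {n : ℕ} (σ : Equiv.Perm (Fin n)) (u z : Fin n → K) (i : Fin n) :
    borderCol (u ∘ σ) (z ∘ σ) i = borderCol u z (σ i) := by
  unfold borderCol
  congr 2
  refine prod_bij (fun j _ => σ j) ?_ ?_ ?_ ?_
  · simp
  · simp
  · intro b hb
    exact ⟨σ.symm b, by simpa [Equiv.symm_apply_eq] using hb, by simp⟩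
  · simp

theorem det_borderMat_comp_perm {n : ℕ} (σ : Equiv.Perm (Fin (n + 1))) (u w z : Fin (n + 1) → K) :
    (borderMat (u ∘ σ) (w ∘ σ) (z ∘ σ)).det = (Equiv.Perm.sign σ : K) * (borderMat u w z).det := by
  rw [← det_permute σ]
  congr 1
  ext i j
  refine Fin.cases ?_ (fun j => ?_) j
  · simp [borderMat, borderCol_comp_perm]
  · simp [borderMat]

/-- Each row is a `u`-part minus a `w`-part; linearity in row `i` separates them. -/
theorem recipDet_update {n : ℕ} (u w z : Fin n → K) (i : Fin n) :
    recipDet u w z = recipDet u (Function.update w i 0) z + recipDet (Function.update u i 0) w z := by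
  unfold recipDet
  have := det_updateRow_add (of fun i j : Fin n => u i * z i ^ (j.rev : ℕ) - w i * z i ^ (j : ℕ)) i
    (fun j => u i * z i ^ (j.rev : ℕ)) (fun j => - w i * z i ^ (j : ℕ))
  refine (congrArg det ?_).trans
    (this.trans (congrArg₂ (· + ·) (congrArg det ?_) (congrArg det ?_)))
  all_goals
    ext a b
    by_cases h : a = i
    · subst h; simp; try ring
    · simp [h]

theorem det_borderMat_update {n : ℕ} (u w z : Fin (n + 1) → K) (i : Fin (n + 1)) :
    (borderMat u w z).det = (borderMat u (Function.update w i 0) z).det +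
      (borderMat (Function.update u i 0) w z).det := by
  have := det_updateRow_add (borderMat u w z) i
    (borderMat u (Function.update w i 0) z i) (borderMat (Function.update u i 0) w z i)
  refine (congrArg det ?_).trans
    (this.trans (congrArg₂ (· + ·) (congrArg det ?_) (congrArg det ?_)))
  · ext a b
    by_cases h : a = i
    · subst h
      refine Fin.cases ?_ (fun j => ?_) b
      · simp [borderMat, borderCol]
      · simp [borderMat]; ring
    · simp [h]
  · ext a b
    by_cases h : a = i
    · subst h; simp
    · refine Fin.cases ?_ (fun j => ?_) b <;> simp [borderMat, h]
  · ext a b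
    by_cases h : a = i
    · subst h; simp
    · refine Fin.cases ?_ (fun j => ?_) b <;> simp [borderMat, borderCol, h]

-- With `w = 0` the left side is `(∏ z - 1)` times a Vandermonde-type determinant. The border column
-- consists of the values at the `zᵢ` of one polynomial `h` of degree at most `n`; modulo the other
-- columns only its leading coefficient `∏ z - 1` matters.
open Polynomial in
theorem recipDet_sub_of_right_eq_zero {n : ℕ} (u z : Fin (n + 1) → K) (hz : ∀ i, z i ≠ -1) :
    recipDet (fun i => u i * z i) 0 z - recipDet u 0 z = (borderMat u 0 z).det := by
  -- At `X = zᵢ` the second product dies and the first is `(zᵢ² - 1) ∏_{j≠i} (zᵢ zⱼ - 1)`. Dividing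
  -- by `X + 1`, legitimate since `-1` is a root, leaves the border entry without `uᵢ`; recovering
  -- it needs `zᵢ ≠ -1`.
  set num : K[X] := ∏ j, (C (z j) * X - 1) - ∏ j, (X - C (z j)) with hnum
  have hroot : num.IsRoot (-1) := by
    simp only [hnum, IsRoot, eval_sub, eval_prod, eval_mul, eval_C, eval_X, eval_one]
    rw [sub_eq_zero]
    refine prod_congr rfl fun j _ => by ring
  obtain ⟨h, hh⟩ := dvd_iff_isRoot.2 hroot
  have hh' : num = (X + 1) * h := by rw [hh]; simp
  have hdeg1 : (∏ j, (C (z j) * X - 1)).natDegree ≤ n + 1 := by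
    refine (natDegree_prod_le _ _).trans ?_
    refine (sum_le_card_nsmul _ _ 1 fun j _ => ?_).trans (by simp)
    compute_degree
  have hdeg2 : (∏ j, (X - C (z j))).natDegree ≤ n + 1 := by
    rw [natDegree_prod_of_monic _ _ fun j _ => monic_X_sub_C _]
    simp
  have hdegnum : num.natDegree ≤ n + 1 := (natDegree_sub_le _ _).trans (max_le hdeg1 hdeg2)
  have hmon : (X + 1 : K[X]).Monic := by simpa using monic_X_add_C (1 : K)
  have hX1 : (X + 1 : K[X]).natDegree = 1 := by simpa using natDegree_X_add_C (1 : K)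
  have hdeg : h.natDegree ≤ n := by
    by_cases h0 : h = 0
    · simp [h0]
    have := hmon.natDegree_mul' h0
    rw [← hh', hX1] at this
    omega
  have hlead : h.coeff n = ∏ j, z j - 1 := by
    have e1 : num.coeff (n + 1) = h.coeff n := by
      rw [hh', add_mul, one_mul, coeff_add, coeff_X_mul,
        coeff_eq_zero_of_natDegree_lt (by omega : h.natDegree < n + 1), add_zero]
    have e2 : (∏ j, (C (z j) * X - 1)).coeff (n + 1) = ∏ j, z j := by
      have := coeff_prod_of_natDegree_le (s := univ) (fun j : Fin (n + 1) => C (z j) * X - 1) 1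
        (fun j _ => by compute_degree)
      simpa [coeff_one] using this
    have e3 : (∏ j, (X - C (z j))).coeff (n + 1) = 1 := by
      have := coeff_prod_of_natDegree_le (s := univ) (fun j : Fin (n + 1) => X - C (z j)) 1
        (fun j _ => by compute_degree)
      simpa using this
    rw [← e1, hnum, coeff_sub, e2, e3]
  have heval : ∀ i, borderCol u z i = u i * h.eval (z i) := by
    intro i
    have e := congrArg (Polynomial.eval (z i)) hh'
    simp only [hnum, eval_sub, eval_prod, eval_mul, eval_C, eval_X, eval_one, eval_add] at e
    rw [prod_eq_zero (f := fun j => z i - z j) (mem_univ i) (by simp), sub_zero,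
      ← mul_prod_erase univ _ (mem_univ i)] at e
    have hne : z i + 1 ≠ 0 := fun hc => hz i (by linear_combination hc)
    unfold borderCol
    congr 1
    apply mul_left_cancel₀ hne
    rw [← e, ← mul_assoc]
    congr 1
    · ring
    · exact prod_congr rfl fun j _ => by ring
  set V : Matrix (Fin (n + 1)) (Fin (n + 1)) K := of fun i j => u i * z i ^ (j.rev : ℕ) with hV
  have hB : (borderMat u 0 z).det = h.coeff n * V.det := by
    have := det_updateCol_sum V 0 (fun k => h.coeff (k.rev : ℕ))
    simp only [Fin.rev_zero, Fin.val_last, smul_eq_mul] at this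
    rw [← this]
    congr 1
    ext i j
    refine Fin.cases ?_ (fun j => ?_) j
    · simp only [borderMat, of_apply, Fin.cons_zero, updateCol_self, heval, hV]
      rw [eval_eq_sum_range' (Nat.lt_succ_of_le hdeg), ← Fin.sum_univ_eq_sum_range
        (fun k => h.coeff k * z i ^ k), mul_sum, ← Equiv.sum_comp Fin.revPerm]
      simp only [Fin.revPerm_apply]
      refine sum_congr rfl fun k _ => by ring
    · have h1 : (j.succ.rev : ℕ) = j.rev := by simp [Fin.val_rev]
      simp only [borderMat, of_apply, Fin.cons_succ, Pi.zero_apply, zero_mul, sub_zero]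
      rw [updateCol_ne (Fin.succ_ne_zero j), hV, of_apply, h1]
  have hD : recipDet u 0 z = V.det := by
    simp [recipDet, hV]
  have hD' : recipDet (fun i => u i * z i) 0 z = (∏ j, z j) * V.det := by
    rw [← det_mul_column]
    unfold recipDet
    congr 1
    ext i j
    simp [hV]
    ring
  rw [hD, hD', hB, hlead]
  ring

/-- Both sides are additive under splitting a row into its `u`- and `w`-parts. This reduces the
claim to `w = 0`, treated by polynomials, and to some `uᵢ = 0`, where elimination lowers the
dimension. -/
theorem recipDet_sub_recipDet {n : ℕ} (u w z : Fin (n + 1) → K) (hz : ∀ i, z i ≠ -1) :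
    recipDet (fun i => u i * z i) w z - recipDet u w z = (borderMat u w z).det := by
  induction n with
  | zero => simp [recipDet, borderMat, borderCol]; ring
  | succ n ih =>
    have h0 : ∀ u w z : Fin (n + 1 + 1) → K, (∀ i, z i ≠ -1) → u 0 = 0 →
        recipDet (fun i => u i * z i) w z - recipDet u w z = (borderMat u w z).det := by
      intro u w z hz hu
      rw [recipDet_zero_left u w z hu, recipDet_zero_left _ w z (by simp [hu]),
        det_borderMat_zero_left u w z hu, ← ih _ _ _ fun i => hz i.succ, ← mul_sub]
      congr 3
      funext k
      ring
    -- Swapping rows `0` and `i` changes all three determinants by the same sign.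
    have hi : ∀ i, ∀ u w z : Fin (n + 1 + 1) → K, (∀ i, z i ≠ -1) → u i = 0 →
        recipDet (fun i => u i * z i) w z - recipDet u w z = (borderMat u w z).det := by
      intro i u w z hz hu
      have := h0 (u ∘ Equiv.swap 0 i) (w ∘ Equiv.swap 0 i) (z ∘ Equiv.swap 0 i)
        (fun _ => hz _) (by simpa using hu)
      rw [recipDet_comp_perm, det_borderMat_comp_perm] at this
      have e : (fun j => (u ∘ Equiv.swap 0 i) j * (z ∘ Equiv.swap 0 i) j) =
        (fun j => u j * z j) ∘ Equiv.swap 0 i := rfl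
      rw [e, recipDet_comp_perm, ← mul_sub] at this
      refine mul_left_cancel₀ ?_ this
      rcases Int.units_eq_one_or (Equiv.Perm.sign (Equiv.swap 0 i)) with h | h <;> simp [h]
    -- Induction on a set containing the support of `w`: each step removes one `wₐ` at the price of
    -- a term with `uₐ = 0`.
    have key : ∀ s : Finset (Fin (n + 1 + 1)), ∀ w, (∀ i ∉ s, w i = 0) →
        recipDet (fun i => u i * z i) w z - recipDet u w z = (borderMat u w z).det := by
      intro s
      induction s using Finset.induction_on with
      | empty =>
        intro w hw
        have : w = 0 := funext fun i => hw i (by simp)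
        rw [this]
        exact recipDet_sub_of_right_eq_zero u z hz
      | insert a s ha ihs =>
        intro w hw
        have h1 := ihs (Function.update w a 0) fun i his => by
          by_cases hia : i = a
          · subst hia; simp
          · rw [Function.update_of_ne hia]; exact hw i (by simp [hia, his])
        have h2 := hi a (Function.update u a 0) w z hz (by simp)
        rw [recipDet_update u w z a, recipDet_update _ w z a, det_borderMat_update u w z a, ← h1,
          ← h2]
        have e : Function.update (fun i => u i * z i) a 0 =
            fun i => Function.update u a 0 i * z i := by
          funext i
          by_cases hia : i = a
          · subst hia; simp
          · simp [hia]
        rw [e]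
        ring
    exact key univ w (by simp)

end RectangularDeterminant

/-! ### Bounded strictly decreasing sequences, split by whether the top value is attained. -/

section DecreasingSequences

open Classical in
/-- The strictly decreasing sequences of length `n` with values below `c`. -/
noncomputable def decSeq (n c : ℕ) : Finset (Fin n → ℕ) :=
  (Fintype.piFinset fun _ => range c).filter StrictAnti

theorem mem_decSeq {n c : ℕ} {s : Fin n → ℕ} :
    s ∈ decSeq n c ↔ (∀ i, s i < c) ∧ StrictAnti s := by
  simp [decSeq]

theorem decSeq_zero_right (n : ℕ) : decSeq (n + 1) 0 = ∅ := by
  ext s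
  simp [mem_decSeq]

theorem strictAnti_cons {n : ℕ} {α : Type*} [Preorder α] {a : α} {s : Fin n → α} :
    StrictAnti (Fin.cons a s : Fin (n + 1) → α) ↔ (∀ i, s i < a) ∧ StrictAnti s := by
  constructor
  · intro h
    refine ⟨fun i => ?_, fun i j hij => ?_⟩
    · simpa using h (Fin.succ_pos i)
    · simpa using h (Fin.succ_lt_succ_iff.2 hij)
  · rintro ⟨h1, h2⟩ i j
    refine Fin.cases ?_ (fun i => ?_) i <;> refine Fin.cases ?_ (fun j => ?_) j
    · simp
    · simpa using h1 j
    · intro h; exact absurd h (Fin.not_lt_zero _)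
    · simpa using fun h => h2 h

theorem sum_decSeq_succ {A : Type*} [AddCommMonoid A] (n c : ℕ) (f : (Fin (n + 1) → ℕ) → A) :
    ∑ s ∈ decSeq (n + 1) (c + 1), f s =
      ∑ s ∈ decSeq (n + 1) c, f s + ∑ s ∈ decSeq n c, f (Fin.cons c s) := by
  classical
  have hu : decSeq (n + 1) (c + 1) =
      decSeq (n + 1) c ∪ (decSeq n c).image (fun s => (Fin.cons c s : Fin (n + 1) → ℕ)) := by
    ext s
    simp only [mem_union, mem_image, mem_decSeq]
    constructor
    · rintro ⟨h1, h2⟩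
      rcases Nat.lt_or_ge (s 0) c with h | h
      · refine Or.inl ⟨fun i => lt_of_le_of_lt (h2.antitone (Fin.zero_le i)) h, h2⟩
      · have h0 : s 0 = c := le_antisymm (Nat.lt_succ_iff.1 (h1 0)) h
        refine Or.inr ⟨Fin.tail s, ?_, ?_⟩
        · have := h2
          rw [← Fin.cons_self_tail s, strictAnti_cons, h0] at this
          exact this
        · rw [← h0, Fin.cons_self_tail]
    · rintro (⟨h1, h2⟩ | ⟨t, ⟨h1, h2⟩, rfl⟩)
      · exact ⟨fun i => (h1 i).trans (Nat.lt_succ_self c), h2⟩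
      · refine ⟨fun i => ?_, strictAnti_cons.2 ⟨h1, h2⟩⟩
        refine Fin.cases (by simp) (fun i => ?_) i
        simpa using (h1 i).trans (Nat.lt_succ_self c)
  rw [hu, sum_union, sum_image]
  · intro s _ t _ h
    exact (Fin.cons_injective2 h).2
  · rw [disjoint_left]
    intro s h1 h2
    obtain ⟨t, -, rfl⟩ := mem_image.1 h2
    simpa using (mem_decSeq.1 h1).1 0

end DecreasingSequences

/-! ### The bounded sum of Schur-type determinants. -/

section BoundedSum

variable {K : Type*} [Field K]

/-- `∏ᵢ (zᵢ - 1) ∏_{i<j} (zᵢ zⱼ - 1)`. -/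
def denomProd {n : ℕ} (z : Fin n → K) : K :=
  (∏ i, (z i - 1)) * ∏ i, ∏ j ∈ Ioi i, (z i * z j - 1)

theorem prod_prod_Ioi_succAbove {M : Type*} [CommMonoid M] {n : ℕ}
    (f : Fin (n + 1) → Fin (n + 1) → M) (hf : ∀ a b, f a b = f b a) (i : Fin (n + 1)) :
    ∏ a, ∏ b ∈ Ioi a, f a b = (∏ b ∈ univ.erase i, f i b) *
      ∏ a : Fin n, ∏ b ∈ Ioi a, f (i.succAbove a) (i.succAbove b) := by
  have e : ∀ {k : ℕ} (g : Fin k → Fin k → M), ∏ a, ∏ b ∈ Ioi a, g a b =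
      ∏ a, ∏ b, if a < b then g a b else 1 := by
    intro k g
    refine prod_congr rfl fun a _ => ?_
    rw [← prod_filter]
    congr 1
    ext b
    simp
  rw [e, e, Fin.prod_univ_succAbove _ i, Fin.prod_univ_succAbove _ i]
  simp only [lt_irrefl, if_false, one_mul]
  have h1 : ∏ b ∈ univ.erase i, f i b = ∏ b : Fin n, f i (i.succAbove b) := by
    have hi : (univ.erase i : Finset (Fin (n + 1))) = univ.map i.succAboveEmb := by
      ext k
      simp only [mem_erase, mem_univ, and_true, Finset.mem_map, true_and, Fin.coe_succAboveEmb]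
      exact Fin.exists_succAbove_eq_iff.symm
    rw [hi, prod_map]
    rfl
  rw [h1]
  have h2 : ∀ a : Fin n, (∏ b, if i.succAbove a < b then f (i.succAbove a) b else 1) =
      (if i.succAbove a < i then f i (i.succAbove a) else 1) *
      ∏ b : Fin n, if a < b then f (i.succAbove a) (i.succAbove b) else 1 := by
    intro a
    rw [Fin.prod_univ_succAbove _ i, hf _ i]
    congr 1
    refine prod_congr rfl fun b _ => ?_
    simp only [Fin.succAbove_lt_succAbove_iff]
  simp only [h2]
  rw [prod_mul_distrib, ← mul_assoc, ← prod_mul_distrib]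
  congr 1
  refine prod_congr rfl fun b _ => ?_
  rcases lt_or_gt_of_ne (Fin.succAbove_ne i b) with h | h
  · simp [h, h.not_gt]
  · simp [h, h.not_gt]

theorem denomProd_succAbove {n : ℕ} (z : Fin (n + 1) → K) (i : Fin (n + 1)) :
    denomProd z = ((z i - 1) * ∏ j ∈ univ.erase i, (z i * z j - 1)) *
      denomProd (fun k => z (i.succAbove k)) := by
  unfold denomProd
  rw [prod_prod_Ioi_succAbove (fun a b => z a * z b - 1) (fun a b => by ring) i,
    Fin.prod_univ_succAbove _ i]
  ring

/-- The first and last columns are negatives of each other; in dimension one the single entry is `1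
- 1`. -/
theorem recipDet_one_one {n : ℕ} (z : Fin (n + 1) → K) : recipDet (fun _ => 1) 1 z = 0 := by
  unfold recipDet
  rcases n with _ | n
  · simp
  · rw [← exists_mulVec_eq_zero_iff]
    refine ⟨Pi.single 0 1 + Pi.single (Fin.last _) 1, ?_, ?_⟩
    · intro h
      have := congrFun h 0
      simp [(Fin.last_pos).ne] at this
    · rw [mulVec_add]
      ext i
      simp

/-- The sum of the determinants `det (zᵢ ^ sⱼ)` over strictly decreasing `s` with values
below `c`. -/
noncomputable def powSum {n : ℕ} (z : Fin n → K) (c : ℕ) : K :=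
  ∑ s ∈ decSeq n c, det (of fun i j => z i ^ s j)

/-- Induction on the bound. Raising `c` by one adds the sequences with top entry `c`; expanding
along their first column reproduces the expansion of `borderMat` along its border. On the right it
multiplies each `uᵢ` by `zᵢ`, so `recipDet_sub_recipDet` matches the increments. -/
theorem powSum_mul_denomProd {n : ℕ} (z : Fin n → K) (hz : ∀ i, z i ≠ -1) (c : ℕ) :
    powSum z c * denomProd z = recipDet (fun i => z i ^ c) 1 z := by
  induction c generalizing n with
  | zero =>
    rcases n with _ | n
    · have : decSeq 0 0 = {Fin.elim0} := by
        ext s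
        simp [mem_decSeq, StrictAnti, Subsingleton.elim s Fin.elim0]
      simp [powSum, denomProd, recipDet, this]
    · simp [powSum, decSeq_zero_right, recipDet_one_one]
  | succ c ih =>
    rcases n with _ | n
    · have : decSeq 0 (c + 1) = {Fin.elim0} := by
        ext s
        simp [mem_decSeq, StrictAnti, Subsingleton.elim s Fin.elim0]
      simp [powSum, denomProd, recipDet, this]
    · have h1 : powSum z (c + 1) = powSum z c + ∑ i : Fin (n + 1), (-1) ^ (i : ℕ) * z i ^ c *
          powSum (fun k => z (i.succAbove k)) c := by
        unfold powSum
        rw [sum_decSeq_succ]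
        congr 1
        simp only [mul_sum]
        rw [sum_comm]
        refine sum_congr rfl fun s _ => ?_
        rw [det_succ_column_zero]
        refine sum_congr rfl fun i _ => ?_
        simp only [of_apply, Fin.cons_zero]
        congr 2
      have h2 := recipDet_sub_recipDet (fun i => z i ^ c) 1 z hz
      rw [← ih z hz] at h2
      have h3 : (borderMat (fun i => z i ^ c) 1 z).det = ∑ i : Fin (n + 1), (-1) ^ (i : ℕ) *
          z i ^ c * powSum (fun k => z (i.succAbove k)) c * denomProd z := by
        rw [det_succ_column_zero]
        refine sum_congr rfl fun i _ => ?_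
        have h4 := ih (fun k => z (i.succAbove k)) fun k => hz _
        have h5 : ((borderMat (fun i => z i ^ c) 1 z).submatrix i.succAbove Fin.succ).det =
            recipDet (fun k => z (i.succAbove k) ^ c) 1 (fun k => z (i.succAbove k)) := by
          unfold recipDet
          congr 1
        rw [h5, ← h4, denomProd_succAbove z i]
        simp only [borderMat, of_apply, Fin.cons_zero, borderCol]
        ring
      rw [h1, add_mul, sum_mul, ← h3, ← h2]
      simp only [← pow_succ]
      ring

end BoundedSum

/-! ### Symmetrization over inversions of the variables. -/

section AlternatingSums

variable {K : Type*} [Field K]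

/-- The alternating determinant `det (ζᵢ^(eⱼ) - ζᵢ^(-eⱼ))`. -/
def altDet {n : ℕ} (ζ : Fin n → K) (e : Fin n → ℤ) : K :=
  det (of fun i j => ζ i ^ e j - (ζ i)⁻¹ ^ e j)

/-- The Weyl denominator `∏ᵢ (ζᵢ - ζᵢ⁻¹) ∏_{i<j} (ζᵢ² + ζᵢ⁻² - ζⱼ² - ζⱼ⁻²)`. -/
def weylProd {n : ℕ} (ζ : Fin n → K) : K :=
  (∏ i, (ζ i - (ζ i)⁻¹)) *
    ∏ i, ∏ j ∈ Ioi i, (ζ i ^ 2 + (ζ i)⁻¹ ^ 2 - ζ j ^ 2 - (ζ j)⁻¹ ^ 2)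

/-- The substitution `zᵢ = ζᵢ²` and multiplication by the Vandermonde product in `ζᵢ⁻²` turn
`denomProd` into the inversion-alternating `weylProd`, up to monomials. -/
theorem powSum_mul_weylProd {n : ℕ} (ζ : Fin n → K) (h0 : ∀ i, ζ i ≠ 0) (h1 : ∀ i, ζ i ^ 2 ≠ -1)
    (c : ℕ) :
    powSum (fun i => ζ i ^ 2) c * weylProd ζ =
      altDet ζ (fun j => (c : ℤ) + n - 1 - 2 * (j : ℕ)) *
        det (of fun i j : Fin n => ζ i ^ ((c : ℤ) + n - 2 - 2 * (j : ℕ))) := by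
  have hV : det (of fun i j : Fin n => ζ i ^ ((c : ℤ) + n - 2 - 2 * (j : ℕ))) =
      (∏ i, ζ i ^ ((c : ℤ) + n - 2)) * ∏ i, ∏ j ∈ Ioi i, ((ζ j ^ 2)⁻¹ - (ζ i ^ 2)⁻¹) := by
    rw [← det_vandermonde fun i => (ζ i ^ 2)⁻¹, ← det_mul_column]
    congr 1
    ext i j
    simp only [of_apply, vandermonde_apply]
    rw [zpow_sub₀ (h0 i), div_eq_mul_inv, _root_.zpow_mul, inv_pow]
    norm_cast
  have hD : denomProd (fun i => ζ i ^ 2) * ∏ i, ∏ j ∈ Ioi i, ((ζ j ^ 2)⁻¹ - (ζ i ^ 2)⁻¹) =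
      (∏ i, ζ i) * weylProd ζ := by
    unfold denomProd weylProd
    have e1 : ∏ i, (ζ i ^ 2 - 1) = (∏ i, ζ i) * ∏ i, (ζ i - (ζ i)⁻¹) := by
      rw [← prod_mul_distrib]
      refine prod_congr rfl fun i _ => ?_
      have := h0 i
      field_simp
    have e2 : (∏ i, ∏ j ∈ Ioi i, (ζ i ^ 2 * ζ j ^ 2 - 1)) *
        ∏ i, ∏ j ∈ Ioi i, ((ζ j ^ 2)⁻¹ - (ζ i ^ 2)⁻¹) =
        ∏ i, ∏ j ∈ Ioi i, (ζ i ^ 2 + (ζ i)⁻¹ ^ 2 - ζ j ^ 2 - (ζ j)⁻¹ ^ 2) := by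
      rw [← prod_mul_distrib]
      refine prod_congr rfl fun i _ => ?_
      rw [← prod_mul_distrib]
      refine prod_congr rfl fun j _ => ?_
      have := h0 i
      have := h0 j
      field_simp
      ring
    rw [e1, mul_assoc, e2, mul_assoc]
  have hR : recipDet (fun i => (ζ i ^ 2) ^ c) 1 (fun i => ζ i ^ 2) =
      (∏ i, ζ i ^ ((c : ℤ) + n - 1)) * altDet ζ (fun j => (c : ℤ) + n - 1 - 2 * (j : ℕ)) := by
    unfold altDet recipDet
    rw [← det_mul_column]
    congr 1
    ext i j
    have hj : ((j.rev : ℕ) : ℤ) = n - 1 - (j : ℕ) := by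
      rw [Fin.val_rev]
      omega
    simp only [of_apply, Pi.one_apply, one_mul, mul_sub, _root_.inv_zpow', ← zpow_add₀ (h0 i), ← pow_mul]
    rw [← pow_add, ← zpow_natCast, ← zpow_natCast]
    push_cast
    rw [hj]
    congr 2 <;> ring
  have hP : (∏ i, ζ i ^ ((c : ℤ) + n - 1)) = (∏ i, ζ i) * ∏ i, ζ i ^ ((c : ℤ) + n - 2) := by
    rw [← prod_mul_distrib]
    refine prod_congr rfl fun i _ => ?_
    rw [← zpow_one_add₀ (h0 i)]
    congr 1
    ring
  have key := powSum_mul_denomProd (fun i => ζ i ^ 2) h1 c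
  have hne : (∏ i, ζ i) ≠ 0 := prod_ne_zero_iff.2 fun i _ => h0 i
  apply mul_left_cancel₀ hne
  rw [hV]
  calc _ = powSum (fun i => ζ i ^ 2) c * ((∏ i, ζ i) * weylProd ζ) := by ring
    _ = _ := by
      rw [← hD, ← mul_assoc, key, hR, hP]
      ring

/-- The sign vector of a subset. -/
def subsetSign {n : ℕ} (S : Finset (Fin n)) (i : Fin n) : K := if i ∈ S then 1 else -1

/-- Invert the coordinates outside a subset. -/
def invOutside {n : ℕ} (ζ : Fin n → K) (S : Finset (Fin n)) (i : Fin n) : K :=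
  if i ∈ S then ζ i else (ζ i)⁻¹

theorem altDet_eq_sum {n : ℕ} (ζ : Fin n → K) (e : Fin n → ℤ) :
    altDet ζ e = ∑ S : Finset (Fin n), (∏ i, subsetSign S i) *
      det (of fun i j => invOutside ζ S i ^ e j) := by
  have := (detRowAlternating (n := Fin n) (R := K)).toMultilinearMap.map_add_univ
    (fun i j => ζ i ^ e j) (fun i j => -(ζ i)⁻¹ ^ e j)
  refine Eq.trans ?_ (this.trans (sum_congr rfl fun S _ => ?_))
  · change _ = det _
    unfold altDet
    congr 1
    ext i j
    simp [sub_eq_add_neg]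
  · change det _ = _
    rw [← det_mul_column]
    congr 1
    ext i j
    by_cases h : i ∈ S <;> simp [subsetSign, invOutside, h]

theorem altDet_invOutside {n : ℕ} (ζ : Fin n → K) (e : Fin n → ℤ) (S : Finset (Fin n)) :
    altDet (invOutside ζ S) e = (∏ i, subsetSign S i) * altDet ζ e := by
  unfold altDet
  rw [← det_mul_column]
  congr 1
  ext i j
  by_cases h : i ∈ S <;> simp [subsetSign, invOutside, h]

theorem weylProd_invOutside {n : ℕ} (ζ : Fin n → K) (S : Finset (Fin n)) :
    weylProd (invOutside ζ S) = (∏ i, subsetSign S i) * weylProd ζ := by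
  unfold weylProd
  rw [← mul_assoc]
  congr 1
  · rw [← prod_mul_distrib]
    refine prod_congr rfl fun i _ => ?_
    by_cases h : i ∈ S <;> simp [subsetSign, invOutside, h]
  · have : ∀ i, invOutside ζ S i ^ 2 + (invOutside ζ S i)⁻¹ ^ 2 = ζ i ^ 2 + (ζ i)⁻¹ ^ 2 := by
      intro i
      by_cases h : i ∈ S <;> simp [invOutside, h, add_comm]
    refine prod_congr rfl fun i _ => prod_congr rfl fun j _ => ?_
    rw [this, sub_sub, sub_sub, this]

/-- Expanding each row of `altDet` gives a signed sum over the `2^n` inversions of variables.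
`weylProd` and the first determinant on the right pick up the same sign under an inversion, so they
factor out; the leftover signed sum of plain determinants reassembles into the second one. -/
theorem sum_altDet_mul_weylProd {n : ℕ} (ζ : Fin n → K) (h0 : ∀ i, ζ i ≠ 0)
    (h1 : ∀ i, ζ i ^ 2 ≠ -1) (b : ℤ) (c : ℕ) :
    (∑ s ∈ decSeq n c, altDet ζ fun j => 2 * (s j : ℤ) + b) * weylProd ζ =
      altDet ζ (fun j => (c : ℤ) + n - 1 - 2 * (j : ℕ)) *
        altDet ζ (fun j => b + c + n - 2 - 2 * (j : ℕ)) := by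
  have h0' : ∀ S i, invOutside ζ S i ≠ 0 := by
    intro S i
    by_cases h : i ∈ S <;> simp [invOutside, h, h0]
  have h1' : ∀ S i, invOutside ζ S i ^ 2 ≠ -1 := by
    intro S i
    by_cases h : i ∈ S
    · simpa [invOutside, h] using h1 i
    · simp only [invOutside, h, if_false, inv_pow]
      intro hc
      apply h1 i
      rw [← inv_inv (ζ i ^ 2), hc]
      norm_num
  have hs : ∑ s ∈ decSeq n c, altDet ζ (fun j => 2 * (s j : ℤ) + b) =
      ∑ S : Finset (Fin n), (∏ i, subsetSign S i) * ((∏ i, invOutside ζ S i ^ b) *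
        powSum (fun i => invOutside ζ S i ^ 2) c) := by
    simp only [altDet_eq_sum]
    rw [sum_comm]
    refine sum_congr rfl fun S _ => ?_
    rw [← mul_sum, powSum, mul_sum _ _ (∏ i, invOutside ζ S i ^ b)]
    congr 1
    refine sum_congr rfl fun s _ => ?_
    rw [← det_mul_column]
    congr 1
    ext i j
    simp only [of_apply]
    rw [← pow_mul, ← zpow_natCast, ← zpow_add₀ (h0' S i)]
    push_cast
    congr 1
    ring
  rw [hs, sum_mul, altDet_eq_sum ζ fun j => b + c + n - 2 - 2 * (j : ℕ), mul_sum]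
  refine sum_congr rfl fun S _ => ?_
  have key := powSum_mul_weylProd (invOutside ζ S) (h0' S) (h1' S) c
  rw [weylProd_invOutside, altDet_invOutside] at key
  have hd : det (of fun i j : Fin n => invOutside ζ S i ^ (b + c + n - 2 - 2 * (j : ℕ))) =
      (∏ i, invOutside ζ S i ^ b) *
        det (of fun i j : Fin n => invOutside ζ S i ^ ((c : ℤ) + n - 2 - 2 * (j : ℕ))) := by
    rw [← det_mul_column]
    congr 1
    ext i j
    simp only [of_apply]
    rw [← zpow_add₀ (h0' S i)]
    congr 1
    ring
  rw [hd]
  calc _ = (∏ i, invOutside ζ S i ^ b) * (powSum (fun i => invOutside ζ S i ^ 2) c *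
        ((∏ i, subsetSign S i) * weylProd ζ)) := by ring
    _ = _ := by
      rw [key]
      ring

end AlternatingSums

/-! ### Specialization to roots of unity: determinants of sines as products of sines. -/

section SineProducts

/-- `∏_{h<t} sin(α(y_h - y_t)) sin(α(y_h + y_t)) ∏_h sin(α y_h)`. -/
noncomputable def sinProd {n : ℕ} (α : ℝ) (y : Fin n → ℝ) : ℝ :=
  (∏ h, ∏ t ∈ Ioi h, (Real.sin (α * (y h - y t)) * Real.sin (α * (y h + y t)))) *
    ∏ h, Real.sin (α * y h)

/-- `det (sin((2i+1) α y_j))`. -/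
noncomputable def sinDet {n : ℕ} (α : ℝ) (y : Fin n → ℝ) : ℝ :=
  det (of fun i j : Fin n => Real.sin ((2 * (i : ℕ) + 1) * (α * y j)))

theorem exists_monic_sin_odd (i : ℕ) : ∃ p : Polynomial ℝ, p.natDegree = i ∧ p.Monic ∧
    ∀ φ : ℝ, Real.sin ((2 * i + 1) * φ) = (-4) ^ i * Real.sin φ * p.eval (Real.sin φ ^ 2) := by
  -- The recurrence `sin(x + 2φ) = 2 cos(2φ) sin x - sin(x - 2φ)` has order two, so two consecutive
  -- cases travel together.
  have key : ∀ i : ℕ, (∃ p : Polynomial ℝ, p.natDegree = i ∧ p.Monic ∧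
      ∀ φ : ℝ, Real.sin ((2 * i + 1) * φ) = (-4) ^ i * Real.sin φ * p.eval (Real.sin φ ^ 2)) ∧
      (∃ p : Polynomial ℝ, p.natDegree = i + 1 ∧ p.Monic ∧
      ∀ φ : ℝ, Real.sin ((2 * (i + 1 : ℕ) + 1) * φ) =
        (-4) ^ (i + 1) * Real.sin φ * p.eval (Real.sin φ ^ 2)) := by
    intro i
    induction i with
    | zero =>
      refine ⟨⟨1, by simp, Polynomial.monic_one, fun φ => by simp⟩,
        ⟨Polynomial.X - Polynomial.C (3 / 4), Polynomial.natDegree_X_sub_C _,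
          Polynomial.monic_X_sub_C _, fun φ => ?_⟩⟩
      have : (2 * ((0 + 1 : ℕ) : ℝ) + 1) * φ = 3 * φ := by push_cast; ring
      rw [this, Real.sin_three_mul]
      simp
      ring
    | succ i ih =>
      obtain ⟨⟨p, hp1, hp2, hp3⟩, ⟨q, hq1, hq2, hq3⟩⟩ := ih
      refine ⟨⟨q, hq1, hq2, hq3⟩, ?_⟩
      have hm : ((Polynomial.X - Polynomial.C (1 / 2)) * q).Monic :=
        (Polynomial.monic_X_sub_C _).mul hq2
      have hd : ((Polynomial.X - Polynomial.C (1 / 2)) * q).natDegree = i + 1 + 1 := by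
        rw [(Polynomial.monic_X_sub_C _).natDegree_mul hq2, Polynomial.natDegree_X_sub_C, hq1]
        ring
      have hlt : (Polynomial.C (1 / 16) * p).natDegree <
          ((Polynomial.X - Polynomial.C (1 / 2)) * q).natDegree := by
        refine (Polynomial.natDegree_C_mul_le _ _).trans_lt ?_
        rw [hd, hp1]
        omega
      refine ⟨(Polynomial.X - Polynomial.C (1 / 2)) * q - Polynomial.C (1 / 16) * p, ?_, ?_, ?_⟩
      · rw [Polynomial.natDegree_sub_eq_left_of_natDegree_lt hlt, hd]
      · exact hm.sub_of_left (Polynomial.degree_lt_degree hlt)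
      · intro φ
        have h1 : Real.sin ((2 * (i + 1 + 1 : ℕ) + 1) * φ) =
            2 * Real.cos (2 * φ) * Real.sin ((2 * (i + 1 : ℕ) + 1) * φ) -
              Real.sin ((2 * i + 1) * φ) := by
          have e1 : (2 * ((i + 1 + 1 : ℕ) : ℝ) + 1) * φ =
            (2 * ((i + 1 : ℕ) : ℝ) + 1) * φ + 2 * φ := by push_cast; ring
          have e2 : (2 * (i : ℝ) + 1) * φ =
            (2 * ((i + 1 : ℕ) : ℝ) + 1) * φ - 2 * φ := by push_cast; ring
          rw [e1, e2, Real.sin_add, Real.sin_sub]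
          ring
        rw [h1, hq3, hp3, Real.cos_two_mul, Real.cos_sq']
        simp only [Polynomial.eval_sub, Polynomial.eval_mul, Polynomial.eval_X, Polynomial.eval_C]
        ring
  exact (key i).1

theorem prod_prod_Ioi_rev {M : Type*} [CommMonoid M] {n : ℕ} (f : Fin n → Fin n → M) :
    ∏ h, ∏ t ∈ Ioi h, f h t = ∏ h : Fin n, ∏ t ∈ Ioi h, f t.rev h.rev := by
  rw [prod_sigma', prod_sigma']
  refine prod_bij (fun p _ => ⟨p.2.rev, p.1.rev⟩) ?_ ?_ ?_ ?_
  · rintro ⟨a, b⟩ h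
    simpa using h
  · rintro ⟨a, b⟩ _ ⟨c, d⟩ _ h
    simpa [and_comm] using h
  · rintro ⟨a, b⟩ h
    exact ⟨⟨b.rev, a.rev⟩, by simpa using h, by simp⟩
  · rintro ⟨a, b⟩ _
    simp

theorem prod_prod_Ioi_const {M : Type*} [CommMonoid M] {n : ℕ} (a : M) :
    ∏ h : Fin n, ∏ _t ∈ Ioi h, a = ∏ i : Fin n, a ^ (i : ℕ) := by
  rw [← Equiv.prod_comp Fin.revPerm]
  refine prod_congr rfl fun i _ => ?_
  rw [prod_const, Fin.card_Ioi]
  congr 1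
  simp only [Fin.revPerm_apply, Fin.val_rev]
  omega

theorem prod_four_pow (n : ℕ) : ∏ i : Fin n, (4 : ℝ) ^ (i : ℕ) = 2 ^ (n * (n - 1)) := by
  rw [Fin.prod_univ_eq_prod_range (fun i => (4 : ℝ) ^ i), prod_pow_eq_pow_sum,
    ← sum_range_id_mul_two, mul_comm, pow_mul]
  norm_num

/-- Odd multiples give `sin((2i+1)φ) = (-4)^i sin φ · pᵢ(sin² φ)` with `pᵢ` monic of degree `i`, so
the determinant is a Vandermonde determinant in `sin²`; its factors split by `sin² a - sin² b =
sin(a-b) sin(a+b)`. -/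
theorem sinDet_eq {n : ℕ} (α : ℝ) (y : Fin n → ℝ) :
    sinDet α y = 2 ^ (n * (n - 1)) * sinProd α y := by
  choose p hp1 hp2 hp3 using exists_monic_sin_odd
  have h1 : sinDet α y = (∏ i : Fin n, (-4 : ℝ) ^ (i : ℕ)) * ((∏ j, Real.sin (α * y j)) *
      det (of fun i j : Fin n => (p i).eval (Real.sin (α * y j) ^ 2))) := by
    rw [← det_mul_row, ← det_mul_column]
    unfold sinDet
    congr 1
    ext i j
    simp only [of_apply]
    rw [hp3]
    ring
  have h2 : det (of fun i j : Fin n => (p i).eval (Real.sin (α * y j) ^ 2)) =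
      ∏ i : Fin n, ∏ j ∈ Ioi i, (Real.sin (α * y j) ^ 2 - Real.sin (α * y i) ^ 2) := by
    rw [← det_vandermonde, ← det_transpose]
    exact (det_eval_matrixOfPolynomials_eq_det_vandermonde _ (fun i : Fin n => p i)
      (fun i => hp1 i) fun i => hp2 i).symm
  have h3 : ∏ i : Fin n, ∏ j ∈ Ioi i, (Real.sin (α * y j) ^ 2 - Real.sin (α * y i) ^ 2) =
      (∏ i : Fin n, (-1 : ℝ) ^ (i : ℕ)) *
      ∏ h, ∏ t ∈ Ioi h, (Real.sin (α * (y h - y t)) * Real.sin (α * (y h + y t))) := by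
    rw [← prod_prod_Ioi_const, ← prod_mul_distrib]
    refine prod_congr rfl fun i _ => ?_
    rw [← prod_mul_distrib]
    refine prod_congr rfl fun j _ => ?_
    rw [mul_sub, mul_add, Real.sin_sub, Real.sin_add]
    linear_combination (Real.sin (α * y i) ^ 2) * Real.sin_sq_add_cos_sq (α * y j) -
      (Real.sin (α * y j) ^ 2) * Real.sin_sq_add_cos_sq (α * y i)
  rw [h1, h2, h3, sinProd, ← prod_four_pow]
  have h4 : ∏ i : Fin n, (4 : ℝ) ^ (i : ℕ) = (∏ i : Fin n, (-4 : ℝ) ^ (i : ℕ)) *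
      ∏ i : Fin n, (-1 : ℝ) ^ (i : ℕ) := by
    rw [← prod_mul_distrib]
    refine prod_congr rfl fun i _ => ?_
    rw [← mul_pow]
    norm_num
  rw [h4]
  ring

theorem altDet_exp {n : ℕ} (α : ℝ) (e : Fin n → ℤ) :
    altDet (fun i : Fin n => Complex.exp (((2 * (i : ℕ) + 1) * α : ℝ) * Complex.I)) e =
      (2 * Complex.I) ^ n * (sinDet α (fun j => (e j : ℝ)) : ℂ) := by
  have : (sinDet α (fun j => (e j : ℝ)) : ℂ) =
      det (of fun i j : Fin n => (Real.sin ((2 * (i : ℕ) + 1) * (α * e j)) : ℂ)) := by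
    unfold sinDet
    rw [← Complex.ofRealHom_eq_coe, RingHom.map_det]
    rfl
  have h2 : ((2 * Complex.I) ^ n : ℂ) = ∏ _i : Fin n, (2 * Complex.I) := by simp
  rw [this, h2, ← det_mul_column]
  unfold altDet
  congr 1
  ext i j
  simp only [of_apply]
  rw [← Complex.exp_neg, ← Complex.exp_int_mul, ← Complex.exp_int_mul, Complex.ofReal_sin,
    Complex.sin]
  have e1 : (e j : ℂ) * (((2 * (i : ℕ) + 1) * α : ℝ) * Complex.I) =
    ((2 * (i : ℕ) + 1) * (α * e j) : ℝ) * Complex.I := by push_cast; ring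
  have e2 : (e j : ℂ) * -(((2 * (i : ℕ) + 1) * α : ℝ) * Complex.I) =
    -((2 * (i : ℕ) + 1) * (α * e j) : ℝ) * Complex.I := by push_cast; ring
  rw [e1, e2]
  linear_combination (-(Complex.exp (-((2 * (i : ℕ) + 1) * (α * e j) : ℝ) * Complex.I) -
    Complex.exp (((2 * (i : ℕ) + 1) * (α * e j) : ℝ) * Complex.I))) * Complex.I_sq

/-- The angles `(2i+1)α` are themselves `α` times an arithmetic progression, so the Weyl denominator
is again a sine product, at the odd numbers `2n-1, …, 3, 1`. -/
theorem weylProd_exp {n : ℕ} (α : ℝ) :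
    weylProd (fun i : Fin n => Complex.exp (((2 * (i : ℕ) + 1) * α : ℝ) * Complex.I)) =
      (2 * Complex.I) ^ n *
        ((2 ^ (n * (n - 1)) * sinProd α (fun j : Fin n => 2 * ((j.rev : ℕ) : ℝ) + 1) : ℝ) : ℂ) := by
  have hd : ∀ x : ℝ, Complex.exp (x * Complex.I) - (Complex.exp (x * Complex.I))⁻¹ =
      2 * Complex.I * (Real.sin x : ℂ) := by
    intro x
    rw [← Complex.exp_neg, Complex.ofReal_sin, Complex.sin, ← neg_mul]
    linear_combination (-(Complex.exp (-x * Complex.I) - Complex.exp (x * Complex.I))) *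
      Complex.I_sq
  have hc : ∀ x : ℝ, Complex.exp (x * Complex.I) ^ 2 + (Complex.exp (x * Complex.I))⁻¹ ^ 2 =
      ((2 * Real.cos (2 * x) : ℝ) : ℂ) := by
    intro x
    rw [← Complex.exp_neg, ← Complex.exp_nat_mul, ← Complex.exp_nat_mul, Complex.ofReal_mul,
      Complex.ofReal_cos, Complex.cos]
    push_cast
    ring_nf
  have e1 : ∏ i : Fin n, (Complex.exp (((2 * (i : ℕ) + 1) * α : ℝ) * Complex.I) -
      (Complex.exp (((2 * (i : ℕ) + 1) * α : ℝ) * Complex.I))⁻¹) = (2 * Complex.I) ^ n *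
        ((∏ j : Fin n, Real.sin (α * (2 * ((j.rev : ℕ) : ℝ) + 1)) : ℝ) : ℂ) := by
    have hr := Equiv.prod_comp Fin.revPerm
      (fun j : Fin n => Real.sin (α * (2 * ((j : ℕ) : ℝ) + 1)))
    simp only [Fin.revPerm_apply] at hr
    rw [hr, Complex.ofReal_prod]
    simp only [hd, prod_mul_distrib]
    congr 1
    · simp [mul_pow]
    · refine prod_congr rfl fun i _ => by rw [mul_comm α]
  have e2 : ∏ i : Fin n, ∏ j ∈ Ioi i, (Complex.exp (((2 * (i : ℕ) + 1) * α : ℝ) * Complex.I) ^ 2 +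
      (Complex.exp (((2 * (i : ℕ) + 1) * α : ℝ) * Complex.I))⁻¹ ^ 2 -
      Complex.exp (((2 * (j : ℕ) + 1) * α : ℝ) * Complex.I) ^ 2 -
      (Complex.exp (((2 * (j : ℕ) + 1) * α : ℝ) * Complex.I))⁻¹ ^ 2) =
      ((2 ^ (n * (n - 1)) * ∏ h : Fin n, ∏ t ∈ Ioi h,
        (Real.sin (α * ((2 * ((h.rev : ℕ) : ℝ) + 1) - (2 * ((t.rev : ℕ) : ℝ) + 1))) *
        Real.sin (α * ((2 * ((h.rev : ℕ) : ℝ) + 1) + (2 * ((t.rev : ℕ) : ℝ) + 1)))) : ℝ) : ℂ) := by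
    rw [← prod_four_pow, ← prod_prod_Ioi_const, prod_prod_Ioi_rev (fun h t : Fin n =>
        (Real.sin (α * ((2 * ((h.rev : ℕ) : ℝ) + 1) - (2 * ((t.rev : ℕ) : ℝ) + 1))) *
        Real.sin (α * ((2 * ((h.rev : ℕ) : ℝ) + 1) + (2 * ((t.rev : ℕ) : ℝ) + 1))))),
        ← prod_mul_distrib, Complex.ofReal_prod]
    refine prod_congr rfl fun i _ => ?_
    rw [← prod_mul_distrib, Complex.ofReal_prod]
    refine prod_congr rfl fun j _ => ?_
    rw [sub_sub, hc, hc, ← Complex.ofReal_sub, ← mul_sub, Real.cos_sub_cos]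
    congr 1
    simp only [Fin.rev_rev]
    have a1 : (2 * ((2 * ((i : ℕ) : ℝ) + 1) * α) + 2 * ((2 * ((j : ℕ) : ℝ) + 1) * α)) / 2 =
      α * ((2 * ((j : ℕ) : ℝ) + 1) + (2 * ((i : ℕ) : ℝ) + 1)) := by ring
    have a2 : (2 * ((2 * ((i : ℕ) : ℝ) + 1) * α) - 2 * ((2 * ((j : ℕ) : ℝ) + 1) * α)) / 2 =
      -(α * ((2 * ((j : ℕ) : ℝ) + 1) - (2 * ((i : ℕ) : ℝ) + 1))) := by ring
    rw [a1, a2, Real.sin_neg]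
    ring
  unfold weylProd sinProd
  rw [e1, e2]
  push_cast
  ring

/-- The bounded sum of sine products over strictly decreasing sequences. -/
theorem sum_sinProd_mul {n : ℕ} (α : ℝ) (hα : ∀ i : Fin n, Real.cos ((2 * (i : ℕ) + 1) * α) ≠ 0)
    (b c : ℕ) :
    (∑ s ∈ decSeq n c, sinProd α fun j => 2 * (s j : ℝ) + b) *
        sinProd α (fun j : Fin n => 2 * ((j.rev : ℕ) : ℝ) + 1) =
      sinProd α (fun j : Fin n => (c : ℝ) + n - 1 - 2 * (j : ℕ)) *
        sinProd α (fun j : Fin n => (b : ℝ) + c + n - 2 - 2 * (j : ℕ)) := by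
  have key := sum_altDet_mul_weylProd
    (fun i : Fin n => Complex.exp (((2 * (i : ℕ) + 1) * α : ℝ) * Complex.I))
    (fun i => Complex.exp_ne_zero _) (fun i hi => hα i ?_) b c
  · simp only [altDet_exp, weylProd_exp, sinDet_eq] at key
    push_cast at key
    rw [← mul_sum, ← mul_sum] at key
    have hI : (2 * Complex.I) ^ n ≠ 0 := pow_ne_zero _ (by simp)
    have h2 : (2 : ℂ) ^ (n * (n - 1)) ≠ 0 := pow_ne_zero _ (by norm_num)
    apply Complex.ofReal_injective
    push_cast
    refine mul_left_cancel₀ (mul_ne_zero (mul_ne_zero hI h2) (mul_ne_zero hI h2)) ?_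
    linear_combination key
  -- The excluded value `ζᵢ² = -1` is exactly the vanishing of `cos((2i+1)α)`.
  · have h := Complex.exp_ne_zero (((2 * (i : ℕ) + 1) * α : ℝ) * Complex.I)
    apply Complex.ofReal_injective
    rw [Complex.ofReal_cos, Complex.cos, Complex.ofReal_zero, neg_mul, Complex.exp_neg]
    field_simp
    linear_combination hi

end SineProducts

/-! ### Perron-Frobenius asymptotics for bipartite symmetric matrices. -/

section PerronFrobenius

variable {Ω : Type*} [Fintype Ω]

/-- If `g` is an eigenvector for the eigenvalue of a positive eigenvector `v` of a connected
nonnegative matrix, then `g` is a multiple of `v`. -/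
theorem eq_smul_of_mulVec_eq {T : Matrix Ω Ω ℝ} (hT0 : ∀ x y, 0 ≤ T x y)
    (hconn : ∀ x y, Relation.ReflTransGen (fun a b => T a b ≠ 0) x y)
    {v : Ω → ℝ} (hv : ∀ x, 0 < v x) {R : ℝ} (hTv : T *ᵥ v = R • v)
    {g : Ω → ℝ} (hg : T *ᵥ g = R • g) : ∃ a : ℝ, g = a • v := by
  rcases isEmpty_or_nonempty Ω with h | h
  · exact ⟨0, funext fun x => isEmptyElim x⟩
  obtain ⟨x, -, hx⟩ := exists_max_image univ (fun y => g y / v y) univ_nonempty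
  refine ⟨g x / v x, ?_⟩
  have hle : ∀ y, g y ≤ g x / v x * v y := fun y => (div_le_iff₀ (hv y)).1 (hx y (mem_univ y))
  -- Maximum principle: where `g/v` attains its maximum, the weighted sum of the nonnegative
  -- deficits over the neighbours is zero, so the maximum spreads along edges.
  have hstep : ∀ a b, g a = g x / v x * v a → T a b ≠ 0 → g b = g x / v x * v b := by
    intro a b ha hab
    have h1 : ∑ y, T a y * (g x / v x * v y - g y) = 0 := by
      have e1 := congrFun hTv a
      have e2 := congrFun hg a
      simp only [mulVec, dotProduct, Pi.smul_apply, smul_eq_mul] at e1 e2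
      simp only [mul_sub, sum_sub_distrib]
      rw [e2, ha]
      have : ∑ y, T a y * (g x / v x * v y) = g x / v x * ∑ y, T a y * v y := by
        rw [mul_sum]
        exact sum_congr rfl fun y _ => by ring
      rw [this, e1]
      ring
    rw [sum_eq_zero_iff_of_nonneg fun y _ => mul_nonneg (hT0 a y) (sub_nonneg.2 (hle y))] at h1
    have := (mul_eq_zero.1 (h1 b (mem_univ b))).resolve_left hab
    linarith
  funext y
  have : ∀ y, Relation.ReflTransGen (fun a b => T a b ≠ 0) x y → g y = g x / v x * v y := by
    intro y hy
    induction hy with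
    | refl => rw [div_mul_cancel₀ _ (hv x).ne']
    | tail _ hbc ih => exact hstep _ _ ih hbc
  exact this y (hconn x y)

/-- Evaluate the eigenvalue equation at a maximum of `|g|/v` and apply the triangle inequality. -/
theorem abs_eigenvalue_le {T : Matrix Ω Ω ℝ} (hT0 : ∀ x y, 0 ≤ T x y)
    {v : Ω → ℝ} (hv : ∀ x, 0 < v x) {R : ℝ} (hTv : T *ᵥ v = R • v)
    {g : Ω → ℝ} (hg0 : g ≠ 0) {l : ℝ} (hg : T *ᵥ g = l • g) : |l| ≤ R := by
  obtain ⟨x₀, hx₀⟩ := Function.ne_iff.1 hg0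
  obtain ⟨x, -, hx⟩ := exists_max_image univ (fun y => |g y| / v y) ⟨x₀, mem_univ _⟩
  have hle : ∀ y, |g y| ≤ |g x| / v x * v y :=
    fun y => (div_le_iff₀ (hv y)).1 (hx y (mem_univ y))
  have hpos : 0 < |g x| := by
    have h1 : 0 < |g x₀| / v x₀ := div_pos (abs_pos.2 hx₀) (hv _)
    have h2 := h1.trans_le (hx x₀ (mem_univ _))
    exact (div_pos_iff_of_pos_right (hv x)).1 h2
  have e1 := congrFun hTv x
  have e2 := congrFun hg x
  simp only [mulVec, dotProduct, Pi.smul_apply, smul_eq_mul] at e1 e2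
  refine le_of_mul_le_mul_right ?_ hpos
  calc |l| * |g x| = |∑ y, T x y * g y| := by rw [e2, abs_mul]
    _ ≤ ∑ y, |T x y * g y| := abs_sum_le_sum_abs _ _
    _ = ∑ y, T x y * |g y| := sum_congr rfl fun y _ => by rw [abs_mul, abs_of_nonneg (hT0 x y)]
    _ ≤ ∑ y, T x y * (|g x| / v x * v y) :=
      sum_le_sum fun y _ => mul_le_mul_of_nonneg_left (hle y) (hT0 x y)
    _ = |g x| / v x * ∑ y, T x y * v y := by
      rw [mul_sum]; exact sum_congr rfl fun y _ => by ring
    _ = R * |g x| := by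
      rw [e1]
      field_simp [(hv x).ne']

theorem pow_mulVec_of_mulVec_eq [DecidableEq Ω] {T : Matrix Ω Ω ℝ} {g : Ω → ℝ} {l : ℝ}
    (hg : T *ᵥ g = l • g) (k : ℕ) : (T ^ k) *ᵥ g = l ^ k • g := by
  induction k with
  | zero => simp
  | succ k ih => rw [pow_succ, ← mulVec_mulVec, hg, mulVec_smul, ih, smul_smul, pow_succ, mul_comm]

/-- Powers of a symmetric matrix with a connected bipartite structure, applied to a vector
orthogonal to the Perron eigenvector on each side, are negligible. -/
theorem tendsto_pow_mulVec_div [DecidableEq Ω] {T : Matrix Ω Ω ℝ} (hT0 : ∀ x y, 0 ≤ T x y)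
    (hsymm : T.IsSymm) (hconn : ∀ x y, Relation.ReflTransGen (fun a b => T a b ≠ 0) x y)
    {s : Ω → ℝ} (hs : ∀ x, s x * s x = 1) (hsT : ∀ x y, T x y ≠ 0 → s y = -s x)
    {v : Ω → ℝ} (hv : ∀ x, 0 < v x) {R : ℝ} (hR : 0 < R) (hTv : T *ᵥ v = R • v)
    {u : Ω → ℝ} (hu : ∑ x, v x * u x = 0) (hu' : ∑ x, s x * v x * u x = 0) (x : Ω) :
    Tendsto (fun k : ℕ => ((T ^ k) *ᵥ u) x / R ^ k) atTop (𝓝 0) := by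
  have hH : T.IsHermitian := by
    rw [IsHermitian, conjTranspose_eq_transpose_of_trivial]
    exact hsymm
  set e := hH.eigenvectorBasis with he
  set l := hH.eigenvalues with hl
  have heig : ∀ i, T *ᵥ (e i).ofLp = l i • (e i).ofLp := fun i => hH.mulVec_eigenvectorBasis i
  have hne : ∀ i, (e i).ofLp ≠ 0 := by
    intro i h
    have := e.orthonormal.ne_zero i
    apply this
    ext j
    simpa using congrFun h j
  -- Multiplication by the sign `s` anticommutes with `T`, so an eigenvector for `-R` becomes one
  -- for `R`.
  have hneg : ∀ g : Ω → ℝ, T *ᵥ (fun x => s x * g x) = fun x => -(s x * (T *ᵥ g) x) := by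
    intro g
    funext a
    simp only [mulVec, dotProduct]
    rw [mul_sum, ← sum_neg_distrib]
    refine sum_congr rfl fun b _ => ?_
    by_cases h : T a b = 0
    · simp [h]
    · rw [hsT a b h]; ring
  have hcoef : ∀ i, |l i| = R → ∑ y, (e i).ofLp y * u y = 0 := by
    intro i hi
    rcases abs_eq hR.le |>.1 hi with h | h
    · obtain ⟨a, ha⟩ := eq_smul_of_mulVec_eq hT0 hconn hv hTv (h ▸ heig i)
      rw [ha]
      simp only [Pi.smul_apply, smul_eq_mul, mul_assoc]
      rw [← mul_sum, hu, mul_zero]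
    · have h1 : T *ᵥ (fun x => s x * (e i).ofLp x) = R • (fun x => s x * (e i).ofLp x) := by
        rw [hneg, heig, h]
        funext a
        simp only [Pi.smul_apply, smul_eq_mul]
        ring
      obtain ⟨a, ha⟩ := eq_smul_of_mulVec_eq hT0 hconn hv hTv h1
      have h2 : ∀ y, (e i).ofLp y = a * (s y * v y) := by
        intro y
        have := congrFun ha y
        simp only [Pi.smul_apply, smul_eq_mul] at this
        calc (e i).ofLp y = s y * s y * (e i).ofLp y := by rw [hs, one_mul]
          _ = s y * (s y * (e i).ofLp y) := by ring
          _ = _ := by rw [this]; ring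
      simp only [h2, mul_assoc]
      rw [← mul_sum]
      simp only [← mul_assoc]
      rw [hu', mul_zero]
  have hexp : u = ∑ i, (∑ y, (e i).ofLp y * u y) • (e i).ofLp := by
    have h1 := e.sum_repr (WithLp.toLp 2 u)
    have h2 := congrArg WithLp.ofLp h1
    rw [WithLp.ofLp_sum] at h2
    simp only [WithLp.ofLp_smul] at h2
    rw [← h2]
    refine sum_congr rfl fun i _ => ?_
    congr 1
    rw [e.repr_apply_apply, h2, PiLp.inner_apply]
    refine sum_congr rfl fun y _ => ?_
    simp [mul_comm]
  have hpow : ∀ k : ℕ, ((T ^ k) *ᵥ u) x / R ^ k =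
      ∑ i, (∑ y, (e i).ofLp y * u y) * (e i).ofLp x * (l i / R) ^ k := by
    intro k
    conv_lhs => rw [hexp]
    rw [mulVec_sum, Finset.sum_apply, sum_div]
    refine sum_congr rfl fun i _ => ?_
    rw [mulVec_smul, pow_mulVec_of_mulVec_eq (heig i), Pi.smul_apply, Pi.smul_apply, div_pow,
      smul_eq_mul, smul_eq_mul]
    ring
  simp only [hpow]
  rw [← sum_const_zero (s := (univ : Finset Ω))]
  refine tendsto_finsetSum _ fun i _ => ?_
  have hle := abs_eigenvalue_le hT0 hv hTv (hne i) (heig i)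
  rcases hle.lt_or_eq with h | h
  · have : |l i / R| < 1 := by rwa [abs_div, abs_of_pos hR, div_lt_one hR]
    simpa using (tendsto_pow_atTop_nhds_zero_of_abs_lt_one this).const_mul
      ((∑ y, (e i).ofLp y * u y) * (e i).ofLp x)
  · simp [hcoef i h]

open Classical in
/-- Asymptotics of the row sums of the powers of a connected bipartite symmetric matrix. -/
theorem tendsto_pow_mulVec_one_div [DecidableEq Ω] {T : Matrix Ω Ω ℝ} (hT0 : ∀ x y, 0 ≤ T x y)
    (hsymm : T.IsSymm) (hconn : ∀ x y, Relation.ReflTransGen (fun a b => T a b ≠ 0) x y)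
    {s : Ω → ℝ} (hs : ∀ x, s x * s x = 1) (hsT : ∀ x y, T x y ≠ 0 → s y = -s x)
    {v : Ω → ℝ} (hv : ∀ x, 0 < v x) {R : ℝ} (hR : 0 < R) (hTv : T *ᵥ v = R • v)
    (x : Ω) (τ : ℝ) (hτ : ∃ z, s z = τ) :
    Tendsto (fun k : ℕ => ((T ^ k) *ᵥ fun _ => 1) x / R ^ k)
      (atTop ⊓ 𝓟 {k | (-1) ^ k * s x = τ})
      (𝓝 (v x * (∑ y with s y = τ, v y) / ∑ y with s y = τ, v y ^ 2)) := by
  obtain ⟨z, hz⟩ := hτ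
  set S1 := ∑ y with s y = τ, v y with hS1
  set S2 := ∑ y with s y = τ, v y ^ 2 with hS2
  have hS2pos : 0 < S2 := sum_pos (fun y _ => pow_pos (hv y) 2) ⟨z, by simpa using hz⟩
  have hττ : τ * τ = 1 := by rw [← hz, hs]
  -- The indicator of the class `s = τ`, written affinely in `s` so that it can be pushed through
  -- powers of `T`. For `k` of the right parity only this class is visible from `x`.
  set p : Ω → ℝ := fun y => (1 + τ * s y) / 2 with hp
  have hp1 : ∀ y, p y = if s y = τ then 1 else 0 := by
    intro y
    split_ifs with h
    · simp only [hp, h, hττ]; norm_num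
    · have h1 : (s y - τ) * (s y + τ) = 0 := by linear_combination hs y - hττ
      have h2 : s y = -τ := by
        have := (mul_eq_zero.1 h1).resolve_left (sub_ne_zero.2 h)
        linarith
      simp only [hp, h2]
      linear_combination (-1 / 2) * hττ
  have hneg : ∀ g : Ω → ℝ, T *ᵥ (fun x => s x * g x) = fun x => -(s x * (T *ᵥ g) x) := by
    intro g
    funext a
    simp only [mulVec, dotProduct]
    rw [mul_sum, ← sum_neg_distrib]
    refine sum_congr rfl fun b _ => ?_
    by_cases h : T a b = 0
    · simp [h]
    · rw [hsT a b h]; ring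
  have hnegk : ∀ (k : ℕ) (g : Ω → ℝ), (T ^ k) *ᵥ (fun x => s x * g x) =
      fun x => (-1) ^ k * (s x * ((T ^ k) *ᵥ g) x) := by
    intro k
    induction k with
    | zero => intro g; simp
    | succ k ih =>
      intro g
      rw [pow_succ', ← mulVec_mulVec, ih]
      have : (fun x => (-1) ^ k * (s x * ((T ^ k) *ᵥ g) x)) =
          fun x => s x * ((-1 : ℝ) ^ k • ((T ^ k) *ᵥ g)) x := by
        funext y
        simp only [Pi.smul_apply, smul_eq_mul]
        ring
      rw [this, hneg, mulVec_smul, mulVec_mulVec]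
      funext y
      simp only [Pi.smul_apply, smul_eq_mul]
      ring
  have hproj : ∀ (k : ℕ) (g : Ω → ℝ), (-1) ^ k * s x = τ →
      ((T ^ k) *ᵥ fun y => p y * g y) x = ((T ^ k) *ᵥ g) x := by
    intro k g hk
    have : (fun y => p y * g y) = (1 / 2 : ℝ) • (g + τ • fun y => s y * g y) := by
      funext y
      simp only [hp, Pi.smul_apply, Pi.add_apply, smul_eq_mul]
      ring
    rw [this, mulVec_smul, mulVec_add, mulVec_smul, hnegk]
    simp only [Pi.smul_apply, Pi.add_apply, smul_eq_mul]
    linear_combination (1 / 2) * ((T ^ k) *ᵥ g) x * τ * hk + (1 / 2) * ((T ^ k) *ᵥ g) x * hττ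
  -- The constant vector minus its projection to `v`, restricted to one class; this is orthogonal to
  -- both `v` and `s v`.
  set u : Ω → ℝ := fun y => p y * (1 - S1 / S2 * v y) with hu
  have hsum1 : ∑ y, v y * u y = 0 := by
    have : ∑ y, v y * u y = S1 - S1 / S2 * S2 := by
      rw [hS1, hS2, mul_sum, ← sum_sub_distrib, sum_filter]
      refine sum_congr rfl fun y _ => ?_
      simp only [hu, hp1]
      split_ifs <;> ring
    rw [this, div_mul_cancel₀ _ hS2pos.ne', sub_self]
  have hsum2 : ∑ y, s y * v y * u y = 0 := by
    have : ∑ y, s y * v y * u y = τ * ∑ y, v y * u y := by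
      rw [mul_sum]
      refine sum_congr rfl fun y _ => ?_
      simp only [hu, hp1]
      split_ifs with h
      · rw [h]; ring
      · ring
    rw [this, hsum1, mul_zero]
  have hlim := tendsto_pow_mulVec_div hT0 hsymm hconn hs hsT hv hR hTv hsum1 hsum2 x
  have hlim2 := (hlim.mono_left (inf_le_left (b := 𝓟 {k : ℕ | (-1) ^ k * s x = τ}))).add_const
    (v x * S1 / S2)
  rw [zero_add] at hlim2
  refine hlim2.congr' ?_
  filter_upwards [mem_inf_of_right (mem_principal_self _)] with k hk
  have h1 := hproj k (fun y => 1 - S1 / S2 * v y) hk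
  have h2 : (fun y => 1 - S1 / S2 * v y) = (fun _ => (1 : ℝ)) - (S1 / S2) • v := by
    funext y
    simp
  rw [h1, h2, mulVec_sub, mulVec_smul, pow_mulVec_of_mulVec_eq hTv]
  simp only [Pi.sub_apply, Pi.smul_apply, smul_eq_mul]
  have := (pow_pos hR k).ne'
  field_simp
  ring

end PerronFrobenius

/-! ### The doubled lattice alcove, its transfer matrix, the Perron eigenvector and connectivity. -/

section LatticeAlcove

/-- Twice the lattice points of the alcove: strictly decreasing vectors of positive integers of
equal parity with `z₁ + z₂ < 2M`. -/
def latticeAlcove {n : ℕ} (hn : 2 ≤ n) (M : ℕ) : Set (Fin n → ℤ) :=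
  {z | StrictAnti z ∧ (∀ i, 0 < z i) ∧ z ⟨0, by omega⟩ + z ⟨1, by omega⟩ < 2 * M ∧
    ∀ i j, z i % 2 = z j % 2}

/-- Two lattice points differ by a diagonal step. -/
def StepAdj {n : ℕ} (x y : Fin n → ℤ) : Prop := ∀ j, y j = x j + 1 ∨ y j = x j - 1

theorem StepAdj.symm {n : ℕ} {x y : Fin n → ℤ} (h : StepAdj x y) : StepAdj y x := by
  intro j
  rcases h j with h | h <;> omega

theorem latticeAlcove_lt {n : ℕ} {hn : 2 ≤ n} {M : ℕ} {z : Fin n → ℤ}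
    (hz : z ∈ latticeAlcove hn M) (i : Fin n) : z i < 2 * M := by
  obtain ⟨h1, h2, h3, -⟩ := hz
  have : z i ≤ z ⟨0, by omega⟩ := h1.antitone (Fin.mk_le_of_le_val (Nat.zero_le _))
  have := h2 ⟨1, by omega⟩
  omega

theorem latticeAlcove_add_lt {n : ℕ} {hn : 2 ≤ n} {M : ℕ} {z : Fin n → ℤ}
    (hz : z ∈ latticeAlcove hn M) {i j : Fin n} (hij : i < j) : z i + z j < 2 * M := by
  obtain ⟨h1, h2, h3, -⟩ := hz
  have : z i ≤ z ⟨0, by omega⟩ := h1.antitone (Fin.mk_le_of_le_val (Nat.zero_le _))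
  have : z j ≤ z ⟨1, by omega⟩ := by
    refine h1.antitone (Fin.mk_le_of_le_val ?_)
    have := Fin.lt_def.1 hij
    omega
  omega

theorem latticeAlcove_finite {n : ℕ} (hn : 2 ≤ n) (M : ℕ) : (latticeAlcove hn M).Finite := by
  refine (Set.Finite.pi' fun _ : Fin n => Set.finite_Icc (0 : ℤ) (2 * M)).subset fun z hz i => ?_
  exact ⟨(hz.2.1 i).le, (latticeAlcove_lt hz i).le⟩

noncomputable instance {n : ℕ} (hn : 2 ≤ n) (M : ℕ) : Fintype (latticeAlcove hn M) :=
  (latticeAlcove_finite hn M).fintype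

open Classical in
/-- The transfer matrix of the diagonal walk on the lattice points of the alcove. -/
noncomputable def transferMatrix {n : ℕ} (hn : 2 ≤ n) (M : ℕ) :
    Matrix (latticeAlcove hn M) (latticeAlcove hn M) ℝ :=
  of fun x y => if StepAdj x.1 y.1 then 1 else 0

theorem transferMatrix_nonneg {n : ℕ} (hn : 2 ≤ n) (M : ℕ) (x y) :
    0 ≤ transferMatrix hn M x y := by
  unfold transferMatrix
  rw [of_apply]
  split_ifs <;> norm_num

theorem transferMatrix_ne_zero {n : ℕ} {hn : 2 ≤ n} {M : ℕ} {x y} :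
    transferMatrix hn M x y ≠ 0 ↔ StepAdj x.1 y.1 := by
  unfold transferMatrix
  rw [of_apply]
  split_ifs with h <;> simp [h]

theorem transferMatrix_isSymm {n : ℕ} (hn : 2 ≤ n) (M : ℕ) : (transferMatrix hn M).IsSymm := by
  ext x y
  simp only [transferMatrix, transpose_apply, of_apply]
  congr 1
  exact propext ⟨StepAdj.symm, StepAdj.symm⟩

theorem sinProd_pos {n : ℕ} {hn : 2 ≤ n} {M : ℕ} {z : Fin n → ℤ} (hz : z ∈ latticeAlcove hn M) :
    0 < sinProd (Real.pi / (2 * M)) (fun j => (z j : ℝ)) := by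
  have hM : 0 < M := by
    have := latticeAlcove_lt hz ⟨0, by omega⟩
    have := hz.2.1 ⟨0, by omega⟩
    omega
  have hM' : (0 : ℝ) < M := by exact_mod_cast hM
  have key : ∀ a : ℤ, 0 < a → a < 2 * M → 0 < Real.sin (Real.pi / (2 * M) * a) := by
    intro a h1 h2
    have h1' : (0 : ℝ) < a := by exact_mod_cast h1
    have h2' : (a : ℝ) < 2 * M := by exact_mod_cast h2
    apply Real.sin_pos_of_pos_of_lt_pi
    · have := Real.pi_pos
      positivity
    · rw [div_mul_eq_mul_div, div_lt_iff₀ (by positivity)]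
      exact mul_lt_mul_of_pos_left h2' Real.pi_pos
  unfold sinProd
  refine mul_pos (prod_pos fun h _ => prod_pos fun t ht => ?_) (prod_pos fun h _ => ?_)
  · have hlt := mem_Ioi.1 ht
    have h1 := hz.1 hlt
    have h2 := latticeAlcove_lt hz h
    have h3 := latticeAlcove_add_lt hz hlt
    have h4 := hz.2.1 h
    have h5 := hz.2.1 t
    have k1 := key (z h - z t) (by omega) (by omega)
    have k2 := key (z h + z t) (by omega) (by omega)
    push_cast at k1 k2
    exact mul_pos k1 k2
  · exact key _ (hz.2.1 h) (latticeAlcove_lt hz h)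

theorem sinDet_pos {n : ℕ} {hn : 2 ≤ n} {M : ℕ} {z : Fin n → ℤ} (hz : z ∈ latticeAlcove hn M) :
    0 < sinDet (Real.pi / (2 * M)) (fun j => (z j : ℝ)) := by
  rw [sinDet_eq]
  have := sinProd_pos hz
  positivity

/-- Equal parities make coordinate differences and sums even, so one step cannot jump over a wall: a
point outside has `yᵢ = yⱼ`, `yᵢ = 0` or `y₁ + y₂ = 2M`, and a factor of the sine product vanishes.
-/
theorem sinDet_eq_zero_of_stepAdj {n : ℕ} {hn : 2 ≤ n} {M : ℕ} {x y : Fin n → ℤ}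
    (hx : x ∈ latticeAlcove hn M) (hxy : StepAdj x y) (hy : y ∉ latticeAlcove hn M) :
    sinDet (Real.pi / (2 * M)) (fun j => (y j : ℝ)) = 0 := by
  have hM : 0 < M := by
    have := latticeAlcove_lt hx ⟨0, by omega⟩
    have := hx.2.1 ⟨0, by omega⟩
    omega
  have hM' : (0 : ℝ) < M := by exact_mod_cast hM
  obtain ⟨h1, h2, h3, h4⟩ := hx
  rw [sinDet_eq]
  apply mul_eq_zero_of_right
  unfold sinProd
  have hpair : ∀ h t : Fin n, h < t → Real.sin (Real.pi / (2 * M) * ((y h : ℝ) - y t)) *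
      Real.sin (Real.pi / (2 * M) * ((y h : ℝ) + y t)) = 0 →
      ∏ h, ∏ t ∈ Ioi h, (Real.sin (Real.pi / (2 * M) * ((y h : ℝ) - y t)) *
      Real.sin (Real.pi / (2 * M) * ((y h : ℝ) + y t))) = 0 := by
    intro h t hlt h0
    exact prod_eq_zero (mem_univ h) (prod_eq_zero (mem_Ioi.2 hlt) h0)
  by_cases ha : StrictAnti y
  · by_cases hb : ∀ i, 0 < y i
    · apply mul_eq_zero_of_left
      have hpar : ∀ i j, y i % 2 = y j % 2 := by
        intro i j
        have := h4 i j
        rcases hxy i with h | h <;> rcases hxy j with h' | h' <;> omega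
      have hc : ¬ y ⟨0, by omega⟩ + y ⟨1, by omega⟩ < 2 * M := fun hc => hy ⟨ha, hb, hc, hpar⟩
      have he : y ⟨0, by omega⟩ + y ⟨1, by omega⟩ = 2 * M := by
        have := h4 ⟨0, by omega⟩ ⟨1, by omega⟩
        rcases hxy ⟨0, by omega⟩ with h | h <;> rcases hxy ⟨1, by omega⟩ with h' | h' <;> omega
      refine hpair ⟨0, by omega⟩ ⟨1, by omega⟩ (by simp) (mul_eq_zero_of_right _ ?_)
      have he' : (y ⟨0, by omega⟩ : ℝ) + y ⟨1, by omega⟩ = 2 * M := by exact_mod_cast he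
      rw [he', div_mul_cancel₀ _ (by positivity), Real.sin_pi]
    · push Not at hb
      obtain ⟨i, hi⟩ := hb
      have he : y i = 0 := by
        have := h2 i
        rcases hxy i with h | h <;> omega
      exact mul_eq_zero_of_right _ (prod_eq_zero (mem_univ i) (by simp [he]))
  · apply mul_eq_zero_of_left
    simp only [StrictAnti, not_forall, not_lt] at ha
    obtain ⟨i, j, hij, hle⟩ := ha
    have he : y i = y j := by
      have := h1 hij
      have := h4 i j
      rcases hxy i with h | h <;> rcases hxy j with h' | h' <;> omega
    exact hpair i j hij (mul_eq_zero_of_left (by simp [he]) _)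

/-- Multilinearity turns the sum over sign choices into one determinant with entries `sin(a+β) +
sin(a-β) = 2 cos β sin a`, where `β = (2i+1)α` depends only on the frequency index. -/
theorem sum_sinDet_step {n : ℕ} (α : ℝ) (x : Fin n → ℤ) :
    ∑ S : Finset (Fin n), sinDet α (fun j => ((if j ∈ S then x j + 1 else x j - 1 : ℤ) : ℝ)) =
      (∏ i : Fin n, (2 * Real.cos ((2 * (i : ℕ) + 1) * α))) * sinDet α (fun j => (x j : ℝ)) := by
  have := (detRowAlternating (n := Fin n) (R := ℝ)).toMultilinearMap.map_add_univ
    (fun j i => Real.sin ((2 * (i : ℕ) + 1) * (α * (x j + 1))))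
    (fun j i => Real.sin ((2 * (i : ℕ) + 1) * (α * (x j - 1))))
  refine Eq.trans (sum_congr rfl fun S _ => ?_) (this.symm.trans ?_)
  · change _ = det _
    unfold sinDet
    rw [← det_transpose]
    congr 1
    ext j i
    by_cases h : j ∈ S <;> simp [h]
  · change det _ = _
    unfold sinDet
    rw [← det_mul_column, ← det_transpose]
    congr 1
    ext j i
    simp only [transpose_apply, Pi.add_apply, of_apply]
    have e1 : (2 * ((i : ℕ) : ℝ) + 1) * (α * (x j + 1)) =
      (2 * ((i : ℕ) : ℝ) + 1) * (α * x j) + (2 * ((i : ℕ) : ℝ) + 1) * α := by ring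
    have e2 : (2 * ((i : ℕ) : ℝ) + 1) * (α * (x j - 1)) =
      (2 * ((i : ℕ) : ℝ) + 1) * (α * x j) - (2 * ((i : ℕ) : ℝ) + 1) * α := by ring
    rw [e1, e2, Real.sin_add, Real.sin_sub]
    ring

/-- The sum over admissible neighbours may be extended to all `2^n` sign choices, because the extra
points lie on walls where the vector vanishes. -/
theorem transferMatrix_mulVec_sinDet {n : ℕ} (hn : 2 ≤ n) (M : ℕ) :
    transferMatrix hn M *ᵥ (fun z => sinDet (Real.pi / (2 * M)) (fun j => (z.1 j : ℝ))) =
      (∏ i : Fin n, (2 * Real.cos ((2 * (i : ℕ) + 1) * (Real.pi / (2 * M))))) •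
        fun z => sinDet (Real.pi / (2 * M)) (fun j => (z.1 j : ℝ)) := by
  classical
  funext x
  rw [Pi.smul_apply, smul_eq_mul, ← sum_sinDet_step]
  simp only [mulVec, dotProduct, transferMatrix, of_apply, ite_mul, one_mul, zero_mul]
  rw [← sum_filter]
  refine sum_of_injOn (fun y => univ.filter fun j => y.1 j = x.1 j + 1) ?_ ?_ ?_ ?_
  · intro y hy y' hy' h
    ext j
    have h1 := (mem_filter.1 hy).2 j
    have h2 := (mem_filter.1 hy').2 j
    have h3 : y.1 j = x.1 j + 1 ↔ y'.1 j = x.1 j + 1 := by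
      simpa using Finset.ext_iff.1 h j
    omega
  · intro y _
    simp
  · intro S _ hS
    refine sinDet_eq_zero_of_stepAdj x.2 (fun j => ?_) fun hmem => hS ?_
    · by_cases h : j ∈ S <;> simp [h]
    · refine ⟨⟨_, hmem⟩, ?_, ?_⟩
      · simp only [coe_filter, mem_univ, true_and, Set.mem_ofPred_eq]
        intro j
        by_cases h : j ∈ S <;> simp [h]
      · ext j
        by_cases h : j ∈ S
        · simp [h]
        · simp only [mem_filter, mem_univ, true_and, h, if_false, iff_false]
          omega
  · intro y hy
    congr 1
    funext j
    have h1 := (mem_filter.1 hy).2 j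
    simp only [mem_filter, mem_univ, true_and]
    split_ifs with h
    · rw [h]
    · rw [h1.resolve_left h]

/-- Every point descends to the minimal one, `(2n-1, …, 3, 1)`, by induction on the coordinate sum.
Even points move down by `1` everywhere; in an odd point the last coordinate that is not minimal
drops by `2` in two steps. -/
theorem exists_reflTransGen_stepAdj {n : ℕ} (hn : 2 ≤ n) (M : ℕ) :
    ∀ (N : ℕ) (x : latticeAlcove hn M), ∑ j, x.1 j = N → ∃ b : latticeAlcove hn M,
      (∀ j, b.1 j = 2 * (j.rev : ℕ) + 1) ∧
      Relation.ReflTransGen (fun a b : latticeAlcove hn M => StepAdj a.1 b.1) x b := by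
  intro N
  induction N using Nat.strong_induction_on with
  | _ N ih =>
    intro x hxN
    obtain ⟨z, hz⟩ := x
    obtain ⟨h1, h2, h3, h4⟩ := hz
    simp only at hxN
    have hred : ∀ y : latticeAlcove hn M, ∑ j, y.1 j < ∑ j, z j →
        Relation.ReflTransGen (fun a b : latticeAlcove hn M => StepAdj a.1 b.1)
          ⟨z, h1, h2, h3, h4⟩ y → ∃ b : latticeAlcove hn M,
      (∀ j, b.1 j = 2 * (j.rev : ℕ) + 1) ∧
      Relation.ReflTransGen (fun a b : latticeAlcove hn M => StepAdj a.1 b.1)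
        ⟨z, h1, h2, h3, h4⟩ b := by
      intro y hy hzy
      have h0 : 0 ≤ ∑ j, y.1 j := sum_nonneg fun j _ => (y.2.2.1 j).le
      obtain ⟨K, hK⟩ := Int.eq_ofNat_of_zero_le h0
      obtain ⟨b, hb1, hb2⟩ := ih K (by omega) y hK
      exact ⟨b, hb1, hzy.trans hb2⟩
    by_cases hpar : z ⟨0, by omega⟩ % 2 = 0
    · have hev : ∀ i, z i % 2 = 0 := fun i => by rw [h4 i ⟨0, by omega⟩, hpar]
      refine hred ⟨fun j => z j - 1, ?_, ?_, ?_, ?_⟩ ?_ (Relation.ReflTransGen.single ?_)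
      · intro i j hij
        have := h1 hij
        simpa using this
      · intro i
        have := h2 i
        have := hev i
        simp only
        omega
      · simp only
        omega
      · intro i j
        have := hev i
        have := hev j
        simp only
        omega
      · refine sum_lt_sum (fun i _ => by simp) ⟨⟨0, by omega⟩, mem_univ _, by simp⟩
      · intro j
        exact Or.inr rfl
    · by_cases hall : ∀ j : Fin n, z j = 2 * (j.rev : ℕ) + 1
      · exact ⟨⟨z, h1, h2, h3, h4⟩, hall, Relation.ReflTransGen.refl⟩
      · push Not at hall
        obtain ⟨j, hj, hmax⟩ : ∃ j : Fin n, z j ≠ 2 * (j.rev : ℕ) + 1 ∧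
            ∀ i, j < i → z i = 2 * (i.rev : ℕ) + 1 := by
          obtain ⟨j, hj⟩ := hall
          obtain ⟨j', hj', hm⟩ := exists_max_image
            (univ.filter fun j : Fin n => z j ≠ 2 * (j.rev : ℕ) + 1) id ⟨j, by simpa using hj⟩
          refine ⟨j', (mem_filter.1 hj').2, fun i hi => ?_⟩
          by_contra hne
          exact absurd (hm i (by simpa using hne)) (not_le.2 hi)
        have hodd : ∀ i, z i % 2 = 1 := fun i => by
          have := h4 i ⟨0, by omega⟩
          omega
        have hzj : 2 * (j.rev : ℕ) + 3 ≤ z j := by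
          have hr : (j.rev : ℕ) = n - (j + 1) := Fin.val_rev j
          have := hodd j
          have := h2 j
          by_cases hl : (j : ℕ) + 1 < n
          · have hlt : j < ⟨j + 1, hl⟩ := by simp [Fin.lt_def]
            have e1 := hmax ⟨j + 1, hl⟩ hlt
            have e2 := h1 hlt
            have hr2 : ((⟨j + 1, hl⟩ : Fin n).rev : ℕ) = n - (j + 1 + 1) := Fin.val_rev _
            omega
          · omega
        have hafter : ∀ i, j < i → z i + 4 ≤ z j := by
          intro i hi
          have := hmax i hi
          have hr : (j.rev : ℕ) = n - (j + 1) := Fin.val_rev j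
          have hr2 : (i.rev : ℕ) = n - (i + 1) := Fin.val_rev i
          have := Fin.lt_def.1 hi
          omega
        have hle : ∀ i, i ≤ j → z j ≤ z i := fun i hi => h1.antitone hi
        refine hred ⟨fun i => if i = j then z i - 2 else z i, ?_, ?_, ?_, ?_⟩ ?_ ?_
        · intro a b hab
          have := h1 hab
          simp only
          split_ifs with e1 e2 e2
          · omega
          · omega
          · subst e2
            have := hafter b hab
            omega
          · omega
        · intro i
          have := h2 i
          simp only
          split_ifs with e1
          · subst e1; omega
          · omega
        · simp only
          split_ifs <;> omega
        · intro a b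
          have := hodd a
          have := hodd b
          simp only
          split_ifs <;> omega
        · refine sum_lt_sum (fun i _ => ?_) ⟨j, mem_univ _, by simp⟩
          simp only
          split_ifs <;> omega
        -- Halfway, coordinates up to `j` go down and later ones go up; the next step undoes this
        -- except at `j`. The gap of at least `4` after position `j` keeps the order strict.
        · have hmid : (fun i => if i ≤ j then z i - 1 else z i + 1) ∈ latticeAlcove hn M := by
            refine ⟨?_, ?_, ?_, ?_⟩
            · intro a b hab
              have := h1 hab
              simp only
              split_ifs with e1 e2 e2
              · omega
              · exact absurd (hab.le.trans e1) e2
              · have := hle a e2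
                have := hafter b (not_le.1 e1)
                omega
              · omega
            · intro i
              have := h2 i
              simp only
              split_ifs with e1
              · have := hle i e1
                omega
              · omega
            · have e0 : (⟨0, by omega⟩ : Fin n) ≤ j := Fin.mk_le_of_le_val (Nat.zero_le _)
              simp only [e0, if_true]
              split_ifs <;> omega
            · intro a b
              have := hodd a
              have := hodd b
              simp only
              split_ifs <;> omega
          refine (Relation.ReflTransGen.single (b := ⟨_, hmid⟩) ?_).tail ?_
          · intro i
            simp only
            split_ifs
            · exact Or.inr rfl
            · exact Or.inl rfl
          · intro i
            simp only
            rcases lt_trichotomy i j with h | h | h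
            · rw [if_neg h.ne, if_pos h.le]; omega
            · rw [if_pos h, if_pos h.le]; omega
            · rw [if_neg h.ne', if_neg (not_le.2 h)]; omega

theorem reflTransGen_transferMatrix {n : ℕ} (hn : 2 ≤ n) (M : ℕ) (x y) :
    Relation.ReflTransGen (fun a b => transferMatrix hn M a b ≠ 0) x y := by
  simp only [transferMatrix_ne_zero]
  have hsum : ∀ x : latticeAlcove hn M, ∃ N : ℕ, ∑ j, x.1 j = N := fun x =>
    Int.eq_ofNat_of_zero_le (sum_nonneg fun j _ => (x.2.2.1 j).le)
  obtain ⟨N, hN⟩ := hsum x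
  obtain ⟨N', hN'⟩ := hsum y
  obtain ⟨b, hb, hxb⟩ := exists_reflTransGen_stepAdj hn M N x hN
  obtain ⟨b', hb', hyb⟩ := exists_reflTransGen_stepAdj hn M N' y hN'
  have hbb : b = b' := by
    ext j
    rw [hb, hb']
  subst hbb
  have : Std.Symm (fun a b : latticeAlcove hn M => StepAdj a.1 b.1) := ⟨fun _ _ h => h.symm⟩
  exact hxb.trans (Std.Symm.symm _ _ hyb)

end LatticeAlcove

/-! ### Walk counts as row sums of matrix powers. -/

section Counting

/-- The point of `ℝⁿ` whose double is a given lattice point. -/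
noncomputable def halve {n : ℕ} (z : Fin n → ℤ) : Fin n → ℝ := fun j => z j / 2

theorem halve_injective {n : ℕ} : Function.Injective (halve (n := n)) := by
  intro x y h
  funext j
  have := congrFun h j
  simp only [halve] at this
  have h2 : (x j : ℝ) = y j := by linarith
  exact_mod_cast h2

theorem halve_mem_alcoveB {n : ℕ} {hn : 2 ≤ n} {M : ℕ} {m : ℝ} (hm : 2 * m = M) {z : Fin n → ℤ} :
    halve z ∈ alcoveB hn m ↔
      StrictAnti z ∧ (∀ i, 0 < z i) ∧ z ⟨0, by omega⟩ + z ⟨1, by omega⟩ < 2 * M := by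
  have hlt : ∀ a b : ℤ, (a : ℝ) / 2 < b / 2 ↔ a < b := fun a b => by
    rw [div_lt_div_iff_of_pos_right (by norm_num : (0 : ℝ) < 2)]
    exact_mod_cast Iff.rfl
  unfold alcoveB halve
  simp only [Set.mem_ofPred_eq]
  refine and_congr ⟨fun h i j hij => (hlt _ _).1 (h i j hij), fun h i j hij => (hlt _ _).2 (h hij)⟩
    (and_congr (forall_congr' fun i => ?_) ?_)
  · simp
  · rw [hm, ← add_div, div_lt_iff₀ (by norm_num : (0 : ℝ) < 2), mul_comm]
    exact_mod_cast Iff.rfl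

theorem isDiagonalStep_halve {n : ℕ} {x y : Fin n → ℤ} :
    IsDiagonalStep (halve y - halve x) ↔ StepAdj x y := by
  unfold IsDiagonalStep StepAdj halve
  refine forall_congr' fun j => or_congr ?_ ?_
  · rw [Pi.sub_apply]
    constructor
    · intro h
      have : (y j : ℝ) = x j + 1 := by linarith
      exact_mod_cast this
    · intro h
      rw [h]
      push_cast
      ring
  · rw [Pi.sub_apply]
    constructor
    · intro h
      have : (y j : ℝ) = x j - 1 := by linarith
      exact_mod_cast this
    · intro h
      rw [h]
      push_cast
      ring

theorem exists_halve_of_isDiagonalStep {n : ℕ} {x : Fin n → ℤ} {p : Fin n → ℝ}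
    (h : IsDiagonalStep (p - halve x)) : ∃ y, p = halve y := by
  have : ∀ j, ∃ a : ℤ, p j = a / 2 := by
    intro j
    rcases h j with h | h
    · refine ⟨x j + 1, ?_⟩
      simp only [Pi.sub_apply, halve] at h
      push_cast
      linarith
    · refine ⟨x j - 1, ?_⟩
      simp only [Pi.sub_apply, halve] at h
      push_cast
      linarith
  choose y hy using this
  exact ⟨y, funext hy⟩

theorem mem_latticeAlcove_of_stepAdj {n : ℕ} {hn : 2 ≤ n} {M : ℕ} {m : ℝ} (hm : 2 * m = M)
    {x y : Fin n → ℤ} (hx : x ∈ latticeAlcove hn M) (hxy : StepAdj x y)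
    (hy : halve y ∈ alcoveB hn m) : y ∈ latticeAlcove hn M := by
  obtain ⟨h1, h2, h3⟩ := (halve_mem_alcoveB hm).1 hy
  refine ⟨h1, h2, h3, fun i j => ?_⟩
  have := hx.2.2.2 i j
  rcases hxy i with h | h <;> rcases hxy j with h' | h' <;> omega

theorem diagonalWalks_succ {n : ℕ} {hn : 2 ≤ n} {M : ℕ} {m : ℝ} (hm : 2 * m = M)
    (x : latticeAlcove hn M) (k : ℕ) :
    diagonalWalks (alcoveB hn m) (halve x.1) (k + 1) =
      ⋃ y ∈ {y : latticeAlcove hn M | StepAdj x.1 y.1},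
        (fun w => (Fin.cons (halve x.1) w : Fin (k + 1 + 1) → Fin n → ℝ)) ''
          diagonalWalks (alcoveB hn m) (halve y.1) k := by
  ext w
  simp only [Set.mem_iUnion, Set.mem_image, exists_prop, Set.mem_ofPred_eq]
  constructor
  · rintro ⟨h1, h2, h3⟩
    have hs := h2 0
    rw [Fin.castSucc_zero, h1] at hs
    obtain ⟨y, hy⟩ := exists_halve_of_isDiagonalStep hs
    rw [hy, isDiagonalStep_halve] at hs
    have hyA : halve y ∈ alcoveB hn m := hy ▸ h3 _
    refine ⟨⟨y, mem_latticeAlcove_of_stepAdj hm x.2 hs hyA⟩, hs, Fin.tail w, ⟨?_, ?_, ?_⟩, ?_⟩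
    · exact hy
    · intro i
      exact h2 i.succ
    · intro i
      exact h3 i.succ
    · rw [← h1, Fin.cons_self_tail]
  · rintro ⟨y, hxy, w', ⟨h1, h2, h3⟩, rfl⟩
    refine ⟨by simp, ?_, ?_⟩
    · intro i
      refine Fin.cases ?_ (fun i => ?_) i
      · simp only [Fin.cons_succ, Fin.castSucc_zero, Fin.cons_zero, h1]
        exact isDiagonalStep_halve.2 hxy
      · rw [← Fin.succ_castSucc]
        simpa using h2 i
    · intro i
      refine Fin.cases ?_ (fun i => ?_) i
      · simpa using (halve_mem_alcoveB hm).2 ⟨x.2.1, x.2.2.1, x.2.2.2.1⟩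
      · simpa using h3 i

/-- Walks are split by their first step. Finiteness is proved in the same induction because
additivity of `ncard` over the disjoint union requires it. -/
theorem diagonalWalks_finite_and_ncard {n : ℕ} {hn : 2 ≤ n} {M : ℕ} {m : ℝ} (hm : 2 * m = M)
    [DecidableEq (latticeAlcove hn M)] (k : ℕ) (x : latticeAlcove hn M) :
    (diagonalWalks (alcoveB hn m) (halve x.1) k).Finite ∧
      (numDiagonalWalks (alcoveB hn m) (halve x.1) k : ℝ) =
        ((transferMatrix hn M ^ k) *ᵥ fun _ => 1) x := by
  classical
  induction k generalizing x with
  | zero =>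
    have : diagonalWalks (alcoveB hn m) (halve x.1) 0 = {fun _ => halve x.1} := by
      ext w
      simp only [diagonalWalks, Set.mem_ofPred_eq, Set.mem_singleton_iff]
      constructor
      · rintro ⟨h, -, -⟩
        funext i
        rw [show i = 0 from Fin.ext (by omega), h]
      · rintro rfl
        exact ⟨rfl, fun i => i.elim0,
          fun _ => (halve_mem_alcoveB hm).2 ⟨x.2.1, x.2.2.1, x.2.2.2.1⟩⟩
    rw [numDiagonalWalks, this]
    simp
  | succ k ih =>
    have hinj : Function.Injective
        (fun w => (Fin.cons (halve x.1) w : Fin (k + 1 + 1) → Fin n → ℝ)) :=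
      Fin.cons_right_injective (α := fun _ => Fin n → ℝ) _
    have hfin : ∀ y ∈ {y : latticeAlcove hn M | StepAdj x.1 y.1},
        ((fun w => (Fin.cons (halve x.1) w : Fin (k + 1 + 1) → Fin n → ℝ)) ''
          diagonalWalks (alcoveB hn m) (halve y.1) k).Finite := fun y _ => (ih y).1.image _
    have hdisj : {y : latticeAlcove hn M | StepAdj x.1 y.1}.PairwiseDisjoint
        fun y => ((fun w => (Fin.cons (halve x.1) w : Fin (k + 1 + 1) → Fin n → ℝ)) ''
          diagonalWalks (alcoveB hn m) (halve y.1) k) := by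
      intro y _ y' _ hne
      refine Set.disjoint_left.2 ?_
      rintro _ ⟨w, hw, rfl⟩ ⟨w', hw', he⟩
      have hww : w' = w := hinj he
      subst hww
      exact hne (Subtype.ext (halve_injective (hw.1.symm.trans hw'.1)))
    constructor
    · rw [diagonalWalks_succ hm]
      exact (Set.toFinite _).biUnion hfin
    · rw [numDiagonalWalks, diagonalWalks_succ hm, (Set.toFinite _).ncard_biUnion hfin hdisj,
        pow_succ', ← mulVec_mulVec]
      have hc : {y : latticeAlcove hn M | StepAdj x.1 y.1} =
          ((univ.filter fun y : latticeAlcove hn M => StepAdj x.1 y.1 :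
            Finset (latticeAlcove hn M)) : Set (latticeAlcove hn M)) := by
        ext y; simp
      rw [hc, finsum_mem_coe_finset, Nat.cast_sum, sum_filter]
      simp only [mulVec, dotProduct]
      refine sum_congr rfl fun y _ => ?_
      rw [Set.ncard_image_of_injective _ hinj]
      have := (ih y).2
      simp only [numDiagonalWalks, mulVec, dotProduct] at this
      rw [this]
      simp only [transferMatrix, of_apply]
      split_ifs <;> simp

end Counting

/-! ### The Cauchy-Binet formula over decreasing sequences. -/

section CauchyBinet

/-- An injective tuple is a decreasing one composed with a unique permutation, obtained by sorting
and reversing. -/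
theorem sum_injective_eq_sum_decSeq {A : Type*} [AddCommMonoid A] (n c : ℕ)
    [DecidablePred (Function.Injective : (Fin n → ℕ) → Prop)]
    (F : (Fin n → ℕ) → A) :
    ∑ x ∈ (Fintype.piFinset fun _ : Fin n => range c) with Function.Injective x, F x =
      ∑ s ∈ decSeq n c, ∑ σ : Equiv.Perm (Fin n), F (s ∘ σ) := by
  rw [← sum_product']
  symm
  refine sum_bij (fun p _ => p.1 ∘ p.2) ?_ ?_ ?_ ?_
  · rintro ⟨s, σ⟩ h
    obtain ⟨h1, h2⟩ := mem_decSeq.1 (mem_product.1 h).1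
    simp only [mem_filter, Fintype.mem_piFinset, mem_range]
    exact ⟨fun i => h1 _, h2.injective.comp σ.injective⟩
  · rintro ⟨s, σ⟩ h ⟨s', σ'⟩ h' he
    obtain ⟨h1, h2⟩ := mem_decSeq.1 (mem_product.1 h).1
    obtain ⟨h1', h2'⟩ := mem_decSeq.1 (mem_product.1 h').1
    simp only at he h2 h2'
    have hr : Set.range (s ∘ Fin.rev) = Set.range (s' ∘ Fin.rev) := by
      have e1 : Set.range (s ∘ Fin.rev) = Set.range s := Fin.rev_surjective.range_comp s
      have e2 : Set.range (s' ∘ Fin.rev) = Set.range s' := Fin.rev_surjective.range_comp s'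
      have e3 : Set.range (s ∘ σ) = Set.range s := σ.surjective.range_comp s
      have e4 : Set.range (s' ∘ σ') = Set.range s' := σ'.surjective.range_comp s'
      rw [e1, e2, ← e3, ← e4, he]
    have hm : StrictMono (s ∘ Fin.rev) := h2.comp Fin.rev_strictAnti
    have hm' : StrictMono (s' ∘ Fin.rev) := h2'.comp Fin.rev_strictAnti
    have hss := (hm.range_inj hm').1 hr
    have hs : s = s' := Fin.rev_surjective.injective_comp_right hss
    subst hs
    have : σ = σ' := by
      ext i
      exact congrArg _ (h2.injective (congrFun he i))
    rw [this]
  · intro x hx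
    simp only [mem_filter, Fintype.mem_piFinset, mem_range] at hx
    obtain ⟨h1, h2⟩ := hx
    set τ : Equiv.Perm (Fin n) := Fin.revPerm.trans (Tuple.sort x) with hτ
    have hmono : StrictMono (x ∘ Tuple.sort x) :=
      (Tuple.monotone_sort x).strictMono_of_injective (h2.comp (Tuple.sort x).injective)
    have hanti : StrictAnti (x ∘ τ) := by
      have : x ∘ τ = (x ∘ Tuple.sort x) ∘ Fin.rev := by
        funext i; simp [hτ]
      rw [this]
      exact hmono.comp_strictAnti Fin.rev_strictAnti
    refine ⟨(x ∘ τ, τ.symm), ?_, ?_⟩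
    · simp only [mem_product, mem_univ, and_true, mem_decSeq]
      exact ⟨fun i => h1 _, hanti⟩
    · funext i
      simp
  · intro _ _
    rfl

/-- The Cauchy–Binet formula for matrices with columns indexed by `0, …, c - 1`. -/
theorem sum_decSeq_det_mul_det {K : Type*} [CommRing K] {n : ℕ} (c : ℕ) (A B : Fin n → ℕ → K) :
    ∑ s ∈ decSeq n c, det (of fun i j => A i (s j)) * det (of fun i j => B i (s j)) =
      det (of fun i j => ∑ x ∈ range c, A i x * B j x) := by
  classical
  have h1 : det (of fun i j => ∑ x ∈ range c, A i x * B j x) =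
      ∑ x ∈ Fintype.piFinset fun _ : Fin n => range c,
        (∏ i, A i (x i)) * det (of fun i j => B j (x i)) := by
    have := (detRowAlternating (n := Fin n) (R := K)).toMultilinearMap.map_sum_finset
      (fun i x => fun j => A i x * B j x) (fun _ => range c)
    refine Eq.trans ?_ (this.trans (sum_congr rfl fun x _ => ?_))
    · change _ = det _
      congr 1
      ext i j
      simp
    · change det _ = _
      rw [← det_mul_column]
      rfl
  rw [h1, ← sum_filter_add_sum_filter_not (Fintype.piFinset fun _ => range c) Function.Injective,
    sum_injective_eq_sum_decSeq,
    sum_eq_zero (s := filter (fun x => ¬ Function.Injective x) _), add_zero]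
  · refine sum_congr rfl fun s _ => ?_
    have h2 : ∀ σ : Equiv.Perm (Fin n), det (of fun i j => B j ((s ∘ σ) i)) =
        (Equiv.Perm.sign σ : K) * det (of fun i j => B i (s j)) := by
      intro σ
      rw [← det_transpose (of fun i j => B i (s j)), ← det_permute]
      rfl
    simp only [h2]
    rw [← det_transpose (of fun i j => A i (s j)), det_apply', sum_mul]
    refine sum_congr rfl fun σ _ => ?_
    simp only [transpose_apply, of_apply, Function.comp]
    ring
  · intro x hx
    have hx' := (mem_filter.1 hx).2
    simp only [Function.Injective, not_forall] at hx'
    obtain ⟨i, j, hij, hne⟩ := hx'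
    rw [det_zero_of_row_eq hne, mul_zero]
    funext k
    simp [hij]

end CauchyBinet

/-! ### The reflection symmetry of the alcove and the splitting of a parity class. -/

section Reflection

/-- The bound on `s` says that all coordinates are at most `M`; as the first two are distinct, their
sum is below `2M`. -/
theorem two_mul_add_mem_latticeAlcove {n : ℕ} {hn : 2 ≤ n} {M b : ℕ} (hb : 0 < b) {s : Fin n → ℕ}
    (hs : s ∈ decSeq n ((M + 2 - b) / 2)) :
    (fun j => 2 * (s j : ℤ) + b) ∈ latticeAlcove hn M := by
  obtain ⟨h1, h2⟩ := mem_decSeq.1 hs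
  refine ⟨fun i j hij => ?_, fun i => ?_, ?_, fun i j => ?_⟩
  · have := h2 hij
    simp only
    omega
  · simp only
    omega
  · have := h1 ⟨0, by omega⟩
    have : s ⟨1, by omega⟩ < s ⟨0, by omega⟩ := h2 (by simp)
    simp only
    omega
  · simp only
    omega

theorem reflect_mem_latticeAlcove {n : ℕ} {hn : 2 ≤ n} {M : ℕ} {z : Fin n → ℤ}
    (hz : z ∈ latticeAlcove hn M) :
    Function.update z ⟨0, by omega⟩ (2 * M - z ⟨0, by omega⟩) ∈ latticeAlcove hn M := by
  have hz' := hz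
  obtain ⟨h1, h2, h3, h4⟩ := hz
  have h01 : (⟨1, by omega⟩ : Fin n) ≠ ⟨0, by omega⟩ := by simp
  refine ⟨fun i j hij => ?_, fun i => ?_, ?_, fun i j => ?_⟩
  · have hj : j ≠ ⟨0, by omega⟩ := by
      intro hj
      rw [hj] at hij
      exact absurd (Fin.lt_def.1 hij) (by simp)
    rw [Function.update_of_ne hj]
    by_cases hi : i = ⟨0, by omega⟩
    · have := latticeAlcove_add_lt hz' hij
      rw [hi] at this ⊢
      rw [Function.update_self]
      omega
    · rw [Function.update_of_ne hi]
      exact h1 hij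
  · by_cases hi : i = ⟨0, by omega⟩
    · rw [hi, Function.update_self]
      have := latticeAlcove_lt hz' ⟨0, by omega⟩
      omega
    · rw [Function.update_of_ne hi]
      exact h2 i
  · rw [Function.update_self, Function.update_of_ne h01]
    have : z ⟨1, by omega⟩ < z ⟨0, by omega⟩ := h1 (by simp)
    omega
  · have key : ∀ i, Function.update z ⟨0, by omega⟩ (2 * M - z ⟨0, by omega⟩) i % 2 =
        z ⟨0, by omega⟩ % 2 := by
      intro i
      by_cases hi : i = ⟨0, by omega⟩
      · rw [hi, Function.update_self]
        omega
      · rw [Function.update_of_ne hi]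
        exact h4 _ _
    rw [key, key]

/-- Points with `z₁ ≤ M` are the sequences `2s + b` with entries at most `M`; points with `z₁ > M`
are reflections of those with entries strictly below `M`. The two bounds on `s` encode `2s + b ≤ M`
and `2s + b < M`. Even coordinates use `b = 2` rather than `0` because coordinates are positive. -/
theorem sum_latticeAlcove_eq {n : ℕ} (hn : 2 ≤ n) (M b : ℕ) (hb : b = 1 ∨ b = 2)
    (f : (Fin n → ℤ) → ℝ)
    (hf : ∀ z, f (Function.update z ⟨0, by omega⟩ (2 * M - z ⟨0, by omega⟩)) = f z) :
    ∑ z : latticeAlcove hn M with z.1 ⟨0, by omega⟩ % 2 = (b : ℤ) % 2, f z.1 =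
      ∑ s ∈ decSeq n ((M + 2 - b) / 2), f (fun j => 2 * (s j : ℤ) + b) +
      ∑ s ∈ decSeq n ((M + 1 - b) / 2), f (fun j => 2 * (s j : ℤ) + b) := by
  have hb0 : 0 < b := by omega
  have hsub : ∀ s ∈ decSeq n ((M + 1 - b) / 2), s ∈ decSeq n ((M + 2 - b) / 2) := by
    intro s hs
    obtain ⟨h1, h2⟩ := mem_decSeq.1 hs
    refine mem_decSeq.2 ⟨fun i => (h1 i).trans_le ?_, h2⟩
    omega
  have hlift : ∀ z ∈ latticeAlcove hn M, z ⟨0, by omega⟩ % 2 = (b : ℤ) % 2 → ∀ c : ℕ,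
      z ⟨0, by omega⟩ < 2 * (c : ℤ) + b →
      ∃ s ∈ decSeq n c, (fun j => 2 * (s j : ℤ) + b) = z := by
    intro z hz hzb c hc
    obtain ⟨h1, h2, h3, h4⟩ := hz
    refine ⟨fun j => ((z j - b) / 2).toNat, mem_decSeq.2 ⟨fun i => ?_, fun i j hij => ?_⟩, ?_⟩
    · have : z i ≤ z ⟨0, by omega⟩ := h1.antitone (Fin.mk_le_of_le_val (Nat.zero_le _))
      have := h2 i
      have := h4 i ⟨0, by omega⟩
      change ((z i - b) / 2).toNat < c
      omega
    · have := h1 hij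
      have := h2 i
      have := h2 j
      have := h4 i ⟨0, by omega⟩
      have := h4 j ⟨0, by omega⟩
      change ((z j - b) / 2).toNat < ((z i - b) / 2).toNat
      omega
    · funext j
      have := h2 j
      have := h4 j ⟨0, by omega⟩
      change 2 * ((((z j - b) / 2).toNat : ℕ) : ℤ) + b = z j
      omega
  rw [← sum_filter_add_sum_filter_not _ (fun z : latticeAlcove hn M => z.1 ⟨0, by omega⟩ ≤ M)]
  congr 1
  · symm
    refine sum_bij (fun s hs => ⟨_, two_mul_add_mem_latticeAlcove hb0 hs⟩) ?_ ?_ ?_ ?_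
    · intro s hs
      have := (mem_decSeq.1 hs).1 ⟨0, by omega⟩
      simp only [mem_filter, mem_univ, true_and]
      omega
    · intro s hs s' hs' h
      funext j
      have := congrFun (congrArg Subtype.val h) j
      simp only at this
      omega
    · rintro ⟨z, hz⟩ h
      simp only [mem_filter, mem_univ, true_and] at h
      obtain ⟨s, hs, hsz⟩ := hlift z hz h.1 ((M + 2 - b) / 2) (by
        have := hz.2.1 ⟨0, by omega⟩
        omega)
      exact ⟨s, hs, Subtype.ext hsz⟩
    · intro s hs
      rfl
  · symm
    refine sum_bij (fun s hs => ⟨_, reflect_mem_latticeAlcove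
      (two_mul_add_mem_latticeAlcove (hn := hn) hb0 (hsub s hs))⟩) ?_ ?_ ?_ ?_
    · intro s hs
      have := (mem_decSeq.1 hs).1 ⟨0, by omega⟩
      simp only [mem_filter, mem_univ, true_and, Function.update_self]
      omega
    · intro s hs s' hs' h
      funext j
      have := congrFun (congrArg Subtype.val h) j
      simp only at this
      by_cases hj : j = ⟨0, by omega⟩
      · rw [hj] at this ⊢
        simp only [Function.update_self] at this
        omega
      · simp only [Function.update_of_ne hj] at this
        omega
    · rintro ⟨z, hz⟩ h
      simp only [mem_filter, mem_univ, true_and] at h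
      obtain ⟨s, hs, hsz⟩ := hlift _ (reflect_mem_latticeAlcove hz) (by
          rw [Function.update_self]
          omega) ((M + 1 - b) / 2) (by
        rw [Function.update_self]
        have := latticeAlcove_lt hz ⟨0, by omega⟩
        omega)
      refine ⟨s, hs, Subtype.ext ?_⟩
      have h0 := congrFun hsz ⟨0, by omega⟩
      simp only [Function.update_self] at h0
      simp only [hsz, Function.update_idem]
      rw [Function.update_eq_self_iff]
      omega
    · intro s hs
      exact (hf _).symm

/-- Reflection replaces the angle `θ` by `π - θ`, and sines of odd multiples are unchanged. -/
theorem sinDet_reflect {n : ℕ} {M : ℕ} (hM : 0 < M) (z : Fin n → ℤ) (i : Fin n) :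
    sinDet (Real.pi / (2 * M)) (fun j => (Function.update z i (2 * M - z i) j : ℝ)) =
      sinDet (Real.pi / (2 * M)) (fun j => (z j : ℝ)) := by
  unfold sinDet
  congr 1
  ext k j
  simp only [of_apply]
  by_cases h : j = i
  · subst h
    have hM' : (M : ℝ) ≠ 0 := by positivity
    rw [Function.update_self]
    have : (2 * ((k : ℕ) : ℝ) + 1) * (Real.pi / (2 * M) * ((2 * M - z j : ℤ) : ℝ)) =
        (Real.pi - (2 * ((k : ℕ) : ℝ) + 1) * (Real.pi / (2 * M) * z j)) +
          (k : ℕ) * (2 * Real.pi) := by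
      push_cast
      field_simp
      ring
    rw [this, Real.sin_add_nat_mul_two_pi, Real.sin_pi_sub]
  · rw [Function.update_of_ne h]

end Reflection

/-! ### The squared norm of the eigenvector on a parity class. -/

section Norm

theorem sum_cos_mul_two_sin (x : ℝ) (b c : ℕ) :
    (∑ s ∈ range c, Real.cos (x * (2 * (s : ℝ) + b))) * (2 * Real.sin x) =
      Real.sin (x * (2 * c + b - 1)) - Real.sin (x * (b - 1)) := by
  induction c with
  | zero => simp
  | succ c ih =>
    rw [sum_range_succ, add_mul, ih]
    have e1 : x * (2 * ((c + 1 : ℕ) : ℝ) + b - 1) = x * (2 * (c : ℝ) + b) + x := by push_cast; ring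
    have e2 : x * (2 * (c : ℝ) + b - 1) = x * (2 * (c : ℝ) + b) - x := by ring
    rw [e1, e2, Real.sin_add, Real.sin_sub]
    ring

/-- Both sums telescope after multiplication by `2 sin x`. The truncations add up to `M + 1 - b`, so
the two upper boundary angles sum to a multiple of `2π` and cancel; only the lower boundary terms
remain. The bound `0 < |r| < M` keeps `sin x` nonzero. -/
theorem sum_cos_add_sum_cos {M b : ℕ} (hb : b = 1 ∨ b = 2) {r : ℤ} (hr0 : r ≠ 0)
    (hr : |r| < M) :
    ∑ s ∈ range ((M + 2 - b) / 2), Real.cos (r * (Real.pi / M) * (2 * (s : ℝ) + b)) +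
      ∑ s ∈ range ((M + 1 - b) / 2), Real.cos (r * (Real.pi / M) * (2 * (s : ℝ) + b)) =
      -((b : ℝ) - 1) := by
  have hM : 0 < M := by have := abs_nonneg r; omega
  have hM' : (0 : ℝ) < M := by exact_mod_cast hM
  have hsin : Real.sin (r * (Real.pi / M)) ≠ 0 := by
    rw [Ne, Real.sin_eq_zero_iff]
    rintro ⟨k, hk⟩
    have h1 : (k : ℝ) * M = r := by
      have := Real.pi_ne_zero
      field_simp at hk
      exact hk
    have h2 : k * M = r := by exact_mod_cast h1
    have hk0 : k ≠ 0 := by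
      rintro rfl
      exact hr0 (by rw [← h2, zero_mul])
    rw [← h2, abs_mul, abs_of_nonneg (Int.natCast_nonneg M)] at hr
    have : 1 ≤ |k| := Int.one_le_abs hk0
    nlinarith
  have hc : (((M + 2 - b) / 2 : ℕ) : ℝ) + (((M + 1 - b) / 2 : ℕ) : ℝ) = M + 1 - b := by
    have : (M + 2 - b) / 2 + (M + 1 - b) / 2 + b = M + 1 := by omega
    have h : (((M + 2 - b) / 2 : ℕ) : ℝ) + (((M + 1 - b) / 2 : ℕ) : ℝ) + b = M + 1 := by
      exact_mod_cast this
    linarith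
  set p := (M + 2 - b) / 2
  set q := (M + 1 - b) / 2
  apply mul_right_cancel₀ (mul_ne_zero two_ne_zero hsin)
  rw [add_mul, sum_cos_mul_two_sin, sum_cos_mul_two_sin]
  have e1 : (r : ℝ) * (Real.pi / M) * (2 * (p : ℝ) + b - 1) =
      r * (2 * Real.pi) - r * (Real.pi / M) * (2 * (q : ℝ) + b - 1) := by
    have : (p : ℝ) = M + 1 - b - q := by linarith
    rw [this]
    field_simp
    ring
  rw [e1, Real.sin_int_mul_two_pi_sub]
  rcases hb with rfl | rfl
  · simp
  · norm_num
    ring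

/-- The Gram matrix of the odd sines on the first `c` points of a parity class. -/
noncomputable def sineGram (n M b c : ℕ) : Matrix (Fin n) (Fin n) ℝ :=
  of fun i j => ∑ s ∈ range c,
    Real.sin ((2 * (i : ℕ) + 1) * (Real.pi / (2 * M) * (2 * (s : ℝ) + b))) *
    Real.sin ((2 * (j : ℕ) + 1) * (Real.pi / (2 * M) * (2 * (s : ℝ) + b)))

theorem sum_sinDet_sq (n M b c : ℕ) :
    ∑ s ∈ decSeq n c, sinDet (Real.pi / (2 * M)) (fun j => 2 * (s j : ℝ) + b) ^ 2 =
      (sineGram n M b c).det := by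
  unfold sineGram
  rw [← sum_decSeq_det_mul_det]
  exact sum_congr rfl fun s _ => sq _

/-- Products of sines become cosines with frequencies `i - j` and `i + j + 1`, both below `M` in
absolute value. The boundary contributions cancel off the diagonal and leave `M/2` on it. -/
theorem sineGram_add {n M b : ℕ} (hb : b = 1 ∨ b = 2) (hM : 2 * n ≤ M) :
    sineGram n M b ((M + 2 - b) / 2) + sineGram n M b ((M + 1 - b) / 2) =
      (M / 2 : ℝ) • (1 : Matrix (Fin n) (Fin n) ℝ) := by
  ext i j
  have hn : 0 < n := i.pos
  have hM' : (0 : ℝ) < M := by exact_mod_cast (by omega : 0 < M)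
  have hprod : ∀ s : ℕ, Real.sin ((2 * (i : ℕ) + 1) * (Real.pi / (2 * M) * (2 * (s : ℝ) + b))) *
      Real.sin ((2 * (j : ℕ) + 1) * (Real.pi / (2 * M) * (2 * (s : ℝ) + b))) =
      (1 / 2) * (Real.cos (((i : ℕ) - (j : ℕ) : ℤ) * (Real.pi / M) * (2 * (s : ℝ) + b)) -
        Real.cos (((i : ℕ) + (j : ℕ) + 1 : ℤ) * (Real.pi / M) * (2 * (s : ℝ) + b))) := by
    intro s
    have e1 : (((i : ℕ) - (j : ℕ) : ℤ) : ℝ) * (Real.pi / M) * (2 * (s : ℝ) + b) =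
      (2 * (i : ℕ) + 1) * (Real.pi / (2 * M) * (2 * (s : ℝ) + b)) -
      (2 * (j : ℕ) + 1) * (Real.pi / (2 * M) * (2 * (s : ℝ) + b)) := by
      push_cast
      field_simp
      ring
    have e2 : (((i : ℕ) + (j : ℕ) + 1 : ℤ) : ℝ) * (Real.pi / M) * (2 * (s : ℝ) + b) =
      (2 * (i : ℕ) + 1) * (Real.pi / (2 * M) * (2 * (s : ℝ) + b)) +
      (2 * (j : ℕ) + 1) * (Real.pi / (2 * M) * (2 * (s : ℝ) + b)) := by
      push_cast
      field_simp
      ring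
    rw [e1, e2, Real.cos_sub, Real.cos_add]
    ring
  simp only [sineGram, Matrix.add_apply, of_apply, hprod, ← mul_sum, sum_sub_distrib]
  have h2 := sum_cos_add_sum_cos (M := M) hb (r := (i : ℕ) + (j : ℕ) + 1) (by positivity) (by
    have := i.2
    have := j.2
    rw [abs_of_nonneg (by positivity)]
    omega)
  by_cases hij : i = j
  · subst hij
    have hc : (((M + 2 - b) / 2 : ℕ) : ℝ) + (((M + 1 - b) / 2 : ℕ) : ℝ) + b = M + 1 := by
      have : (M + 2 - b) / 2 + (M + 1 - b) / 2 + b = M + 1 := by omega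
      exact_mod_cast this
    simp only [sub_self, Int.cast_zero, zero_mul, Real.cos_zero, sum_const, card_range,
      nsmul_eq_mul, mul_one, Matrix.smul_apply, one_apply_eq, smul_eq_mul]
    linear_combination (1 / 2) * hc - (1 / 2) * h2
  · have h1 := sum_cos_add_sum_cos (M := M) hb (r := (i : ℕ) - (j : ℕ)) (by
      intro h
      exact hij (Fin.ext (by omega))) (by
      have := i.2
      have := j.2
      rw [abs_lt]
      omega)
    simp only [Matrix.smul_apply, one_apply_ne hij, smul_eq_mul, mul_zero]
    linear_combination (1 / 2) * h1 - (1 / 2) * h2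

/-- The truncations differ by at most one point, the one fixed by the reflection, so the difference
has rank at most one. -/
theorem exists_sineGram_sub (n M b : ℕ) :
    ∃ u : Fin n → ℝ, sineGram n M b ((M + 2 - b) / 2) - sineGram n M b ((M + 1 - b) / 2) =
      vecMulVec u u := by
  have : (M + 2 - b) / 2 = (M + 1 - b) / 2 ∨ (M + 2 - b) / 2 = (M + 1 - b) / 2 + 1 := by omega
  rcases this with h | h
  · refine ⟨0, ?_⟩
    rw [h, sub_self, vecMulVec_zero]
  · refine ⟨fun i => Real.sin ((2 * (i : ℕ) + 1) *
      (Real.pi / (2 * M) * (2 * (((M + 1 - b) / 2 : ℕ) : ℝ) + b))), ?_⟩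
    rw [h]
    ext i j
    simp [sineGram, sum_range_succ, vecMulVec_apply]

/-- The two matrices are `(a/2) I ± (1/2) u uᵀ`. By the matrix determinant lemma the determinant is
affine in the coefficient of `u uᵀ`, so the rank-one corrections cancel. -/
theorem det_add_det_of_add_of_sub {n : ℕ} {a : ℝ} (ha : a ≠ 0) {G H : Matrix (Fin n) (Fin n) ℝ}
    {u : Fin n → ℝ} (h1 : G + H = a • 1) (h2 : G - H = vecMulVec u u) :
    G.det + H.det = 2 * (a / 2) ^ n := by
  have key : ∀ t : ℝ, ((a / 2) • (1 : Matrix (Fin n) (Fin n) ℝ) + (t / 2) • vecMulVec u u).det =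
      (a / 2) ^ n * (1 + t / a * (u ⬝ᵥ u)) := by
    intro t
    have e : (a / 2) • (1 : Matrix (Fin n) (Fin n) ℝ) + (t / 2) • vecMulVec u u =
        (a / 2) • (1 + replicateCol Unit ((t / a) • u) * replicateRow Unit u) := by
      rw [← vecMulVec_eq, smul_add, smul_vecMulVec, smul_smul]
      congr 2
      field_simp
    rw [e, det_smul, det_one_add_replicateCol_mul_replicateRow, dotProduct_smul, Fintype.card_fin,
      smul_eq_mul]
  have hG : G = (a / 2) • (1 : Matrix (Fin n) (Fin n) ℝ) + ((1 : ℝ) / 2) • vecMulVec u u := by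
    have : G = (1 / 2 : ℝ) • ((G + H) + (G - H)) := by
      ext i j
      simp only [Matrix.smul_apply, Matrix.add_apply, Matrix.sub_apply, smul_eq_mul]
      ring
    rw [this, h1, h2, smul_add, smul_smul]
    congr 2
    ring
  have hH : H = (a / 2) • (1 : Matrix (Fin n) (Fin n) ℝ) + ((-1 : ℝ) / 2) • vecMulVec u u := by
    have : H = (1 / 2 : ℝ) • ((G + H) - (G - H)) := by
      ext i j
      simp only [Matrix.smul_apply, Matrix.add_apply, Matrix.sub_apply, smul_eq_mul]
      ring
    rw [this, h1, h2, smul_sub, smul_smul, sub_eq_add_neg, ← neg_smul]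
    congr 2 <;> ring
  rw [hG, hH, key, key]
  ring

theorem sum_sinDet_sq_latticeAlcove {n : ℕ} (hn : 2 ≤ n) {M b : ℕ} (hb : b = 1 ∨ b = 2)
    (hM : 2 * n ≤ M) :
    ∑ z : latticeAlcove hn M with z.1 ⟨0, by omega⟩ % 2 = (b : ℤ) % 2,
      sinDet (Real.pi / (2 * M)) (fun j => (z.1 j : ℝ)) ^ 2 = 2 * ((M : ℝ) / 4) ^ n := by
  have hM0 : 0 < M := by omega
  have hM' : (M : ℝ) / 2 ≠ 0 := by positivity
  rw [sum_latticeAlcove_eq hn M b hb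
    (fun z => sinDet (Real.pi / (2 * M)) (fun j => (z j : ℝ)) ^ 2)
    fun z => by rw [sinDet_reflect hM0]]
  push_cast
  rw [sum_sinDet_sq, sum_sinDet_sq]
  obtain ⟨u, hu⟩ := exists_sineGram_sub n M b
  rw [det_add_det_of_add_of_sub hM' (sineGram_add hb hM) hu]
  congr 2
  ring

end Norm

/-! ### Rewriting `E`, `O`, `P` and `Q` through sine products at arithmetic progressions. -/

section ProductFormulas

theorem prod_Icc_one {M : Type*} [CommMonoid M] (f : ℕ → M) (n : ℕ) :
    ∏ h ∈ Icc 1 n, f h = ∏ k ∈ range n, f (k + 1) := by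
  rw [← Finset.Ico_add_one_right_eq_Icc, prod_Ico_eq_prod_range]
  simp [add_comm]

theorem prod_prod_Ioi_eq_range {M : Type*} [CommMonoid M] (f : ℕ → ℕ → M) (n : ℕ) :
    ∏ h : Fin n, ∏ t ∈ Ioi h, f h t = ∏ t ∈ range n, ∏ h ∈ range t, f h t := by
  rw [prod_sigma', prod_sigma']
  refine prod_bij (fun p _ => ⟨p.2, p.1⟩) ?_ ?_ ?_ ?_
  · rintro ⟨a, b⟩ h
    simpa using h
  · rintro ⟨a, b⟩ _ ⟨c, d⟩ _ h
    simp only [Sigma.mk.injEq, heq_eq_eq] at h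
    obtain ⟨h1, h2⟩ := h
    rw [Fin.ext h1, Fin.ext h2]
  · rintro ⟨t, h⟩ hth
    simp only [mem_sigma, mem_range] at hth
    exact ⟨⟨⟨h, hth.2.trans hth.1⟩, ⟨t, hth.1⟩⟩, by simpa using hth.2, rfl⟩
  · rintro ⟨a, b⟩ _
    rfl

theorem prod_range_two_mul {M : Type*} [CommMonoid M] (f : ℕ → M) (n : ℕ) :
    ∏ k ∈ range (2 * n), f k = (∏ k ∈ range n, f (2 * k)) * ∏ k ∈ range n, f (2 * k + 1) := by
  induction n with
  | zero => simp
  | succ n ih =>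
    rw [mul_add, mul_one, prod_range_succ, prod_range_succ, ih, prod_range_succ, prod_range_succ]
    simp only [mul_assoc, mul_left_comm]

/-- The triangles of index sums `h + t` and `h + t + 1` with `h < t` together have the same multiset
of sums as an `n × (n+1)` rectangle. This produces the rectangular double product in `P`. -/
theorem prod_triangle_mul_shift {M : Type*} [CommMonoid M] (g : ℕ → M) (n : ℕ) :
    (∏ t ∈ range (n + 1), ∏ h ∈ range t, g (h + t)) *
        ∏ t ∈ range (n + 1), ∏ h ∈ range t, g (h + t + 1) =
      ∏ h ∈ range n, ∏ t ∈ range (n + 1), g (h + t + 1) := by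
  induction n with
  | zero => simp
  | succ n ih =>
    have e1 : ∏ h ∈ range (n + 1), ∏ t ∈ range (n + 1 + 1), g (h + t + 1) =
        (∏ h ∈ range n, ∏ t ∈ range (n + 1), g (h + t + 1)) *
          ((∏ h ∈ range n, g (h + (n + 1) + 1)) * ∏ t ∈ range (n + 1 + 1), g (n + t + 1)) := by
      rw [prod_range_succ, ← mul_assoc, ← prod_mul_distrib]
      congr 1
      exact prod_congr rfl fun h _ => prod_range_succ _ _
    have e2 : (∏ h ∈ range n, g (h + (n + 1) + 1)) * ∏ t ∈ range (n + 1 + 1), g (n + t + 1) =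
        (∏ h ∈ range (n + 1), g (h + (n + 1))) * ∏ h ∈ range (n + 1), g (h + (n + 1) + 1) := by
      rw [prod_range_succ (fun t => g (n + t + 1)), prod_range_succ (fun h => g (h + (n + 1) + 1)),
        mul_left_comm]
      congr 1
      exact prod_congr rfl fun h _ => congrArg g (by ring)
    rw [e1, e2, ← ih, prod_range_succ _ (n + 1), prod_range_succ _ (n + 1)]
    exact mul_mul_mul_comm _ _ _ _

/-- A square is two triangles plus its diagonal; this is the version needed for `Q`. -/
theorem prod_square_eq {M : Type*} [CommMonoid M] (g : ℕ → M) (n : ℕ) :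
    ∏ h ∈ range n, ∏ t ∈ range n, g (h + t) =
      (∏ t ∈ range n, ∏ h ∈ range t, g (h + t)) * (∏ t ∈ range n, ∏ h ∈ range t, g (h + t)) *
        ∏ h ∈ range n, g (2 * h) := by
  induction n with
  | zero => simp
  | succ n ih =>
    have e1 : ∏ h ∈ range (n + 1), ∏ t ∈ range (n + 1), g (h + t) =
        (∏ h ∈ range n, ∏ t ∈ range n, g (h + t)) *
          ((∏ h ∈ range n, g (h + n)) * ((∏ h ∈ range n, g (h + n)) * g (2 * n))) := by
      have a : ∏ h ∈ range n, ∏ t ∈ range (n + 1), g (h + t) =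
          (∏ h ∈ range n, ∏ t ∈ range n, g (h + t)) * ∏ h ∈ range n, g (h + n) := by
        rw [← prod_mul_distrib]
        exact prod_congr rfl fun h _ => prod_range_succ _ _
      rw [prod_range_succ, a, prod_range_succ (fun t => g (n + t)), two_mul, mul_assoc]
      simp only [add_comm n]
    rw [e1, ih, prod_range_succ _ n, prod_range_succ _ n]
    simp only [mul_assoc, mul_left_comm]

/-- The sine product at the arithmetic progression `c + n - 1, c + n - 3, …, c - n + 1`. -/
noncomputable def progSinProd (n : ℕ) (α c : ℝ) : ℝ :=
  sinProd α (fun j : Fin n => c + n - 1 - 2 * (j : ℕ))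

theorem progSinProd_eq (n : ℕ) (α c : ℝ) :
    progSinProd n α c = (∏ h : Fin n, ∏ t ∈ Ioi h, Real.sin (α * (2 * (idx t - idx h)))) *
      (∏ h : Fin n, ∏ t ∈ Ioi h, Real.sin (α * (2 * (c - n - 1 + idx t + idx h)))) *
      ∏ h : Fin n, Real.sin (α * (c - n - 1 + 2 * idx h)) := by
  have hrev : ∀ j : Fin n, c + n - 1 - 2 * ((j.rev : ℕ) : ℝ) = c - n - 1 + 2 * idx j := by
    intro j
    have : ((j.rev : ℕ) : ℝ) + (j : ℕ) + 1 = n := by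
      have : (j.rev : ℕ) + j + 1 = n := by rw [Fin.val_rev]; omega
      exact_mod_cast this
    unfold idx
    linarith
  unfold progSinProd sinProd
  have e : ∏ h : Fin n, ∏ t ∈ Ioi h,
      (Real.sin (α * ((c + n - 1 - 2 * ((h : ℕ) : ℝ)) - (c + n - 1 - 2 * ((t : ℕ) : ℝ)))) *
      Real.sin (α * ((c + n - 1 - 2 * ((h : ℕ) : ℝ)) + (c + n - 1 - 2 * ((t : ℕ) : ℝ))))) =
      (∏ h : Fin n, ∏ t ∈ Ioi h, Real.sin (α * (2 * (idx t - idx h)))) *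
      ∏ h : Fin n, ∏ t ∈ Ioi h, Real.sin (α * (2 * (c - n - 1 + idx t + idx h))) := by
    rw [prod_prod_Ioi_rev, ← prod_mul_distrib]
    refine prod_congr rfl fun h _ => ?_
    rw [← prod_mul_distrib]
    refine prod_congr rfl fun t _ => ?_
    rw [hrev, hrev]
    congr 2 <;> ring
  rw [e]
  congr 1
  rw [← Equiv.prod_comp Fin.revPerm]
  refine prod_congr rfl fun h _ => ?_
  simp only [Fin.revPerm_apply, hrev]

theorem startFactorEven_halve {n M : ℕ} {m : ℝ} (hm : 2 * m = M) (z : Fin n → ℤ) :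
    startFactorEven m (halve z) = sinProd (Real.pi / (2 * M)) (fun j => (z j : ℝ)) *
      progSinProd n (Real.pi / (2 * M)) (n + 1) := by
  rw [progSinProd_eq]
  unfold startFactorEven sinProd halve
  rw [← hm, prod_mul_distrib (f := fun h : Fin n => Real.sin (Real.pi * (z h / 2) / (2 * m)))]
  have e : ∏ h : Fin n, ∏ t ∈ Ioi h, (Real.sin (Real.pi * ((z h : ℝ) / 2 - z t / 2) / (2 * m)) *
      Real.sin (Real.pi * (idx t - idx h) / (2 * m)) *
      Real.sin (Real.pi * ((z h : ℝ) / 2 + z t / 2) / (2 * m)) *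
      Real.sin (Real.pi * (idx t + idx h) / (2 * m))) =
    (∏ h : Fin n, ∏ t ∈ Ioi h, (Real.sin (Real.pi / (2 * (2 * m)) * (z h - z t)) *
      Real.sin (Real.pi / (2 * (2 * m)) * (z h + z t)))) *
    ((∏ h : Fin n, ∏ t ∈ Ioi h, Real.sin (Real.pi / (2 * (2 * m)) * (2 * (idx t - idx h)))) *
      ∏ h : Fin n, ∏ t ∈ Ioi h,
        Real.sin (Real.pi / (2 * (2 * m)) * (2 * ((n : ℝ) + 1 - n - 1 + idx t + idx h)))) := by
    rw [← prod_mul_distrib, ← prod_mul_distrib]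
    refine prod_congr rfl fun h _ => ?_
    rw [← prod_mul_distrib, ← prod_mul_distrib]
    refine prod_congr rfl fun t _ => ?_
    have a1 : Real.pi * ((z h : ℝ) / 2 - z t / 2) / (2 * m) =
      Real.pi / (2 * (2 * m)) * (z h - z t) := by ring
    have a2 : Real.pi * ((z h : ℝ) / 2 + z t / 2) / (2 * m) =
      Real.pi / (2 * (2 * m)) * (z h + z t) := by ring
    have a3 : Real.pi * (idx t - idx h) / (2 * m) =
      Real.pi / (2 * (2 * m)) * (2 * (idx t - idx h)) := by ring
    have a4 : Real.pi * (idx t + idx h) / (2 * m) =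
      Real.pi / (2 * (2 * m)) * (2 * ((n : ℝ) + 1 - n - 1 + idx t + idx h)) := by ring
    rw [a1, a2, a3, a4]
    ring
  have e2 : ∏ h : Fin n, Real.sin (Real.pi * ((z h : ℝ) / 2) / (2 * m)) =
      ∏ h : Fin n, Real.sin (Real.pi / (2 * (2 * m)) * z h) :=
    prod_congr rfl fun h _ => by congr 1; ring
  have e3 : ∏ h : Fin n, Real.sin (Real.pi * idx h / (2 * m)) =
      ∏ h : Fin n, Real.sin (Real.pi / (2 * (2 * m)) * ((n : ℝ) + 1 - n - 1 + 2 * idx h)) :=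
    prod_congr rfl fun h _ => by congr 1; ring
  rw [e, e2, e3]
  ring

theorem startFactorOdd_halve {n M : ℕ} {m : ℝ} (hm : 2 * m = M) (z : Fin n → ℤ) :
    startFactorOdd m (halve z) = sinProd (Real.pi / (2 * M)) (fun j => (z j : ℝ)) *
      progSinProd n (Real.pi / (2 * M)) n := by
  rw [progSinProd_eq]
  unfold startFactorOdd sinProd halve
  rw [← hm, prod_mul_distrib (f := fun h : Fin n => Real.sin (Real.pi * (z h / 2) / (2 * m)))]
  have e : ∏ h : Fin n, ∏ t ∈ Ioi h, (Real.sin (Real.pi * ((z h : ℝ) / 2 - z t / 2) / (2 * m)) *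
      Real.sin (Real.pi * (idx t - idx h) / (2 * m)) *
      Real.sin (Real.pi * ((z h : ℝ) / 2 + z t / 2) / (2 * m)) *
      Real.sin (Real.pi * (idx t + idx h - 1) / (2 * m))) =
    (∏ h : Fin n, ∏ t ∈ Ioi h, (Real.sin (Real.pi / (2 * (2 * m)) * (z h - z t)) *
      Real.sin (Real.pi / (2 * (2 * m)) * (z h + z t)))) *
    ((∏ h : Fin n, ∏ t ∈ Ioi h, Real.sin (Real.pi / (2 * (2 * m)) * (2 * (idx t - idx h)))) *
      ∏ h : Fin n, ∏ t ∈ Ioi h,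
        Real.sin (Real.pi / (2 * (2 * m)) * (2 * ((n : ℝ) - n - 1 + idx t + idx h)))) := by
    rw [← prod_mul_distrib, ← prod_mul_distrib]
    refine prod_congr rfl fun h _ => ?_
    rw [← prod_mul_distrib, ← prod_mul_distrib]
    refine prod_congr rfl fun t _ => ?_
    have a1 : Real.pi * ((z h : ℝ) / 2 - z t / 2) / (2 * m) =
      Real.pi / (2 * (2 * m)) * (z h - z t) := by ring
    have a2 : Real.pi * ((z h : ℝ) / 2 + z t / 2) / (2 * m) =
      Real.pi / (2 * (2 * m)) * (z h + z t) := by ring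
    have a3 : Real.pi * (idx t - idx h) / (2 * m) =
      Real.pi / (2 * (2 * m)) * (2 * (idx t - idx h)) := by ring
    have a4 : Real.pi * (idx t + idx h - 1) / (2 * m) =
      Real.pi / (2 * (2 * m)) * (2 * ((n : ℝ) - n - 1 + idx t + idx h)) := by ring
    rw [a1, a2, a3, a4]
    ring
  have e2 : ∏ h : Fin n, Real.sin (Real.pi * ((z h : ℝ) / 2) / (2 * m)) =
      ∏ h : Fin n, Real.sin (Real.pi / (2 * (2 * m)) * z h) :=
    prod_congr rfl fun h _ => by congr 1; ring
  have e3 : ∏ h : Fin n, Real.sin (Real.pi * (2 * idx h - 1) / (4 * m)) =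
      ∏ h : Fin n, Real.sin (Real.pi / (2 * (2 * m)) * ((n : ℝ) - n - 1 + 2 * idx h)) :=
    prod_congr rfl fun h _ => by congr 1; ring
  rw [e, e2, e3]
  ring

/-- The product of the `sin(2α(c - n + 1 + h + t))` over `0 ≤ h < t < n`. -/
noncomputable def triangleSin (n : ℕ) (α c : ℝ) : ℝ :=
  ∏ t ∈ range n, ∏ h ∈ range t, Real.sin (α * (2 * (c - n + 1 + ((h + t : ℕ) : ℝ))))

/-- The product of the `sin(2α(t - h))` over `1 ≤ h < t ≤ n`. -/
noncomputable def diffSin (n : ℕ) (α : ℝ) : ℝ :=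
  ∏ h : Fin n, ∏ t ∈ Ioi h, Real.sin (α * (2 * (idx t - idx h)))

theorem progSinProd_eq_range (n : ℕ) (α c : ℝ) :
    progSinProd n α c = diffSin n α * triangleSin n α c *
      ∏ h ∈ range n, Real.sin (α * (c - n + 1 + 2 * (h : ℝ))) := by
  rw [progSinProd_eq, diffSin, triangleSin]
  congr 1
  · congr 1
    rw [← prod_prod_Ioi_eq_range]
    refine prod_congr rfl fun h _ => prod_congr rfl fun t _ => ?_
    unfold idx
    push_cast
    congr 1
    ring
  · rw [← Fin.prod_univ_eq_prod_range (fun h => Real.sin (α * (c - n + 1 + 2 * (h : ℝ))))]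
    refine prod_congr rfl fun h _ => ?_
    unfold idx
    congr 1
    ring

theorem prod_range_reflect_shift {M : Type*} [CommMonoid M] (f : ℝ → M) (n : ℕ) :
    ∏ h ∈ range n, f h = ∏ h ∈ range n, f (n - 1 - (h : ℝ)) := by
  rw [← prod_range_reflect]
  refine prod_congr rfl fun h hh => ?_
  congr 1
  have := mem_range.1 hh
  rw [Nat.sub_sub, Nat.cast_sub (by omega)]
  push_cast
  ring

/-- The single sines of the two progressions interleave, as odd and even `h`, into one product over
`1, …, 2n`; their pairwise-sum triangles fill a rectangle. -/
theorem progSinProd_mul_succ {n : ℕ} (hn : 1 ≤ n) (α c : ℝ) :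
    progSinProd n α c * progSinProd n α (c + 1) = diffSin n α ^ 2 *
      ((∏ h ∈ Icc 1 (2 * n), Real.sin (α * (c - n + h))) *
      ∏ h ∈ Icc 1 (n - 1), ∏ t ∈ Icc 1 n, Real.sin (α * (2 * (c + t - h)))) := by
  obtain ⟨N, rfl⟩ : ∃ N, n = N + 1 := ⟨n - 1, by omega⟩
  have e1 : ∏ h ∈ Icc 1 (2 * (N + 1)), Real.sin (α * (c - (N + 1 : ℕ) + h)) =
      (∏ h ∈ range (N + 1), Real.sin (α * (c - (N + 1 : ℕ) + 1 + 2 * (h : ℝ)))) *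
      ∏ h ∈ range (N + 1), Real.sin (α * (c + 1 - (N + 1 : ℕ) + 1 + 2 * (h : ℝ))) := by
    rw [prod_Icc_one, prod_range_two_mul]
    congr 1 <;> refine prod_congr rfl fun h _ => ?_ <;> push_cast <;> congr 1 <;> ring
  have e2 : ∏ h ∈ Icc 1 (N + 1 - 1), ∏ t ∈ Icc 1 (N + 1), Real.sin (α * (2 * (c + t - h))) =
      triangleSin (N + 1) α c * triangleSin (N + 1) α (c + 1) := by
    have := prod_triangle_mul_shift
      (fun k => Real.sin (α * (2 * (c - (N + 1 : ℕ) + 1 + (k : ℝ))))) N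
    have h2 : triangleSin (N + 1) α (c + 1) = ∏ t ∈ range (N + 1), ∏ h ∈ range t,
        Real.sin (α * (2 * (c - (N + 1 : ℕ) + 1 + ((h + t + 1 : ℕ) : ℝ)))) := by
      unfold triangleSin
      refine prod_congr rfl fun h _ => prod_congr rfl fun t _ => ?_
      push_cast
      congr 1
      ring
    rw [h2, triangleSin, this]
    rw [prod_Icc_one, Nat.add_sub_cancel]
    simp only [prod_Icc_one]
    push_cast
    rw [prod_range_reflect_shift
      (fun x => ∏ t ∈ range (N + 1), Real.sin (α * (2 * (c + ((t : ℝ) + 1) - (x + 1)))))]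
    refine prod_congr rfl fun h _ => prod_congr rfl fun t _ => ?_
    congr 1
    ring
  rw [e1, e2, progSinProd_eq_range, progSinProd_eq_range]
  ring

theorem endFactorEven_eq {n M : ℕ} (hn : 1 ≤ n) {m : ℝ} (hm : 2 * m = M) (c : ℝ)
    (hd : diffSin n (Real.pi / (2 * M)) ≠ 0) :
    endFactorEven n m c = progSinProd n (Real.pi / (2 * M)) c *
      progSinProd n (Real.pi / (2 * M)) (c + 1) /
      (progSinProd n (Real.pi / (2 * M)) n * progSinProd n (Real.pi / (2 * M)) (n + 1)) := by
  rw [progSinProd_mul_succ hn, progSinProd_mul_succ hn, mul_div_mul_left _ _ (pow_ne_zero 2 hd),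
    mul_div_mul_comm, ← prod_div_distrib, ← prod_div_distrib]
  unfold endFactorEven
  rw [← hm]
  congr 1
  · refine prod_congr rfl fun h _ => ?_
    congr 2 <;> ring
  · refine prod_congr rfl fun h _ => ?_
    rw [← prod_div_distrib]
    refine prod_congr rfl fun t _ => ?_
    congr 2 <;> ring

/-- The diagonal of the square consists of double angles, and `sin 2x = 2 sin x cos x` accounts for
the `2^n`, the single sines and the cosines to divide by. The remaining divisors are the even-`h`
sines, absent from the square of one progression. -/
theorem progSinProd_sq (n : ℕ) (α c : ℝ)
    (hB : ∀ h ∈ Icc 1 n, Real.sin (α * (c - n + 2 * (h : ℝ))) ≠ 0)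
    (hC : ∀ h ∈ Icc 1 n, Real.cos (α * (c - n + 2 * (h : ℝ) - 1)) ≠ 0) :
    2 ^ n * progSinProd n α c ^ 2 = diffSin n α ^ 2 *
      ((∏ h ∈ Icc 1 (2 * n), Real.sin (α * (c - n + h))) *
      (∏ h ∈ Icc 1 n, ∏ t ∈ Icc 1 n, Real.sin (α * (2 * (c + t - h)))) /
      ((∏ h ∈ Icc 1 n, Real.sin (α * (c - n + 2 * (h : ℝ)))) *
        ∏ h ∈ Icc 1 n, Real.cos (α * (c - n + 2 * (h : ℝ) - 1)))) := by
  have e1 : ∏ h ∈ Icc 1 (2 * n), Real.sin (α * (c - n + h)) =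
      (∏ h ∈ range n, Real.sin (α * (c - n + 1 + 2 * (h : ℝ)))) *
      ∏ h ∈ Icc 1 n, Real.sin (α * (c - n + 2 * (h : ℝ))) := by
    rw [prod_Icc_one, prod_range_two_mul, prod_Icc_one]
    congr 1 <;> refine prod_congr rfl fun h _ => ?_ <;> push_cast <;> congr 1 <;> ring
  have e2 : ∏ h ∈ Icc 1 n, ∏ t ∈ Icc 1 n, Real.sin (α * (2 * (c + t - h))) =
      triangleSin n α c * triangleSin n α c * (2 ^ n *
        (∏ h ∈ range n, Real.sin (α * (c - n + 1 + 2 * (h : ℝ)))) *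
        ∏ h ∈ Icc 1 n, Real.cos (α * (c - n + 2 * (h : ℝ) - 1))) := by
    have h1 := prod_square_eq (fun k => Real.sin (α * (2 * (c - n + 1 + (k : ℝ))))) n
    have h2 : ∏ h ∈ range n, Real.sin (α * (2 * (c - n + 1 + ((2 * h : ℕ) : ℝ)))) =
        2 ^ n * (∏ h ∈ range n, Real.sin (α * (c - n + 1 + 2 * (h : ℝ)))) *
        ∏ h ∈ Icc 1 n, Real.cos (α * (c - n + 2 * (h : ℝ) - 1)) := by
      have h3 : (2 : ℝ) ^ n = ∏ _h ∈ range n, 2 := by simp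
      rw [prod_Icc_one, h3, ← prod_mul_distrib, ← prod_mul_distrib]
      refine prod_congr rfl fun h _ => ?_
      push_cast
      rw [mul_left_comm, Real.sin_two_mul]
      congr 2
      ring
    rw [← h2, triangleSin, ← h1]
    simp only [prod_Icc_one]
    push_cast
    rw [prod_range_reflect_shift
      (fun x => ∏ t ∈ range n, Real.sin (α * (2 * (c + ((t : ℝ) + 1) - (x + 1)))))]
    refine prod_congr rfl fun h _ => prod_congr rfl fun t _ => ?_
    congr 1
    ring
  have hB' := prod_ne_zero_iff.2 hB
  have hC' := prod_ne_zero_iff.2 hC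
  rw [e1, e2, progSinProd_eq_range]
  field_simp

theorem endFactorOdd_eq {n M : ℕ} {m : ℝ} (hm : 2 * m = M) (c : ℝ)
    (hd : diffSin n (Real.pi / (2 * M)) ≠ 0)
    (hB : ∀ h ∈ Icc 1 n, Real.sin (Real.pi / (2 * M) * (c - n + 2 * (h : ℝ))) ≠ 0)
    (hC : ∀ h ∈ Icc 1 n, Real.cos (Real.pi / (2 * M) * (c - n + 2 * (h : ℝ) - 1)) ≠ 0)
    (hB0 : ∀ h ∈ Icc 1 n, Real.sin (Real.pi / (2 * M) * ((n : ℝ) - n + 2 * (h : ℝ))) ≠ 0)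
    (hC0 : ∀ h ∈ Icc 1 n, Real.cos (Real.pi / (2 * M) * ((n : ℝ) - n + 2 * (h : ℝ) - 1)) ≠ 0) :
    endFactorOdd n m c = progSinProd n (Real.pi / (2 * M)) c ^ 2 /
      progSinProd n (Real.pi / (2 * M)) n ^ 2 := by
  rw [← mul_div_mul_left _ _ (pow_ne_zero n two_ne_zero), progSinProd_sq n _ c hB hC,
    progSinProd_sq n _ n hB0 hC0, mul_div_mul_left _ _ (pow_ne_zero 2 hd)]
  have e : endFactorOdd n m c =
      ((∏ h ∈ Icc 1 (2 * n), Real.sin (Real.pi / (2 * M) * (c - n + h))) /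
        ∏ h ∈ Icc 1 (2 * n), Real.sin (Real.pi / (2 * M) * ((n : ℝ) - n + h))) *
      ((∏ h ∈ Icc 1 n, ∏ t ∈ Icc 1 n, Real.sin (Real.pi / (2 * M) * (2 * (c + t - h)))) /
        ∏ h ∈ Icc 1 n, ∏ t ∈ Icc 1 n, Real.sin (Real.pi / (2 * M) * (2 * ((n : ℝ) + t - h)))) *
      (((∏ h ∈ Icc 1 n, Real.sin (Real.pi / (2 * M) * ((n : ℝ) - n + 2 * (h : ℝ)))) /
        ∏ h ∈ Icc 1 n, Real.sin (Real.pi / (2 * M) * (c - n + 2 * (h : ℝ)))) *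
      ((∏ h ∈ Icc 1 n, Real.cos (Real.pi / (2 * M) * ((n : ℝ) - n + 2 * (h : ℝ) - 1))) /
        ∏ h ∈ Icc 1 n, Real.cos (Real.pi / (2 * M) * (c - n + 2 * (h : ℝ) - 1)))) := by
    simp only [← prod_div_distrib, ← prod_mul_distrib]
    unfold endFactorOdd
    rw [← hm]
    congr 1
    · congr 1
      · refine prod_congr rfl fun h _ => ?_
        congr 2 <;> ring
      · refine prod_congr rfl fun h _ => prod_congr rfl fun t _ => ?_
        congr 2 <;> ring
    · refine prod_congr rfl fun h _ => ?_
      congr 3 <;> ring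
  rw [e, div_div_div_eq, ← mul_div_mul_comm, ← mul_div_mul_comm, ← mul_div_mul_comm]
  congr 1
  ring

end ProductFormulas

/-! ### Closed forms of the class sums, the growth rate and the parity sign. -/

section Assembly

theorem two_mul_rev_add_mem_latticeAlcove {n M b : ℕ} (hn : 2 ≤ n) (hM : 2 * n ≤ M)
    (hb : b = 1 ∨ b = 2) :
    (fun j : Fin n => 2 * ((j.rev : ℕ) : ℤ) + b) ∈ latticeAlcove hn M := by
  refine two_mul_add_mem_latticeAlcove (s := fun j => (j.rev : ℕ)) (by omega)
    (mem_decSeq.2 ⟨fun i => ?_, fun i j hij => ?_⟩)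
  · have := i.rev.2
    omega
  · exact Fin.lt_def.1 (Fin.rev_lt_rev.2 hij)

theorem cast_rev {n : ℕ} (j : Fin n) : ((j.rev : ℕ) : ℝ) = n - 1 - (j : ℕ) := by
  have : (j.rev : ℕ) + j + 1 = n := by rw [Fin.val_rev]; omega
  have h : ((j.rev : ℕ) : ℝ) + (j : ℕ) + 1 = n := by exact_mod_cast this
  linarith

theorem progSinProd_pos {n M : ℕ} (hn : 2 ≤ n) (hM : 2 * n ≤ M) :
    0 < progSinProd n (Real.pi / (2 * M)) n ∧ 0 < progSinProd n (Real.pi / (2 * M)) (n + 1) := by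
  have h1 := sinProd_pos (two_mul_rev_add_mem_latticeAlcove hn hM (b := 1) (Or.inl rfl))
  have h2 := sinProd_pos (two_mul_rev_add_mem_latticeAlcove hn hM (b := 2) (Or.inr rfl))
  unfold progSinProd
  constructor
  · convert h1 using 2
    funext j
    push_cast
    rw [cast_rev]
    ring
  · convert h2 using 2
    funext j
    push_cast
    rw [cast_rev]
    ring

theorem diffSin_ne_zero {n M : ℕ} (hn : 2 ≤ n) (hM : 2 * n ≤ M) :
    diffSin n (Real.pi / (2 * M)) ≠ 0 := by
  intro h
  have := (progSinProd_pos hn hM).1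
  rw [progSinProd_eq_range, h] at this
  simp at this

theorem sin_pi_div_mul_pos {M : ℕ} {x : ℝ} (h0 : 0 < x) (h1 : x < 2 * M) :
    0 < Real.sin (Real.pi / (2 * M) * x) := by
  have hM : (0 : ℝ) < M := by linarith
  apply Real.sin_pos_of_pos_of_lt_pi
  · have := Real.pi_pos
    positivity
  · rw [div_mul_eq_mul_div, div_lt_iff₀ (by positivity)]
    exact mul_lt_mul_of_pos_left h1 Real.pi_pos

theorem cos_pi_div_mul_pos {M : ℕ} {x : ℝ} (h0 : 0 ≤ x) (h1 : x < M) :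
    0 < Real.cos (Real.pi / (2 * M) * x) := by
  have hM : (0 : ℝ) < M := by linarith
  have hpi := Real.pi_pos
  apply Real.cos_pos_of_mem_Ioo
  constructor
  · have : 0 ≤ Real.pi / (2 * M) * x := by positivity
    linarith
  · rw [div_mul_eq_mul_div, div_lt_iff₀ (by positivity)]
    nlinarith

/-- The minimal point is the progression with parameter `n`, so `sum_sinProd_mul` relates three
values of `progSinProd`. Taking `b = 2` gives parameters `c, c + 1` and hence `P`; taking `b = 1`
gives a square and hence `Q`. -/
theorem sum_sinProd_decSeq {n M : ℕ} (hM : 2 * n ≤ M) (b c : ℕ) :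
    (∑ s ∈ decSeq n c, sinProd (Real.pi / (2 * M)) fun j => 2 * (s j : ℝ) + b) *
        progSinProd n (Real.pi / (2 * M)) n =
      progSinProd n (Real.pi / (2 * M)) c * progSinProd n (Real.pi / (2 * M)) (c + b - 1) := by
  have h := sum_sinProd_mul (n := n) (Real.pi / (2 * M)) (fun i => by
    rw [mul_comm]
    refine (cos_pi_div_mul_pos (by positivity) ?_).ne'
    have := i.2
    exact_mod_cast (by omega : 2 * (i : ℕ) + 1 < M)) b c
  unfold progSinProd
  convert h using 3
  · funext j
    rw [cast_rev]
    ring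
  · funext j
    ring

theorem sum_sinProd_even {n M : ℕ} (hn : 2 ≤ n) (hM : 2 * n ≤ M) {m : ℝ} (hm : 2 * m = M) (c : ℕ) :
    ∑ s ∈ decSeq n c, sinProd (Real.pi / (2 * M)) (fun j => 2 * (s j : ℝ) + (2 : ℕ)) =
      progSinProd n (Real.pi / (2 * M)) (n + 1) * endFactorEven n m c := by
  obtain ⟨h1, h2⟩ := progSinProd_pos hn hM
  rw [endFactorEven_eq (by omega) hm _ (diffSin_ne_zero hn hM)]
  have h := sum_sinProd_decSeq hM 2 c
  have e : (c : ℝ) + (2 : ℕ) - 1 = c + 1 := by push_cast; ring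
  rw [e] at h
  rw [← h]
  field_simp

/-- The bounds on `c` keep the angles in the denominators of `Q` inside `(0, π)` for the sines and
`[0, π/2)` for the cosines. -/
theorem sum_sinProd_odd {n M : ℕ} (hn : 2 ≤ n) (hM : 2 * n ≤ M) {m : ℝ} (hm : 2 * m = M) {c : ℕ}
    (hc : n ≤ c) (hcM : 2 * c ≤ M + 1) :
    ∑ s ∈ decSeq n c, sinProd (Real.pi / (2 * M)) (fun j => 2 * (s j : ℝ) + (1 : ℕ)) =
      progSinProd n (Real.pi / (2 * M)) n * endFactorOdd n m c := by
  obtain ⟨h1, h2⟩ := progSinProd_pos hn hM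
  have hS : ∀ c : ℕ, n ≤ c → 2 * c ≤ M + 1 → ∀ h ∈ Icc 1 n,
      Real.sin (Real.pi / (2 * M) * ((c : ℝ) - n + 2 * (h : ℝ))) ≠ 0 := by
    intro c hc hcM h hh
    obtain ⟨a1, a2⟩ := mem_Icc.1 hh
    have e : (c : ℝ) - n + 2 * h = ((c - n + 2 * h : ℕ) : ℝ) := by
      push_cast [Nat.cast_sub hc]; ring
    rw [e]
    refine (sin_pi_div_mul_pos ?_ ?_).ne'
    · exact_mod_cast (by omega)
    · exact_mod_cast (by omega)
  have hC : ∀ c : ℕ, n ≤ c → 2 * c ≤ M + 1 → ∀ h ∈ Icc 1 n,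
      Real.cos (Real.pi / (2 * M) * ((c : ℝ) - n + 2 * (h : ℝ) - 1)) ≠ 0 := by
    intro c hc hcM h hh
    obtain ⟨a1, a2⟩ := mem_Icc.1 hh
    have e : (c : ℝ) - n + 2 * h - 1 = ((c - n + 2 * h - 1 : ℕ) : ℝ) := by
      rw [Nat.cast_sub (by omega)]
      push_cast [Nat.cast_sub hc]; ring
    rw [e]
    refine (cos_pi_div_mul_pos (Nat.cast_nonneg _) ?_).ne'
    exact_mod_cast (by omega)
  rw [endFactorOdd_eq hm _ (diffSin_ne_zero hn hM) (hS c hc hcM) (hC c hc hcM)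
    (hS n le_rfl (by omega)) (hC n le_rfl (by omega))]
  have h := sum_sinProd_decSeq hM 1 c
  have e : (c : ℝ) + (1 : ℕ) - 1 = c := by push_cast; ring
  rw [e] at h
  rw [sq (progSinProd n (Real.pi / (2 * M)) c), ← h]
  field_simp

theorem sinProd_reflect {n : ℕ} {M : ℕ} (hM : 0 < M) (z : Fin n → ℤ) (i : Fin n) :
    sinProd (Real.pi / (2 * M)) (fun j => (Function.update z i (2 * M - z i) j : ℝ)) =
      sinProd (Real.pi / (2 * M)) (fun j => (z j : ℝ)) := by
  have h := sinDet_reflect hM z i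
  rw [sinDet_eq, sinDet_eq] at h
  exact mul_left_cancel₀ (by positivity) h

theorem sum_sinProd_latticeAlcove {n : ℕ} (hn : 2 ≤ n) {M b : ℕ} (hb : b = 1 ∨ b = 2)
    (hM : 2 * n ≤ M) :
    ∑ z : latticeAlcove hn M with z.1 ⟨0, by omega⟩ % 2 = (b : ℤ) % 2,
      sinProd (Real.pi / (2 * M)) (fun j => (z.1 j : ℝ)) =
      (∑ s ∈ decSeq n ((M + 2 - b) / 2),
        sinProd (Real.pi / (2 * M)) (fun j => 2 * (s j : ℝ) + b)) +
      ∑ s ∈ decSeq n ((M + 1 - b) / 2),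
        sinProd (Real.pi / (2 * M)) (fun j => 2 * (s j : ℝ) + b) := by
  rw [sum_latticeAlcove_eq hn M b hb
    (fun z => sinProd (Real.pi / (2 * M)) (fun j => (z j : ℝ)))
    fun z => sinProd_reflect (by omega) z _]
  push_cast
  rfl

theorem growthRate_eq {n M : ℕ} {m : ℝ} (hm : 2 * m = M) :
    growthRate n m = ∏ i : Fin n, (2 * Real.cos ((2 * (i : ℕ) + 1) * (Real.pi / (2 * M)))) := by
  unfold growthRate
  rw [prod_mul_distrib, prod_Icc_one, ← Fin.prod_univ_eq_prod_range
    (fun k => Real.cos ((2 * ((k + 1 : ℕ) : ℝ) - 1) * Real.pi / (4 * m))), ← hm]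
  congr 1
  · simp
  · refine prod_congr rfl fun i _ => ?_
    push_cast
    congr 1
    ring

theorem growthRate_pos {n M : ℕ} {m : ℝ} (hm : 2 * m = M) (hM : 2 * n ≤ M) :
    0 < growthRate n m := by
  rw [growthRate_eq hm]
  refine prod_pos fun i _ => mul_pos two_pos ?_
  rw [mul_comm]
  refine cos_pi_div_mul_pos (by positivity) ?_
  have := i.2
  exact_mod_cast (by omega : 2 * (i : ℕ) + 1 < M)

/-- The parity sign of a lattice point. -/
noncomputable def paritySign {n : ℕ} {hn : 2 ≤ n} {M : ℕ} (z : latticeAlcove hn M) : ℝ :=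
  if z.1 ⟨0, by omega⟩ % 2 = 0 then 1 else -1

theorem paritySign_mul_self {n : ℕ} {hn : 2 ≤ n} {M : ℕ} (z : latticeAlcove hn M) :
    paritySign z * paritySign z = 1 := by
  unfold paritySign
  split_ifs <;> norm_num

theorem paritySign_step {n : ℕ} {hn : 2 ≤ n} {M : ℕ} (x y : latticeAlcove hn M)
    (h : transferMatrix hn M x y ≠ 0) : paritySign y = -paritySign x := by
  have := transferMatrix_ne_zero.1 h ⟨0, by omega⟩
  unfold paritySign
  split_ifs with h1 h2 h2
  · omega
  · norm_num
  · rfl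
  · omega

theorem paritySign_eq_iff {n : ℕ} {hn : 2 ≤ n} {M b : ℕ} (hb : b = 1 ∨ b = 2)
    (z : latticeAlcove hn M) :
    paritySign z = (-1) ^ b ↔ z.1 ⟨0, by omega⟩ % 2 = (b : ℤ) % 2 := by
  unfold paritySign
  rcases hb with rfl | rfl
  · split_ifs with h
    · norm_num
      omega
    · norm_num
      omega
  · split_ifs with h
    · norm_num
      omega
    · norm_num
      omega

end Assembly

/-! ### Asymptotic equivalence per parity class and the degenerate case. -/

section Asymptotics

/-- The two factors `2^(n(n-1))` come from the eigenvector at the start and in the class sum, the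
denominator from its squared norm; `n(n-1) + n = n²` yields the power of `4`. -/
theorem limit_constant_eq {n : ℕ} (hn : 1 ≤ n) {M m : ℝ} (hm : 2 * m = M) (hM : 0 < M)
    (V S : ℝ) :
    2 ^ (n * (n - 1)) * V * (2 ^ (n * (n - 1)) * S) / (2 * (M / 4) ^ n) =
      4 ^ (n ^ 2) / (2 * (2 * m) ^ n) * V * S := by
  have e1 : (4 : ℝ) ^ (n ^ 2) = 2 ^ (n * (n - 1)) * 2 ^ (n * (n - 1)) * 4 ^ n := by
    rw [← mul_pow, show (2 : ℝ) * 2 = 4 by norm_num, ← pow_add]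
    congr 1
    obtain ⟨N, rfl⟩ : ∃ N, n = N + 1 := ⟨n - 1, by omega⟩
    simp only [Nat.add_sub_cancel]
    ring
  rw [e1, hm, div_pow]
  field_simp

theorem sum_paritySign_class {n : ℕ} {hn : 2 ≤ n} {M b : ℕ} (hb : b = 1 ∨ b = 2)
    [DecidablePred fun z : latticeAlcove hn M => paritySign z = (-1) ^ b]
    (f : latticeAlcove hn M → ℝ) :
    ∑ z with paritySign z = (-1) ^ b, f z =
      ∑ z : latticeAlcove hn M with z.1 ⟨0, by omega⟩ % 2 = (b : ℤ) % 2, f z := by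
  refine sum_congr ?_ fun _ _ => rfl
  ext z
  simp only [mem_filter, mem_univ, true_and]
  exact paritySign_eq_iff hb z

theorem tendsto_numDiagonalWalks_div {n : ℕ} {hn : 2 ≤ n} {M b : ℕ} (hb : b = 1 ∨ b = 2)
    (hM : 2 * n ≤ M) {m : ℝ} (hm : 2 * m = M) (x : latticeAlcove hn M) :
    Tendsto (fun k : ℕ => (numDiagonalWalks (alcoveB hn m) (halve x.1) k : ℝ) /
        growthRate n m ^ k)
      (atTop ⊓ 𝓟 {k : ℕ | (-1) ^ k * paritySign x = (-1) ^ b})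
      (𝓝 (4 ^ (n ^ 2) / (2 * (2 * m) ^ n) *
        sinProd (Real.pi / (2 * M)) (fun j => (x.1 j : ℝ)) *
        ∑ z : latticeAlcove hn M with z.1 ⟨0, by omega⟩ % 2 = (b : ℤ) % 2,
          sinProd (Real.pi / (2 * M)) (fun j => (z.1 j : ℝ)))) := by
  classical
  have hz₀ : paritySign (hn := hn) (M := M)
      ⟨_, two_mul_rev_add_mem_latticeAlcove hn hM hb⟩ = (-1) ^ b := by
    rw [paritySign_eq_iff hb]
    change (2 * _ + (b : ℤ)) % 2 = _
    omega
  have hlim := tendsto_pow_mulVec_one_div (transferMatrix_nonneg hn M)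
    (transferMatrix_isSymm hn M) (reflTransGen_transferMatrix hn M)
    (s := paritySign) paritySign_mul_self paritySign_step
    (v := fun z => sinDet (Real.pi / (2 * M)) (fun j => (z.1 j : ℝ)))
    (fun z => sinDet_pos z.2) (growthRate_pos (n := n) hm hM)
    (by rw [growthRate_eq hm]; exact transferMatrix_mulVec_sinDet hn M)
    x ((-1) ^ b) ⟨_, hz₀⟩
  rw [sum_paritySign_class hb, sum_paritySign_class hb,
    sum_sinDet_sq_latticeAlcove hn hb hM] at hlim
  simp only [sinDet_eq, ← mul_sum] at hlim
  rw [limit_constant_eq (by omega) hm (by exact_mod_cast (by omega : 0 < M))] at hlim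
  refine hlim.congr fun k => ?_
  rw [(diagonalWalks_finite_and_ncard hm k x).2]

theorem isEquivalent_numDiagonalWalks {n : ℕ} {hn : 2 ≤ n} {M b : ℕ} (hb : b = 1 ∨ b = 2)
    (hM : 2 * n ≤ M) {m : ℝ} (hm : 2 * m = M) (x : latticeAlcove hn M) :
    Asymptotics.IsEquivalent (atTop ⊓ 𝓟 {k : ℕ | (-1) ^ k * paritySign x = (-1) ^ b})
      (fun k : ℕ => (numDiagonalWalks (alcoveB hn m) (halve x.1) k : ℝ))
      (fun k : ℕ => 4 ^ (n ^ 2) / (2 * (2 * m) ^ n) * growthRate n m ^ k *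
        sinProd (Real.pi / (2 * M)) (fun j => (x.1 j : ℝ)) *
        ((∑ s ∈ decSeq n ((M + 2 - b) / 2),
          sinProd (Real.pi / (2 * M)) (fun j => 2 * (s j : ℝ) + b)) +
        ∑ s ∈ decSeq n ((M + 1 - b) / 2),
          sinProd (Real.pi / (2 * M)) (fun j => 2 * (s j : ℝ) + b))) := by
  have hR := growthRate_pos (n := n) hm hM
  have hM0 : (0 : ℝ) < M := by exact_mod_cast (by omega : 0 < M)
  have hVpos := sinProd_pos x.2
  have hSpos : 0 < ∑ z : latticeAlcove hn M with z.1 ⟨0, by omega⟩ % 2 = (b : ℤ) % 2,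
      sinProd (Real.pi / (2 * M)) (fun j => (z.1 j : ℝ)) := by
    refine sum_pos (fun z _ => sinProd_pos z.2)
      ⟨⟨_, two_mul_rev_add_mem_latticeAlcove hn hM hb⟩, mem_filter.2 ⟨mem_univ _, ?_⟩⟩
    change (2 * _ + (b : ℤ)) % 2 = _
    omega
  have hlim := tendsto_numDiagonalWalks_div hb hM hm x
  rw [sum_sinProd_latticeAlcove hn hb hM] at hlim hSpos
  generalize sinProd (Real.pi / (2 * M)) (fun j => (x.1 j : ℝ)) = V at *
  generalize (∑ s ∈ decSeq n ((M + 2 - b) / 2),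
          sinProd (Real.pi / (2 * M)) (fun j => 2 * (s j : ℝ) + b)) +
        ∑ s ∈ decSeq n ((M + 1 - b) / 2),
          sinProd (Real.pi / (2 * M)) (fun j => 2 * (s j : ℝ) + b) = S at *
  have hL : 4 ^ (n ^ 2) / (2 * (2 * m) ^ n) * V * S ≠ 0 := by
    rw [hm]
    positivity
  have h2 := ((Asymptotics.isEquivalent_const_iff_tendsto hL).2 hlim).mul
    (Asymptotics.IsEquivalent.refl (u := fun k : ℕ => growthRate n m ^ k))
  refine (h2.congr_left ?_).congr_right ?_
  · refine Eventually.of_forall fun k => ?_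
    simp only [Pi.mul_apply]
    rw [div_mul_cancel₀ _ (pow_pos hR k).ne']
  · refine Eventually.of_forall fun k => ?_
    simp only [Pi.mul_apply, Function.const_apply]
    ring

theorem neg_one_pow_mul_paritySign_eq_iff {n : ℕ} {hn : 2 ≤ n} {M : ℕ} (x : latticeAlcove hn M)
    (k b : ℕ) : (-1) ^ k * paritySign x = (-1) ^ b ↔
      ((k : ℤ) + x.1 ⟨0, by omega⟩) % 2 = (b : ℤ) % 2 := by
  unfold paritySign
  have hk := Nat.even_or_odd k
  have hb := Nat.even_or_odd b
  rw [Nat.even_iff, Nat.odd_iff] at hk hb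
  rw [neg_one_pow_eq_ite, neg_one_pow_eq_ite]
  simp only [Nat.even_iff]
  split_ifs <;> norm_num <;> omega

theorem exists_parity_iff {n : ℕ} {hn : 2 ≤ n} {M : ℕ} (x : latticeAlcove hn M) (k : ℕ)
    (p : ℤ → Prop) (q : ℤ) (hp : ∀ l, p l ↔ l % 2 = q) :
    (∀ j, ∃ l : ℤ, p l ∧ (k : ℝ) + 2 * halve x.1 j = l) ↔
      ((k : ℤ) + x.1 ⟨0, by omega⟩) % 2 = q := by
  have e : ∀ j, (k : ℝ) + 2 * halve x.1 j = ((k + x.1 j : ℤ) : ℝ) := fun j => by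
    unfold halve
    push_cast
    ring
  simp only [e, Int.cast_inj, hp]
  constructor
  · intro h
    obtain ⟨l, h1, h2⟩ := h ⟨0, by omega⟩
    omega
  · intro h j
    have := x.2.2.2.2 ⟨0, by omega⟩ j
    exact ⟨_, by omega, rfl⟩

theorem evenSteps_halve {n : ℕ} {hn : 2 ≤ n} {M : ℕ} (x : latticeAlcove hn M) :
    evenSteps (halve x.1) = atTop ⊓ 𝓟 {k : ℕ | (-1) ^ k * paritySign x = (-1) ^ 2} := by
  unfold evenSteps
  congr 2
  ext k
  exact (exists_parity_iff x k _ 0 fun l => Int.even_iff).trans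
    (neg_one_pow_mul_paritySign_eq_iff x k 2).symm

theorem oddSteps_halve {n : ℕ} {hn : 2 ≤ n} {M : ℕ} (x : latticeAlcove hn M) :
    oddSteps (halve x.1) = atTop ⊓ 𝓟 {k : ℕ | (-1) ^ k * paritySign x = (-1) ^ 1} := by
  unfold oddSteps
  congr 2
  ext k
  exact (exists_parity_iff x k _ 1 fun l => Int.odd_iff).trans
    (neg_one_pow_mul_paritySign_eq_iff x k 1).symm

/-- A nonempty alcove contains the minimal point, whose first two coordinates give `(2n-1) + (2n-3)
< 2M`. -/
theorem le_of_mem_latticeAlcove {n : ℕ} {hn : 2 ≤ n} {M : ℕ} (x : latticeAlcove hn M) :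
    2 * n ≤ M + 1 := by
  have h0 : 0 ≤ ∑ j, x.1 j := sum_nonneg fun j _ => (x.2.2.1 j).le
  obtain ⟨b, hb, -⟩ := exists_reflTransGen_stepAdj hn M _ x (Int.toNat_of_nonneg h0).symm
  have := b.2.2.2.1
  rw [hb, hb, Fin.val_rev, Fin.val_rev] at this
  simp only at this
  omega

theorem growthRate_eq_zero {n M : ℕ} {m : ℝ} (hn : 1 ≤ n) (hm : 2 * m = M) (hM : M + 1 = 2 * n) :
    growthRate n m = 0 := by
  rw [growthRate_eq hm]
  refine prod_eq_zero (mem_univ ⟨n - 1, by omega⟩) ?_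
  have hM' : (M : ℝ) + 1 = 2 * n := by exact_mod_cast hM
  have hM0 : (M : ℝ) ≠ 0 := by exact_mod_cast (by omega : M ≠ 0)
  have e : (2 * ((n - 1 : ℕ) : ℝ) + 1) * (Real.pi / (2 * M)) = Real.pi / 2 := by
    rw [Nat.cast_sub hn, Nat.cast_one, show 2 * ((n : ℝ) - 1) + 1 = M by linarith]
    field_simp
  simp only [e, Real.cos_pi_div_two, mul_zero]

/-- A nonnegative matrix that annihilates a positive vector is zero, so not even one step is
possible. -/
theorem numDiagonalWalks_succ_eq_zero {n : ℕ} {hn : 2 ≤ n} {M : ℕ} {m : ℝ} (hm : 2 * m = M)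
    (hR : growthRate n m = 0) (x : latticeAlcove hn M) (k : ℕ) :
    numDiagonalWalks (alcoveB hn m) (halve x.1) (k + 1) = 0 := by
  classical
  have hT : transferMatrix hn M = 0 := by
    have h := transferMatrix_mulVec_sinDet hn M
    rw [← growthRate_eq hm, hR, zero_smul] at h
    ext y z
    have h1 := congrFun h y
    simp only [mulVec, dotProduct, Pi.zero_apply] at h1
    rw [sum_eq_zero_iff_of_nonneg fun w _ =>
      mul_nonneg (transferMatrix_nonneg hn M y w) (sinDet_pos w.2).le] at h1
    exact (mul_eq_zero.1 (h1 z (mem_univ z))).resolve_right (sinDet_pos z.2).ne'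
  have := (diagonalWalks_finite_and_ncard hm (k + 1) x).2
  rw [hT, zero_pow (by omega), zero_mulVec, Pi.zero_apply] at this
  exact_mod_cast this

/-- Both sides vanish from `k = 1` on, whatever the constants, so ill-defined factors of `P` and `Q`
do no harm. -/
theorem isEquivalent_of_growthRate_eq_zero {n : ℕ} {hn : 2 ≤ n} {M : ℕ} {m : ℝ} (hm : 2 * m = M)
    (hR : growthRate n m = 0) (x : latticeAlcove hn M) {l : Filter ℕ} (hl : l ≤ atTop)
    (a b c : ℝ) :
    Asymptotics.IsEquivalent l
      (fun k : ℕ => (numDiagonalWalks (alcoveB hn m) (halve x.1) k : ℝ))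
      (fun k : ℕ => a * growthRate n m ^ k * b * c) := by
  refine EventuallyEq.isEquivalent (hl ?_)
  filter_upwards [eventually_ge_atTop 1] with k hk
  obtain ⟨k, rfl⟩ : ∃ l, k = l + 1 := ⟨k - 1, by omega⟩
  rw [numDiagonalWalks_succ_eq_zero hm hR, hR, pow_succ]
  simp

theorem isEquivalent_evenSteps {n : ℕ} {hn : 2 ≤ n} {M : ℕ} (hM : 2 * n ≤ M) {m : ℝ}
    (hm : 2 * m = M) (x : latticeAlcove hn M) :
    Asymptotics.IsEquivalent (evenSteps (halve x.1))
      (fun k : ℕ => (numDiagonalWalks (alcoveB hn m) (halve x.1) k : ℝ))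
      (fun k : ℕ => 4 ^ (n ^ 2) / (2 * (2 * m) ^ n) * growthRate n m ^ k *
        startFactorEven m (halve x.1) *
        (endFactorEven n m (M / 2 : ℕ) + endFactorEven n m ((M - 1) / 2 : ℕ))) := by
  rw [evenSteps_halve]
  have h := isEquivalent_numDiagonalWalks (b := 2) (Or.inr rfl) hM hm x
  rw [sum_sinProd_even hn hM hm, sum_sinProd_even hn hM hm, Nat.add_sub_cancel,
    show M + 1 - 2 = M - 1 by omega] at h
  refine h.congr_right (Eventually.of_forall fun k => ?_)
  simp only [startFactorEven_halve hm]
  ring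

theorem isEquivalent_oddSteps {n : ℕ} {hn : 2 ≤ n} {M : ℕ} (hM : 2 * n ≤ M) {m : ℝ}
    (hm : 2 * m = M) (x : latticeAlcove hn M) :
    Asymptotics.IsEquivalent (oddSteps (halve x.1))
      (fun k : ℕ => (numDiagonalWalks (alcoveB hn m) (halve x.1) k : ℝ))
      (fun k : ℕ => 4 ^ (n ^ 2) / (2 * (2 * m) ^ n) * growthRate n m ^ k *
        startFactorOdd m (halve x.1) *
        (endFactorOdd n m ((M + 1) / 2 : ℕ) + endFactorOdd n m (M / 2 : ℕ))) := by
  rw [oddSteps_halve]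
  have h := isEquivalent_numDiagonalWalks (b := 1) (Or.inl rfl) hM hm x
  rw [Nat.add_sub_cancel, show M + 2 - 1 = M + 1 by omega,
    sum_sinProd_odd hn hM hm (by omega) (by omega),
    sum_sinProd_odd hn hM hm (by omega) (by omega)] at h
  refine h.congr_right (Eventually.of_forall fun k => ?_)
  simp only [startFactorOdd_halve hm]
  ring

theorem exists_halve_eq {n : ℕ} {hn : 2 ≤ n} {M : ℕ} {m : ℝ} (hm : 2 * m = M) {η : Fin n → ℝ}
    (hη : (∀ j, IsInteger (η j)) ∨ (∀ j, IsHalfInteger (η j))) (hηA : η ∈ alcoveB hn m) :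
    ∃ x : latticeAlcove hn M, halve x.1 = η := by
  obtain ⟨z, hz, hp⟩ : ∃ z : Fin n → ℤ, halve z = η ∧ ∀ i j, z i % 2 = z j % 2 := by
    rcases hη with h | h
    · choose z hz using h
      refine ⟨fun j => 2 * z j, ?_, fun i j => by dsimp only; omega⟩
      funext j
      rw [hz, halve]
      push_cast
      ring
    · choose z hz using h
      refine ⟨fun j => 2 * z j + 1, ?_, fun i j => by dsimp only; omega⟩
      funext j
      rw [hz, halve]
      push_cast
      ring
  rw [← hz, halve_mem_alcoveB hm] at hηA
  exact ⟨⟨z, hηA.1, hηA.2.1, hηA.2.2, hp⟩, hz⟩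

theorem IsInteger.exists_nat {m : ℝ} (h : IsInteger m) (hm : 0 < m) :
    ∃ N : ℕ, 1 ≤ N ∧ m = N := by
  obtain ⟨z, rfl⟩ := h
  have hz : 0 < z := by exact_mod_cast hm
  lift z to ℕ using hz.le
  exact ⟨z, by omega, by simp⟩

theorem IsHalfInteger.exists_nat {m : ℝ} (h : IsHalfInteger m) (hm : 0 < m) :
    ∃ N : ℕ, m = N + 1 / 2 := by
  obtain ⟨z, rfl⟩ := h
  have hz : 0 < 2 * z + 1 := by
    have : (0 : ℝ) < 2 * z + 1 := by linarith
    exact_mod_cast this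
  lift z to ℕ using (by omega)
  exact ⟨z, by push_cast; ring⟩

end Asymptotics

end AlcoveWalk

theorem mainTheorem11 (n : ℕ) (hn : 2 ≤ n) (m : ℝ) (hm : 0 < m)
    (hmint : AlcoveWalk.IsInteger m ∨ AlcoveWalk.IsHalfInteger m)
    (η : Fin n → ℝ)
    (hη : (∀ j, AlcoveWalk.IsInteger (η j)) ∨ (∀ j, AlcoveWalk.IsHalfInteger (η j)))
    (hηA : η ∈ AlcoveWalk.alcoveB hn m) :
    (AlcoveWalk.IsInteger m →
      Asymptotics.IsEquivalent (AlcoveWalk.evenSteps η)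
        (fun k : ℕ => (AlcoveWalk.numDiagonalWalks (AlcoveWalk.alcoveB hn m) η k : ℝ))
        (fun k : ℕ => 4 ^ (n ^ 2) / (2 * (2 * m) ^ n) * AlcoveWalk.growthRate n m ^ k *
          AlcoveWalk.startFactorEven m η *
          (AlcoveWalk.endFactorEven n m m + AlcoveWalk.endFactorEven n m (m - 1)))) ∧
    (AlcoveWalk.IsHalfInteger m →
      Asymptotics.IsEquivalent (AlcoveWalk.evenSteps η)
        (fun k : ℕ => (AlcoveWalk.numDiagonalWalks (AlcoveWalk.alcoveB hn m) η k : ℝ))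
        (fun k : ℕ => 4 ^ (n ^ 2) / (2 * m) ^ n * AlcoveWalk.growthRate n m ^ k *
          AlcoveWalk.startFactorEven m η * AlcoveWalk.endFactorEven n m ⌊m⌋)) ∧
    (AlcoveWalk.IsInteger m →
      Asymptotics.IsEquivalent (AlcoveWalk.oddSteps η)
        (fun k : ℕ => (AlcoveWalk.numDiagonalWalks (AlcoveWalk.alcoveB hn m) η k : ℝ))
        (fun k : ℕ => 4 ^ (n ^ 2) / (2 * m) ^ n * AlcoveWalk.growthRate n m ^ k *
          AlcoveWalk.startFactorOdd m η * AlcoveWalk.endFactorOdd n m m)) ∧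
    (AlcoveWalk.IsHalfInteger m →
      Asymptotics.IsEquivalent (AlcoveWalk.oddSteps η)
        (fun k : ℕ => (AlcoveWalk.numDiagonalWalks (AlcoveWalk.alcoveB hn m) η k : ℝ))
        (fun k : ℕ => 4 ^ (n ^ 2) / (2 * (2 * m) ^ n) * AlcoveWalk.growthRate n m ^ k *
          AlcoveWalk.startFactorOdd m η *
          (AlcoveWalk.endFactorOdd n m ⌈m⌉ + AlcoveWalk.endFactorOdd n m ⌊m⌋))) := by
  refine ⟨fun h => ?_, fun h => ?_, fun h => ?_, fun h => ?_⟩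
  · obtain ⟨N, hN, rfl⟩ := h.exists_nat hm
    have hM : 2 * (N : ℝ) = (2 * N : ℕ) := by push_cast; rfl
    obtain ⟨x, rfl⟩ := AlcoveWalk.exists_halve_eq hM hη hηA
    have h2 := AlcoveWalk.le_of_mem_latticeAlcove x
    have := AlcoveWalk.isEquivalent_evenSteps (by omega) hM x
    -- For `M = 2N` the two truncations in the even class are `N` and `N - 1`, giving `P(m) +
    -- P(m-1)`.
    rwa [show 2 * N / 2 = N by omega, show (2 * N - 1) / 2 = N - 1 by omega,
      Nat.cast_sub hN, Nat.cast_one] at this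
  · obtain ⟨N, rfl⟩ := h.exists_nat hm
    have hM : 2 * ((N : ℝ) + 1 / 2) = (2 * N + 1 : ℕ) := by push_cast; ring
    have hfl : ⌊(N : ℝ) + 1 / 2⌋ = N := by
      rw [Int.floor_eq_iff]
      constructor <;> push_cast <;> linarith
    obtain ⟨x, rfl⟩ := AlcoveWalk.exists_halve_eq hM hη hηA
    have h2 := AlcoveWalk.le_of_mem_latticeAlcove x
    -- Since `2n ≤ M + 1` always holds, failure means `M = 2n - 1`, the degenerate case; for even
    -- `M` parity rules it out.
    by_cases hnM : 2 * n ≤ 2 * N + 1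
    · have := AlcoveWalk.isEquivalent_evenSteps hnM hM x
      -- Both truncations equal `N = ⌊m⌋`, so the bracket is `2P(⌊m⌋)` and the factor `1/2` cancels.
      rw [show (2 * N + 1) / 2 = N by omega, show (2 * N + 1 - 1) / 2 = N by omega] at this
      rw [hfl, Int.cast_natCast]
      refine this.congr_right (Filter.Eventually.of_forall fun k => ?_)
      field_simp
      ring
    · exact AlcoveWalk.isEquivalent_of_growthRate_eq_zero hM
        (AlcoveWalk.growthRate_eq_zero (by omega) hM (by omega)) x inf_le_left _ _ _
  · obtain ⟨N, hN, rfl⟩ := h.exists_nat hm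
    have hM : 2 * (N : ℝ) = (2 * N : ℕ) := by push_cast; rfl
    obtain ⟨x, rfl⟩ := AlcoveWalk.exists_halve_eq hM hη hηA
    have h2 := AlcoveWalk.le_of_mem_latticeAlcove x
    have := AlcoveWalk.isEquivalent_oddSteps (by omega) hM x
    rw [show 2 * N / 2 = N by omega, show (2 * N + 1) / 2 = N by omega] at this
    refine this.congr_right (Filter.Eventually.of_forall fun k => ?_)
    field_simp
    ring
  · obtain ⟨N, rfl⟩ := h.exists_nat hm
    have hM : 2 * ((N : ℝ) + 1 / 2) = (2 * N + 1 : ℕ) := by push_cast; ring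
    have hfl : ⌊(N : ℝ) + 1 / 2⌋ = N := by
      rw [Int.floor_eq_iff]
      constructor <;> push_cast <;> linarith
    have hcl : ⌈(N : ℝ) + 1 / 2⌉ = (N + 1 : ℕ) := by
      rw [Int.ceil_eq_iff]
      constructor <;> push_cast <;> linarith
    obtain ⟨x, rfl⟩ := AlcoveWalk.exists_halve_eq hM hη hηA
    have h2 := AlcoveWalk.le_of_mem_latticeAlcove x
    by_cases hnM : 2 * n ≤ 2 * N + 1
    · have := AlcoveWalk.isEquivalent_oddSteps hnM hM x
      -- Here the reflection-fixed coordinate `M` is odd and belongs to the class of end points, so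
      -- the truncations differ: `N + 1 = ⌈m⌉` and `N = ⌊m⌋`.
      rw [show (2 * N + 1) / 2 = N by omega, show (2 * N + 1 + 1) / 2 = N + 1 by omega] at this
      rwa [hfl, hcl, Int.cast_natCast, Int.cast_natCast]
    · exact AlcoveWalk.isEquivalent_of_growthRate_eq_zero hM
        (AlcoveWalk.growthRate_eq_zero (by omega) hM (by omega)) x inf_le_left _ _ _
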